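/- **Conventions.** An *ample groupoid* is a locally compact Hausdorff topological groupoid $G$ with base space $G^0$, range and source maps $r,s:G\to G^0$ (so $gh$ is defined when $s(g)=r(h)$), which is étale and whose topology has a basis of compact open bisections. It is *principal* if $r(g)=s(g)$ implies that $g$ is a unit. For a locally compact Hausdorff space $X$, $\mathbb Z[X]$ denotes the group of continuous compactly supported functions $X\to\mathbb Z$; a local homeomorphism $f:X\to Y$ induces $f_*:\mathbb Z[X]\to\mathbb Z[Y]$, $f_*(a)(y)=\sum_{x\in f^{-1}(y)}a(x)$. A *$G$-space* is a locally compact Hausdorff space $X$ with an étale anchor map $r:X\to G^0$ and a continuous action $(g,x)\mapsto gx$, defined when $s(g)=r(x)$; morphisms of $G$-spaces are equivariant étale maps. $\mathbb Z[G]$ acts on $\mathbb Z[X]$ by $(fa)(x)=\sum_{r(g)=r(x)}f(g)\,a(g^{-1}x)$. Let $\varepsilon:\mathbb Z[G]\to\mathbb Z[G^0]\subseteq\mathbb Z[G]$, $\varepsilon(f)(x)=\sum_{s(g)=x}f(g)$ (extended by zero off the units). The *coinvariants* $\mathbb Z[X]_G$ are the quotient of $\mathbb Z[X]$ by the subgroup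 generated by all $fa-\varepsilon(f)a$, $f\in\mathbb Z[G]$, $a\in\mathbb Z[X]$. The homology $H_*(X_*)$ of a semi-simplicial $G$-space $X_*$ (a sequence of $G$-spaces with face maps that are morphisms of $G$-spaces) is the homology of the complex $\mathbb Z[X_n]_G$ with differential $\sum_i(-1)^i(\partial_i)_*$. It is functorial for morphisms of semi-simplicial $G$-spaces (sequences of morphisms of $G$-spaces commuting with the face maps). The homology $H_*(G)$ is the Crainic–Moerdijk–Matui homology: the homology of the complex $\mathbb Z[BG_n]$ with differential $\sum_i(-1)^i(\partial_i)_*$, where $BG_0=G^0$, $BG_n$ $(n\ge1)$ is the space of composable strings $(g_1,\dots,g_n)$, and $\partial_i$ are the usual face maps ($\partial_0=s$ and $\partial_1=r$ on $BG_1$; for $n\ge 2$, $\partial_0$ and $\partial_n$ drop $g_1$ and $g_n$ respectively, and $\partial_i$ multiplies $g_i$ with $g_{i+1}$ for $0<i<n$). A *colouring* $\mathcal C$ of $G$ is a finite tuple $(G_0,\dots,G_d)$ of compact open subgroupoids of $G$ whose unit spaces cover $G^0$. Write $G_i^x=\{h\in G_i: r(h)=x\}$. The *nerve* $\mathcal N_*$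 of $\mathcal C$ is the following semi-simplicial $G$-space. $\mathcal N_0$ is the set of pairs $(gG_i^{s(g)},i)$ with $g\in G$, $0\le i\le d$ and $G_i^{s(g)}\neq\varnothing$, with the topology generated by the sets $\{(gG_i^{s(g)},i): g\in V\}$, where $V\subseteq G$ is open and $G_i^{s(g)}\ne\varnothing$ for all $g\in V$. $\mathcal N_n\subseteq\mathcal N_0^{n+1}$ is the subspace of tuples $(U_0,\dots,U_n)$ whose underlying sets have non-empty intersection in $G$. The anchor map is $(gG_i^{s(g)},i)\mapsto r(g)$ (the same for all entries of a tuple), $G$ acts entrywise by left multiplication, and $\partial_i$ omits $U_i$. Put $H_*(\mathcal C):=H_*(\mathcal N_*)$. An *anti-Čech sequence* $\mathcal A$ for $G$ consists of colourings $(\mathcal C_m)_{m=0}^\infty$ with nerves $\mathcal N^{(m)}_*$ and, for each $m\ge1$, a morphism of semi-simplicial $G$-spaces $\iota^{(m)}:\mathcal N_*^{(m-1)}\to\mathcal N_*^{(m)}$ such that $\iota^{(m)}(U)\supseteq U$ for all $U\in\mathcal N^{(m-1)}_0$, and such that for every compact open $K\subseteq G$ there is $m_K$ with $\iota^{(m)}(U)\supseteq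 UK$ for all $m\ge m_K$ and all $U\in\mathcal N_0^{(m-1)}$ (inclusions between the underlying subsets of $G$; $UK$ is the set of all products $uk$ with $u\in U$, $k\in K$, $s(u)=r(k)$). Its homology is $H_*(\mathcal A):=\varinjlim_m H_*(\mathcal C_m)$ along the maps $\iota^{(m)}_*$. **Theorem.** Let $G$ be a principal, $\sigma$-compact ample groupoid with compact base space $G^0$, and let $\mathcal A$ be an anti-Čech sequence for $G$. Then $H_n(\mathcal A)\cong H_n(G)$ as abelian groups for every $n\ge0$. -/

import Mathlib

namespace AntiCech

open Topology Filter CategoryTheory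
open scoped CompactlySupported

universe u v w

section Etale

variable {X : Type u} {Y : Type v} {Z : Type w}
  [TopologicalSpace X] [TopologicalSpace Y] [TopologicalSpace Z]

theorem isLocalHomeomorph_of_injOn {f : X → Z} (hc : Continuous f) (ho : IsOpenMap f)
    (hi : ∀ x, ∃ U ∈ 𝓝 x, Set.InjOn f U) : IsLocalHomeomorph f := by
  rw [isLocalHomeomorph_iff_isOpenEmbedding_restrict]
  intro x
  obtain ⟨U, hU, hinj⟩ := hi x
  refine ⟨interior U, interior_mem_nhds.2 hU, ?_⟩
  refine IsOpenEmbedding.of_continuous_injective_isOpenMap (hc.comp continuous_subtype_val) ?_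
    (ho.comp isOpen_interior.isOpenMap_subtype_val)
  exact Set.injOn_iff_injective.1 (hinj.mono interior_subset)

theorem nhds_le_map_of_section {P : X → Prop} {F : X → Z} (x : {x // P x}) (τ : Z → X)
    (hτ : ContinuousAt τ (F x)) (h0 : τ (F x) = x) (hP : ∀ᶠ z in 𝓝 (F x), P (τ z))
    (hF : ∀ᶠ z in 𝓝 (F x), F (τ z) = z) :
    𝓝 (F x) ≤ Filter.map (fun y : {x // P x} => F y) (𝓝 x) := by
  intro A hA
  rw [Filter.mem_map, nhds_subtype_eq_comap, Filter.mem_comap] at hA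
  obtain ⟨V, hV, hVA⟩ := hA
  have hV' : ∀ᶠ z in 𝓝 (F x), τ z ∈ V := hτ.eventually (by rw [h0]; exact hV)
  filter_upwards [hV', hP, hF] with z h1 h2 h3
  have : F (τ z) ∈ A := hVA (show (⟨τ z, h2⟩ : {x // P x}) ∈ Subtype.val ⁻¹' V from h1)
  rwa [h3] at this

theorem exists_section {f : X → Z} (hf : IsLocalHomeomorph f) (x : X) :
    ∃ τ : Z → X, ContinuousAt τ (f x) ∧ τ (f x) = x ∧ (∀ᶠ z in 𝓝 (f x), f (τ z) = z) ∧
      ∀ᶠ y in 𝓝 x, τ (f y) = y := by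
  obtain ⟨e, hx, rfl⟩ := hf x
  exact ⟨e.symm, e.continuousAt_symm (e.map_source hx), e.left_inv hx,
    e.eventually_right_inverse (e.map_source hx), e.eventually_left_inverse hx⟩

theorem isLocalHomeomorph_pullback_fst {f : X → Z} {g : Y → Z} (hf : Continuous f)
    (hg : IsLocalHomeomorph g) :
    IsLocalHomeomorph (fun q : {q : X × Y // f q.1 = g q.2} => q.1.1) := by
  refine isLocalHomeomorph_of_injOn (by fun_prop) (IsOpenMap.of_nhds_le fun q => ?_) fun q => ?_
  · obtain ⟨τ, h1, h2, h3, -⟩ := exists_section hg q.1.2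
    have hfq : Tendsto f (𝓝 q.1.1) (𝓝 (g q.1.2)) := by
      rw [← q.2]; exact hf.continuousAt
    refine nhds_le_map_of_section (F := Prod.fst) q (fun x => (x, τ (f x))) ?_ ?_ ?_ ?_
    · refine continuousAt_id.prodMk ?_
      have : ContinuousAt τ (f q.1.1) := by rw [q.2]; exact h1
      exact this.comp hf.continuousAt
    · ext
      · rfl
      · simp [q.2, h2]
    · filter_upwards [hfq.eventually h3] with x hx using hx.symm
    · exact Eventually.of_forall fun x => rfl
  · obtain ⟨τ, -, -, -, h4⟩ := exists_section hg q.1.2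
    refine ⟨{q' | τ (g q'.1.2) = q'.1.2}, ?_, ?_⟩
    · exact (continuous_snd.comp continuous_subtype_val).continuousAt.eventually h4
    · rintro ⟨⟨a, b⟩, h⟩ hq ⟨⟨a', b'⟩, h'⟩ hq' (rfl : a = a')
      simp only [Set.mem_ofPred_eq] at hq hq' h h'
      have : b = b' := by rw [← hq, ← hq', ← h, ← h']
      subst this; rfl

theorem isLocalHomeomorph_pullback_snd {f : X → Z} {g : Y → Z} (hf : IsLocalHomeomorph f)
    (hg : Continuous g) :
    IsLocalHomeomorph (fun q : {q : X × Y // f q.1 = g q.2} => q.1.2) := by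
  let e : {q : X × Y // f q.1 = g q.2} ≃ₜ {q : Y × X // g q.1 = f q.2} :=
    { toFun := fun q => ⟨(q.1.2, q.1.1), q.2.symm⟩
      invFun := fun q => ⟨(q.1.2, q.1.1), q.2.symm⟩
      left_inv := fun q => rfl
      right_inv := fun q => rfl
      continuous_toFun := by fun_prop
      continuous_invFun := by fun_prop }
  exact (isLocalHomeomorph_pullback_fst hg hf).comp e.isLocalHomeomorph

theorem isLocalHomeomorph_of_surjective {f : X → Y} {g : Y → Z} (hf : IsLocalHomeomorph f)
    (hs : Function.Surjective f) (hgf : IsLocalHomeomorph (g ∘ f)) : IsLocalHomeomorph g := by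
  have := (hgf.isLocalHomeomorphOn (s := Set.univ)).of_comp_right hf.isLocalHomeomorphOn
  rw [Set.image_univ, hs.range_eq] at this
  exact isLocalHomeomorph_iff_isLocalHomeomorphOn_univ.2 this

theorem locallyCompactSpace_of_isLocalHomeomorph [LocallyCompactSpace Z] {f : X → Z}
    (hf : IsLocalHomeomorph f) : LocallyCompactSpace X := by
  refine ⟨fun x N hN => ?_⟩
  obtain ⟨e, hx, rfl⟩ := hf x
  have : LocallyCompactSpace e.source := e.isOpenEmbedding_restrict.locallyCompactSpace
  obtain ⟨K, hK, hKN, hKc⟩ := this.local_compact_nhds ⟨x, hx⟩ (Subtype.val ⁻¹' N)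
    (continuous_subtype_val.continuousAt hN)
  refine ⟨Subtype.val '' K, ?_, by simpa using hKN, hKc.image continuous_subtype_val⟩
  exact e.open_source.isOpenMap_subtype_val.image_mem_nhds hK

theorem isLocalHomeomorph_fibrePower {f : X → Z} (hf : IsLocalHomeomorph f) (n : ℕ) :
    IsLocalHomeomorph (fun y : {y : Fin (n + 1) → X // ∀ i, f (y i) = f (y 0)} => f (y.1 0)) := by
  refine isLocalHomeomorph_of_injOn
    (hf.continuous.comp ((continuous_apply 0).comp continuous_subtype_val))
    (IsOpenMap.of_nhds_le fun y => ?_) fun y => ?_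
  · choose τ h1 h2 h3 h4 using fun i => exists_section hf (y.1 i)
    have hall : ∀ᶠ z in 𝓝 (f (y.1 0)), ∀ i, f (τ i z) = z := by
      rw [eventually_all]
      intro i
      have := h3 i
      rwa [y.2 i] at this
    refine nhds_le_map_of_section (F := fun y : Fin (n + 1) → X => f (y 0)) y
      (fun z i => τ i z) ?_ ?_ ?_ ?_
    · refine continuousAt_pi.2 fun i => ?_
      have := h1 i
      rwa [y.2 i] at this
    · funext i
      have := h2 i
      rwa [y.2 i] at this
    · filter_upwards [hall] with z hz i
      rw [hz, hz]
    · filter_upwards [hall] with z hz using hz 0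
  · choose τ h1 h2 h3 h4 using fun i => exists_section hf (y.1 i)
    refine ⟨{y' | ∀ i, τ i (f (y'.1 i)) = y'.1 i}, ?_, ?_⟩
    · refine eventually_all.2 fun i => ?_
      exact ((continuous_apply i).comp continuous_subtype_val).continuousAt.eventually (h4 i)
    · intro a ha b hb hab
      refine Subtype.ext (funext fun i => ?_)
      rw [← ha i, ← hb i, a.2 i, b.2 i]
      exact congrArg (τ i) hab

end Etale

section Pushforward

variable {X : Type u} {Y : Type v} {Z : Type w}
  [TopologicalSpace X] [TopologicalSpace Y] [TopologicalSpace Z]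

theorem finite_fibre_inter [T1Space Y] {f : X → Y} (hf : IsLocalHomeomorph f) {S : Set X}
    (hS : IsCompact S) (y : Y) : (f ⁻¹' {y} ∩ S).Finite := by
  have hcl : IsClosed (f ⁻¹' {y}) := isClosed_singleton.preimage hf.continuous
  have hc : IsCompact (f ⁻¹' {y} ∩ S) := hS.inter_left hcl
  refine hc.finite ?_
  refine isDiscrete_iff_forall_mem_exists_isOpen.2 ?_
  rintro x ⟨hx, hxS⟩
  obtain ⟨U, hU, hxU, hinj⟩ := hf.isLocallyInjective x
  refine ⟨U, hU, Set.eq_singleton_iff_unique_mem.2 ⟨⟨hxU, hx, hxS⟩, ?_⟩⟩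
  rintro x' ⟨h1, h2, -⟩
  exact hinj h1 hxU (Eq.trans h2 (Eq.symm hx))

theorem finite_fibre_support [T1Space Y] {f : X → Y} (hf : IsLocalHomeomorph f) (a : C_c(X, ℤ))
    (y : Y) : (f ⁻¹' {y} ∩ Function.support a).Finite :=
  (finite_fibre_inter hf a.hasCompactSupport y).subset
    (Set.inter_subset_inter_right _ (subset_tsupport _))

theorem pushforward_eventually [T2Space X] [T2Space Y] {f : X → Y} (hf : IsLocalHomeomorph f)
    (a : C_c(X, ℤ)) (y₀ : Y) :
    ∀ᶠ y in 𝓝 y₀, ∑ᶠ x ∈ f ⁻¹' {y}, a x = ∑ᶠ x ∈ f ⁻¹' {y₀}, a x := by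
  classical
  have hS : IsCompact (tsupport a) := a.hasCompactSupport
  have hF := finite_fibre_inter hf hS y₀
  obtain ⟨U, hU, hd⟩ := hF.t2_separation
  choose τ h1 h2 h3 h4 using fun x => exists_section hf x
  have hV : ∀ x, ∃ V : Set X, IsOpen V ∧ x ∈ V ∧ V ⊆ U x ∧ (∀ x' ∈ V, τ x (f x') = x') ∧
      ∀ x' ∈ V, a x' = a x := by
    intro x
    have ha : ∀ᶠ x' in 𝓝 x, a x' = a x := by
      have := a.continuous.continuousAt (x := x)
      exact this.eventually (show ({a x} : Set ℤ) ∈ 𝓝 (a x) by simp)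
    obtain ⟨V, hV, hVo, hxV⟩ := eventually_nhds_iff.1
      ((h4 x).and (ha.and ((hU x).2.mem_nhds (hU x).1)))
    exact ⟨V, hVo, hxV, fun x' hx' => (hV x' hx').2.2, fun x' hx' => (hV x' hx').1,
      fun x' hx' => (hV x' hx').2.1⟩
  choose V hVo hxV hVU hVτ hVa using hV
  have hC : IsCompact (tsupport a \ ⋃ x ∈ f ⁻¹' {y₀} ∩ tsupport a, V x) :=
    hS.diff (isOpen_biUnion fun x _ => hVo x)
  have hC' : IsClosed (f '' (tsupport a \ ⋃ x ∈ f ⁻¹' {y₀} ∩ tsupport a, V x)) :=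
    (hC.image hf.continuous).isClosed
  have hy₀ : y₀ ∉ f '' (tsupport a \ ⋃ x ∈ f ⁻¹' {y₀} ∩ tsupport a, V x) := by
    rintro ⟨x, ⟨hx, hx'⟩, hxy⟩
    exact hx' (Set.mem_biUnion (⟨hxy, hx⟩ : x ∈ f ⁻¹' {y₀} ∩ tsupport a) (hxV x))
  have hW : ∀ᶠ y in 𝓝 y₀, ∀ x ∈ f ⁻¹' {y₀} ∩ tsupport a, y ∈ f '' V x := by
    refine (eventually_all_finite hF).2 fun x hx => ?_
    have := (hf.isOpenMap _ (hVo x)).mem_nhds (Set.mem_image_of_mem f (hxV x))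
    rwa [show f x = y₀ from hx.1] at this
  filter_upwards [hW, hC'.isOpen_compl.mem_nhds hy₀] with y hyW hyC
  have hsec : ∀ x ∈ f ⁻¹' {y₀} ∩ tsupport a, τ x y ∈ V x ∧ f (τ x y) = y := by
    intro x hx
    obtain ⟨x', hx', rfl⟩ := hyW x hx
    rw [hVτ x x' hx']
    exact ⟨hx', rfl⟩
  have e1 : ∑ᶠ x ∈ f ⁻¹' {y₀}, a x = ∑ x ∈ hF.toFinset, a x := by
    refine finsum_mem_eq_sum_of_inter_support_eq _ ?_
    ext x
    simp only [Set.mem_inter_iff, Set.Finite.coe_toFinset]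
    exact ⟨fun h => ⟨⟨h.1, subset_tsupport _ h.2⟩, h.2⟩, fun h => ⟨h.1.1, h.2⟩⟩
  have hinj : Set.InjOn (fun x => τ x y) (hF.toFinset : Set X) := by
    intro x hx x' hx' h
    rw [Set.Finite.coe_toFinset] at hx hx'
    by_contra hne
    refine Set.disjoint_left.1 (hd hx hx' hne) (hVU x (hsec x hx).1) ?_
    have := hVU x' (hsec x' hx').1
    rwa [← show τ x y = τ x' y from h] at this
  have e2 : ∑ᶠ x ∈ f ⁻¹' {y}, a x = ∑ x ∈ hF.toFinset.image (fun x => τ x y), a x := by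
    refine finsum_mem_eq_sum_of_inter_support_eq _ ?_
    ext x
    simp only [Set.mem_inter_iff, Finset.coe_image, Set.Finite.coe_toFinset, Set.mem_image]
    constructor
    · rintro ⟨hxy, hx⟩
      refine ⟨?_, hx⟩
      by_contra hcon
      refine hyC ⟨x, ⟨subset_tsupport _ hx, fun hmem => hcon ?_⟩, hxy⟩
      obtain ⟨z, hz, hxz⟩ := Set.mem_iUnion₂.1 hmem
      refine ⟨z, hz, ?_⟩
      rw [← show f x = y from hxy]
      exact hVτ z x hxz
    · rintro ⟨⟨z, hz, rfl⟩, hx⟩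
      exact ⟨(hsec z hz).2, hx⟩
  rw [e1, e2, Finset.sum_image hinj]
  refine Finset.sum_congr rfl fun x hx => ?_
  rw [Set.Finite.mem_toFinset] at hx
  exact hVa x _ (hsec x hx).1

/-- The homomorphism `f_* : ℤ[X] → ℤ[Y]` induced by an étale map `f`, given by
`f_*(a)(y) = ∑_{f(x) = y} a(x)`; here `ℤ[X] = C_c(X, ℤ)`. -/
noncomputable def pushforward [T2Space X] [T2Space Y] (f : X → Y) (hf : IsLocalHomeomorph f) :
    C_c(X, ℤ) →+ C_c(Y, ℤ) where
  toFun a :=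
    { toFun := fun y => ∑ᶠ x ∈ f ⁻¹' {y}, a x
      continuous_toFun := continuous_iff_continuousAt.2 fun y =>
        (tendsto_const_nhds (x := ∑ᶠ x ∈ f ⁻¹' {y}, a x)).congr'
          ((pushforward_eventually hf a y).mono fun _ h => h.symm)
      hasCompactSupport' := by
        refine HasCompactSupport.intro (a.hasCompactSupport.image hf.continuous) fun y hy => ?_
        refine finsum_mem_eq_zero_of_forall_eq_zero fun x hx => ?_
        by_contra h
        exact hy ⟨x, subset_tsupport _ h, hx⟩ }
  map_zero' := by
    ext y
    exact finsum_mem_zero _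
  map_add' a b := by
    ext y
    exact finsum_mem_add_distrib' (finite_fibre_support hf a y) (finite_fibre_support hf b y)

theorem pushforward_apply [T2Space X] [T2Space Y] {f : X → Y} (hf : IsLocalHomeomorph f)
    (a : C_c(X, ℤ)) (y : Y) : pushforward f hf a y = ∑ᶠ x ∈ f ⁻¹' {y}, a x := rfl

theorem pushforward_comp [T2Space X] [T2Space Y] [T2Space Z] {f : X → Y} {g : Y → Z}
    (hf : IsLocalHomeomorph f) (hg : IsLocalHomeomorph g) (a : C_c(X, ℤ)) :
    pushforward g hg (pushforward f hf a) = pushforward (g ∘ f) (hg.comp hf) a := by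
  classical
  ext z
  have hT := finite_fibre_support (hg.comp hf) a z
  have e1 : pushforward (g ∘ f) (hg.comp hf) a z = ∑ x ∈ hT.toFinset, a x :=
    finsum_mem_eq_sum_of_inter_support_eq _ (by ext x; simp)
  have e2 : pushforward g hg (pushforward f hf a) z =
      ∑ y ∈ hT.toFinset.image f, pushforward f hf a y := by
    refine finsum_mem_eq_sum_of_inter_support_eq _ ?_
    ext y
    constructor
    · rintro ⟨hy, hay⟩
      refine ⟨?_, hay⟩
      obtain ⟨x, hx, hax⟩ := exists_ne_zero_of_finsum_mem_ne_zero hay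
      have hxy : f x = y := hx
      simp only [Finset.coe_image, Set.Finite.coe_toFinset]
      refine ⟨x, ⟨?_, hax⟩, hxy⟩
      show g (f x) = z
      rw [hxy]; exact hy
    · rintro ⟨hy, hay⟩
      simp only [Finset.coe_image, Set.Finite.coe_toFinset] at hy
      obtain ⟨x, ⟨hx, -⟩, rfl⟩ := hy
      exact ⟨hx, hay⟩
  rw [e1, e2, ← Finset.sum_fiberwise_of_maps_to (fun x hx => Finset.mem_image_of_mem f hx)]
  refine Finset.sum_congr rfl fun y hy => ?_
  refine finsum_mem_eq_sum_of_inter_support_eq _ ?_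
  ext x
  simp only [Set.mem_inter_iff, Finset.coe_filter, Set.Finite.mem_toFinset, Set.mem_ofPred_eq,
    Set.mem_preimage, Set.mem_singleton_iff, Function.comp_apply]
  obtain ⟨x', hx', rfl⟩ := Finset.mem_image.1 hy
  have hz : g (f x') = z := ((Set.Finite.mem_toFinset _).1 hx').1
  constructor
  · rintro ⟨h1, h2⟩
    exact ⟨⟨⟨by rw [h1, hz], h2⟩, h1⟩, h2⟩
  · rintro ⟨⟨-, h1⟩, h2⟩
    exact ⟨h1, h2⟩

theorem pushforward_congr [T2Space X] [T2Space Y] {f g : X → Y} (hf : IsLocalHomeomorph f)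
    (hg : IsLocalHomeomorph g) (h : f = g) : pushforward f hf = pushforward g hg := by
  subst h; rfl

end Pushforward

/-- A topological groupoid whose arrow space and object space are locally compact Hausdorff.
The product `mul g h` has a meaning only for composable pairs, `s g = r h`; no law and no
continuity is imposed on its (arbitrary) values at other pairs, and they are never used. -/
structure TopGroupoid where
  /-- The space of arrows. -/
  Arr : Type u
  /-- The base space. -/
  Obj : Type u
  [topArr : TopologicalSpace Arr]
  [topObj : TopologicalSpace Obj]
  [t2Arr : T2Space Arr]
  [t2Obj : T2Space Obj]
  [lcArr : LocallyCompactSpace Arr]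
  [lcObj : LocallyCompactSpace Obj]
  /-- The range map. -/
  r : Arr → Obj
  /-- The source map. -/
  s : Arr → Obj
  /-- The identity arrows. -/
  unit : Obj → Arr
  /-- The product of composable arrows. -/
  mul : Arr → Arr → Arr
  /-- The inverse. -/
  inv : Arr → Arr
  r_unit : ∀ x, r (unit x) = x
  s_unit : ∀ x, s (unit x) = x
  r_mul : ∀ g h, s g = r h → r (mul g h) = r g
  s_mul : ∀ g h, s g = r h → s (mul g h) = s h
  r_inv : ∀ g, r (inv g) = s g
  s_inv : ∀ g, s (inv g) = r g
  mul_assoc : ∀ g h k, s g = r h → s h = r k → mul (mul g h) k = mul g (mul h k)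
  unit_mul : ∀ g, mul (unit (r g)) g = g
  mul_unit : ∀ g, mul g (unit (s g)) = g
  mul_inv : ∀ g, mul g (inv g) = unit (r g)
  inv_mul : ∀ g, mul (inv g) g = unit (s g)
  continuous_r : Continuous r
  continuous_s : Continuous s
  continuous_unit : Continuous unit
  continuous_inv : Continuous inv
  continuousOn_mul : ContinuousOn (fun q : Arr × Arr => mul q.1 q.2) {q | s q.1 = r q.2}

namespace TopGroupoid

attribute [instance] topArr topObj t2Arr t2Obj lcArr lcObj

variable (G : TopGroupoid.{u})

/-- A bisection: a set of arrows on which `r` and `s` are homeomorphisms onto their images. -/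
def IsBisection (A : Set G.Arr) : Prop :=
  IsEmbedding (fun g : A => G.r g) ∧ IsEmbedding (fun g : A => G.s g)

/-- An ample groupoid: it is étale (the range map is a local homeomorphism), and the compact open
bisections form a basis of the topology. -/
structure IsAmple : Prop where
  etale_r : IsLocalHomeomorph G.r
  basis : TopologicalSpace.IsTopologicalBasis
    {A : Set G.Arr | IsCompact A ∧ IsOpen A ∧ G.IsBisection A}

/-- A principal groupoid: all isotropy groups are trivial. -/
def IsPrincipal : Prop := ∀ g, G.r g = G.s g → g = G.unit (G.r g)

end TopGroupoid

/-- Ample groupoids (locally compact Hausdorff, étale). -/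
structure AmpleGroupoid extends TopGroupoid.{u} where
  ample : toTopGroupoid.IsAmple

namespace AmpleGroupoid

variable (G : AmpleGroupoid.{u})

theorem etale_r : IsLocalHomeomorph G.r := G.ample.etale_r

theorem inv_inv (g : G.Arr) : G.inv (G.inv g) = g := by
  have h1 := G.mul_assoc (G.inv (G.inv g)) (G.inv g) g (by simp [G.s_inv]) (by simp [G.s_inv])
  rw [G.inv_mul (G.inv g), G.inv_mul g, G.s_inv, G.unit_mul] at h1
  have h2 := G.mul_unit (G.inv (G.inv g))
  rw [G.s_inv, G.r_inv] at h2
  exact (h1.trans h2).symm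

theorem etale_s : IsLocalHomeomorph G.s := by
  let e : G.Arr ≃ₜ G.Arr :=
    { toFun := G.inv
      invFun := G.inv
      left_inv := G.inv_inv
      right_inv := G.inv_inv
      continuous_toFun := G.continuous_inv
      continuous_invFun := G.continuous_inv }
  have : G.s = G.r ∘ e := funext fun g => (G.r_inv g).symm
  rw [this]
  exact G.etale_r.comp e.isLocalHomeomorph

theorem etale_unit : IsLocalHomeomorph G.unit := by
  have h : IsLocalHomeomorph (G.s ∘ G.unit) := by
    rw [show G.s ∘ G.unit = id from funext G.s_unit]
    exact (Homeomorph.refl G.Obj).isLocalHomeomorph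
  exact h.of_comp G.etale_s G.continuous_unit

variable {G}

theorem inv_mul_cancel {g h : G.Arr} (hr : G.r g = G.r h) :
    G.mul g (G.mul (G.inv g) h) = h := by
  rw [← G.mul_assoc _ _ _ (G.r_inv g).symm ((G.s_inv g).trans hr), G.mul_inv, hr, G.unit_mul]

theorem mul_inv_cancel {g h : G.Arr} (hr : G.s g = G.r h) :
    G.mul (G.inv g) (G.mul g h) = h := by
  rw [← G.mul_assoc _ _ _ (G.s_inv g) hr, G.inv_mul, hr, G.unit_mul]

theorem mul_mul_inv_cancel {g h : G.Arr} (hr : G.s g = G.s h) :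
    G.mul (G.mul g (G.inv h)) h = g := by
  rw [G.mul_assoc _ _ _ (hr.trans (G.r_inv h).symm) (G.s_inv h), G.inv_mul, ← hr, G.mul_unit]

theorem inv_mul_eq {g h k : G.Arr} (h1 : G.s g = G.r h) (h2 : G.r g = G.r k) :
    G.mul (G.inv (G.mul g h)) k = G.mul (G.inv h) (G.mul (G.inv g) k) := by
  have e1 : G.r (G.mul (G.inv g) k) = G.s g := by
    rw [G.r_mul _ _ ((G.s_inv g).trans h2), G.r_inv]
  have e2 : G.r (G.mul (G.inv h) (G.mul (G.inv g) k)) = G.s h := by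
    rw [G.r_mul _ _ (by rw [G.s_inv, e1, h1]), G.r_inv]
  have key : G.mul (G.mul g h) (G.mul (G.inv h) (G.mul (G.inv g) k)) = k := by
    rw [G.mul_assoc _ _ _ h1 e2.symm, inv_mul_cancel (by rw [e1, h1]), inv_mul_cancel h2]
  conv_lhs => rw [← key]
  rw [mul_inv_cancel]
  rw [G.s_mul _ _ h1, e2]

theorem continuous_mul {T : Type v} [TopologicalSpace T] {f g : T → G.Arr} (hf : Continuous f)
    (hg : Continuous g) (h : ∀ t, G.s (f t) = G.r (g t)) :
    Continuous fun t => G.mul (f t) (g t) :=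
  G.continuousOn_mul.comp_continuous (hf.prodMk hg) h

theorem continuousAt_mul {T : Type v} [TopologicalSpace T] {f g : T → G.Arr} {t₀ : T}
    (hf : ContinuousAt f t₀) (hg : ContinuousAt g t₀) (h₀ : G.s (f t₀) = G.r (g t₀))
    (h : ∀ᶠ t in 𝓝 t₀, G.s (f t) = G.r (g t)) :
    ContinuousAt (fun t => G.mul (f t) (g t)) t₀ :=
  Tendsto.comp (G.continuousOn_mul (f t₀, g t₀) h₀)
    (tendsto_nhdsWithin_iff.2 ⟨hf.prodMk hg, h⟩)

end AmpleGroupoid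

/-- A left `G`-space which is locally compact, Hausdorff and étale (its anchor map is a local
homeomorphism). -/
structure GSpace (G : AmpleGroupoid.{u}) where
  /-- The underlying space. -/
  carrier : Type u
  [top : TopologicalSpace carrier]
  [t2 : T2Space carrier]
  [lc : LocallyCompactSpace carrier]
  /-- The anchor map. -/
  anchor : carrier → G.Obj
  /-- The action, defined for `s g = anchor x`. -/
  smul : ∀ (g : G.Arr) (x : carrier), G.s g = anchor x → carrier
  anchor_smul : ∀ g x h, anchor (smul g x h) = G.r g
  unit_smul : ∀ x, smul (G.unit (anchor x)) x (G.s_unit _) = x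
  mul_smul : ∀ (g h : G.Arr) (x : carrier) (hg : G.s g = G.r h) (hx : G.s h = anchor x),
    smul (G.mul g h) x ((G.s_mul g h hg).trans hx) =
      smul g (smul h x hx) (hg.trans (anchor_smul h x hx).symm)
  etale_anchor : IsLocalHomeomorph anchor
  continuous_smul : Continuous
    fun q : {q : G.Arr × carrier // G.s q.1 = anchor q.2} => smul q.1.1 q.1.2 q.2

namespace GSpace

variable {G : AmpleGroupoid.{u}}

attribute [instance] top t2 lc

/-- Equivariant étale maps between `G`-spaces. -/
structure Hom (X Y : GSpace G) where
  /-- The underlying map. -/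
  toFun : X.carrier → Y.carrier
  etale : IsLocalHomeomorph toFun
  anchor_map : ∀ x, Y.anchor (toFun x) = X.anchor x
  map_smul : ∀ (g : G.Arr) (x : X.carrier) (h : G.s g = X.anchor x),
    toFun (X.smul g x h) = Y.smul g (toFun x) (h.trans (anchor_map x).symm)

/-- A continuous equivariant map between étale `G`-spaces is étale. -/
def Hom.ofContinuous {X Y : GSpace G} (f : X.carrier → Y.carrier) (hf : Continuous f)
    (ha : ∀ x, Y.anchor (f x) = X.anchor x)
    (hs : ∀ (g : G.Arr) (x : X.carrier) (h : G.s g = X.anchor x),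
      f (X.smul g x h) = Y.smul g (f x) (h.trans (ha x).symm)) : Hom X Y where
  toFun := f
  etale := by
    refine IsLocalHomeomorph.of_comp (g := Y.anchor) ?_ Y.etale_anchor hf
    rw [show Y.anchor ∘ f = X.anchor from funext ha]
    exact X.etale_anchor
  anchor_map := ha
  map_smul := hs

/-- The fibre product `G ×_{s,p} X` of composable pairs. -/
abbrev Pairs (X : GSpace G) : Type u := {q : G.Arr × X.carrier // G.s q.1 = X.anchor q.2}

variable (X : GSpace G)

/-- The action map `G ×_{s,p} X → X`. -/
def act (q : X.Pairs) : X.carrier := X.smul q.1.1 q.1.2 q.2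

theorem etale_act : IsLocalHomeomorph X.act := by
  refine IsLocalHomeomorph.of_comp (g := X.anchor) ?_ X.etale_anchor X.continuous_smul
  have : X.anchor ∘ X.act = G.r ∘ fun q : X.Pairs => q.1.1 :=
    funext fun q => X.anchor_smul _ _ _
  rw [this]
  exact G.etale_r.comp (isLocalHomeomorph_pullback_fst G.continuous_s X.etale_anchor)

/-- The function `(g, x) ↦ f(g) a(x)` on `G ×_{s,p} X`. -/
def tensor (f : C_c(G.Arr, ℤ)) (a : C_c(X.carrier, ℤ)) : C_c(X.Pairs, ℤ) where
  toFun q := f q.1.1 * a q.1.2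
  continuous_toFun := by
    have h1 := f.continuous
    have h2 := a.continuous
    fun_prop
  hasCompactSupport' := by
    have hcl : IsClosed {q : G.Arr × X.carrier | G.s q.1 = X.anchor q.2} :=
      isClosed_eq (G.continuous_s.comp continuous_fst)
        (X.etale_anchor.continuous.comp continuous_snd)
    have hK : IsCompact (Subtype.val ⁻¹' (tsupport f ×ˢ tsupport a) : Set X.Pairs) :=
      hcl.isClosedEmbedding_subtypeVal.isCompact_preimage
        (f.hasCompactSupport.isCompact.prod a.hasCompactSupport.isCompact)
    refine HasCompactSupport.intro hK fun q hq => ?_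
    by_contra h
    exact hq ⟨subset_tsupport _ (left_ne_zero_of_mul h), subset_tsupport _ (right_ne_zero_of_mul h)⟩

variable {X} in
theorem smul_congr {g g' : G.Arr} {x x' : X.carrier} (hg : g = g') (hx : x = x')
    (h : G.s g = X.anchor x) :
    X.smul g x h = X.smul g' x' (by rw [← hg, ← hx]; exact h) := by
  subst hg hx; rfl

variable {X} in
theorem inv_smul_smul (g : G.Arr) (x : X.carrier) (h : G.s g = X.anchor x) :
    X.smul (G.inv g) (X.smul g x h) ((G.s_inv g).trans (X.anchor_smul g x h).symm) = x := by
  rw [← X.mul_smul (G.inv g) g x (G.s_inv g) h]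
  exact (smul_congr ((G.inv_mul g).trans (congrArg G.unit h)) rfl _).trans (X.unit_smul x)

variable {X} in
theorem smul_inv_smul (g : G.Arr) (x : X.carrier) (h : G.r g = X.anchor x) :
    X.smul g (X.smul (G.inv g) x ((G.s_inv g).trans h))
      ((G.r_inv g).symm.trans (X.anchor_smul _ _ _).symm) = x := by
  rw [← X.mul_smul g (G.inv g) x (G.r_inv g).symm ((G.s_inv g).trans h)]
  exact (smul_congr ((G.mul_inv g).trans (congrArg G.unit h)) rfl _).trans (X.unit_smul x)

theorem convolve_eq (f : C_c(G.Arr, ℤ)) (a : C_c(X.carrier, ℤ)) (x : X.carrier) :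
    ∑ᶠ g : {g : G.Arr // G.r g = X.anchor x},
      f g.1 * a (X.smul (G.inv g.1) x ((G.s_inv g.1).trans g.2)) =
    pushforward X.act X.etale_act (X.tensor f a) x := by
  rw [pushforward_apply]
  refine Eq.trans ?_ (finsum_subtype_eq_finsum_cond (f := fun q => X.tensor f a q)
    (fun q => q ∈ X.act ⁻¹' {x}))
  refine finsum_eq_of_bijective
    (fun g => ⟨⟨(g.1, X.smul (G.inv g.1) x ((G.s_inv g.1).trans g.2)),
      (G.r_inv g.1).symm.trans (X.anchor_smul _ _ _).symm⟩, smul_inv_smul g.1 x g.2⟩)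
    ⟨fun g g' h => ?_, fun q => ?_⟩ fun g => rfl
  · exact Subtype.ext (congrArg (fun q => q.1.1.1) h)
  · obtain ⟨⟨⟨g, y⟩, hq⟩, hx⟩ := q
    have hx' : X.smul g y hq = x := hx
    subst hx'
    refine ⟨⟨g, (X.anchor_smul g y hq).symm⟩, ?_⟩
    refine Subtype.ext (Subtype.ext (Prod.ext rfl ?_))
    exact inv_smul_smul g y hq

/-- The action of `ℤ[G] = C_c(G, ℤ)` on `ℤ[X] = C_c(X, ℤ)`, given by
`(f a)(x) = ∑_{g ∈ G^{p(x)}} f(g) a(g⁻¹ x)`. -/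
noncomputable def convolve (f : C_c(G.Arr, ℤ)) (a : C_c(X.carrier, ℤ)) : C_c(X.carrier, ℤ) :=
  (pushforward X.act X.etale_act (X.tensor f a)).copy
    (fun x => ∑ᶠ g : {g : G.Arr // G.r g = X.anchor x},
      f g.1 * a (X.smul (G.inv g.1) x ((G.s_inv g.1).trans g.2)))
    (funext fun x => X.convolve_eq f a x)

/-- The augmentation `ε : ℤ[G] → ℤ[G⁰]`, `ε(f)(x) = ∑_{g ∈ G_x} f(g)`, followed by the inclusion
`ℤ[G⁰] ⊆ ℤ[G]` (extension by zero). -/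
noncomputable def augmentation (G : AmpleGroupoid.{u}) : C_c(G.Arr, ℤ) →+ C_c(G.Arr, ℤ) :=
  (pushforward G.unit G.etale_unit).comp (pushforward G.s G.etale_s)

/-- The subgroup of `ℤ[X]` generated by the elements `f a - ε(f) a`. -/
def coinvKer : AddSubgroup C_c(X.carrier, ℤ) :=
  AddSubgroup.closure
    {b | ∃ (f : C_c(G.Arr, ℤ)) (a : C_c(X.carrier, ℤ)),
      b = X.convolve f a - X.convolve (augmentation G f) a}

/-- The coinvariants `ℤ[X]_G`. -/
abbrev Coinv : Type u := C_c(X.carrier, ℤ) ⧸ X.coinvKer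

variable {X} {Y : GSpace G}

theorem pushforward_convolve (φ : Hom X Y) (f : C_c(G.Arr, ℤ)) (a : C_c(X.carrier, ℤ)) :
    pushforward φ.toFun φ.etale (X.convolve f a) =
      Y.convolve f (pushforward φ.toFun φ.etale a) := by
  have hX : X.convolve f a = pushforward X.act X.etale_act (X.tensor f a) :=
    CompactlySupportedContinuousMap.copy_eq _ _ _
  have hY : Y.convolve f (pushforward φ.toFun φ.etale a) =
      pushforward Y.act Y.etale_act (Y.tensor f (pushforward φ.toFun φ.etale a)) :=
    CompactlySupportedContinuousMap.copy_eq _ _ _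
  let ψ : X.Pairs → Y.Pairs :=
    fun q => ⟨(q.1.1, φ.toFun q.1.2), q.2.trans (φ.anchor_map q.1.2).symm⟩
  have hψ : IsLocalHomeomorph ψ := by
    refine IsLocalHomeomorph.of_comp (g := fun q : Y.Pairs => q.1.1) ?_
      (isLocalHomeomorph_pullback_fst G.continuous_s Y.etale_anchor) ?_
    · exact isLocalHomeomorph_pullback_fst G.continuous_s X.etale_anchor
    · have := φ.etale.continuous
      fun_prop
  have hcomm : φ.toFun ∘ X.act = Y.act ∘ ψ := funext fun q => φ.map_smul _ _ _
  have htensor : pushforward ψ hψ (X.tensor f a) =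
      Y.tensor f (pushforward φ.toFun φ.etale a) := by
    ext ⟨⟨g, y⟩, hq⟩
    change ∑ᶠ q ∈ ψ ⁻¹' {⟨(g, y), hq⟩}, f q.1.1 * a q.1.2 =
      f g * ∑ᶠ x ∈ φ.toFun ⁻¹' {y}, a x
    rw [mul_finsum_mem]
    symm
    have hanch : ∀ x, x ∈ φ.toFun ⁻¹' {y} → G.s g = X.anchor x := by
      rintro x rfl
      exact hq.trans (φ.anchor_map x)
    refine (finsum_mem_eq_of_bijOn (fun q : X.Pairs => q.1.2) ⟨?_, ?_, ?_⟩ ?_).symm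
    · rintro q hqy
      exact congrArg (fun q => q.1.2) hqy
    · rintro q hq1 q' hq2 h
      refine Subtype.ext (Prod.ext ?_ h)
      exact (congrArg (fun q => q.1.1) hq1).trans (congrArg (fun q => q.1.1) hq2).symm
    · intro x hx
      refine ⟨⟨(g, x), hanch x hx⟩, ?_, rfl⟩
      exact Subtype.ext (Prod.ext rfl hx)
    · intro q hqy
      have : q.1.1 = g := congrArg (fun q => q.1.1) hqy
      rw [this]
  rw [hX, hY, ← htensor, pushforward_comp, pushforward_comp]
  exact DFunLike.congr_fun (pushforward_congr _ _ hcomm) _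

theorem coinvKer_le_comap (φ : Hom X Y) :
    X.coinvKer ≤ Y.coinvKer.comap (pushforward φ.toFun φ.etale) := by
  refine (AddSubgroup.closure_le _).2 ?_
  rintro _ ⟨f, a, rfl⟩
  refine AddSubgroup.subset_closure ⟨f, pushforward φ.toFun φ.etale a, ?_⟩
  rw [map_sub, pushforward_convolve, pushforward_convolve]

/-- The homomorphism `ℤ[X]_G → ℤ[Y]_G` induced by an equivariant étale map. -/
noncomputable def Hom.coinvMap (φ : Hom X Y) : X.Coinv →+ Y.Coinv :=
  QuotientAddGroup.map _ _ (pushforward φ.toFun φ.etale) (coinvKer_le_comap φ)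

theorem coinvMap_comp_eq {Z W : GSpace G} {φ : Hom X Y} {ψ : Hom Y Z} {φ' : Hom X W}
    {ψ' : Hom W Z} (h : ∀ x, ψ.toFun (φ.toFun x) = ψ'.toFun (φ'.toFun x)) :
    ψ.coinvMap.comp φ.coinvMap = ψ'.coinvMap.comp φ'.coinvMap := by
  ext a
  change ((pushforward ψ.toFun ψ.etale (pushforward φ.toFun φ.etale a) : C_c(Z.carrier, ℤ)) :
      Z.Coinv) = (pushforward ψ'.toFun ψ'.etale (pushforward φ'.toFun φ'.etale a) :)
  rw [pushforward_comp, pushforward_comp]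
  congr 1
  exact DFunLike.congr_fun (pushforward_congr _ _ (funext h)) _

end GSpace

section Complex

/-- The alternating sum `∑ (-1)^i d_i`. -/
noncomputable def altSum {C : ℕ → Type u} [∀ n, AddCommGroup (C n)]
    (d : ∀ n, Fin (n + 2) → C (n + 1) →+ C n) (n : ℕ) :
    AddCommGrpCat.of (C (n + 1)) ⟶ AddCommGrpCat.of (C n) :=
  AddCommGrpCat.ofHom (∑ i : Fin (n + 2), (-1 : ℤ) ^ (i : ℕ) • d n i)

theorem altSum_apply {C : ℕ → Type u} [∀ n, AddCommGroup (C n)]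
    (d : ∀ n, Fin (n + 2) → C (n + 1) →+ C n) (n : ℕ) (x : C (n + 1)) :
    (altSum d n).hom x = ∑ i : Fin (n + 2), (-1 : ℤ) ^ (i : ℕ) • d n i x := by
  change (∑ i : Fin (n + 2), (-1 : ℤ) ^ (i : ℕ) • d n i) x = _
  simp only [AddMonoidHom.finsetSum_apply, AddMonoidHom.smul_apply]

theorem altSum_comp {C : ℕ → Type u} [∀ n, AddCommGroup (C n)]
    (d : ∀ n, Fin (n + 2) → C (n + 1) →+ C n)
    (hd : ∀ n (i j : Fin (n + 2)), i ≤ j →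
      (d n i).comp (d (n + 1) j.succ) = (d n j).comp (d (n + 1) i.castSucc)) (n : ℕ) :
    altSum d (n + 1) ≫ altSum d n = 0 := by
  have key : ∀ i j : Fin (n + 2), i ≤ j → ∀ x,
      d n i (d (n + 1) j.succ x) = d n j (d (n + 1) i.castSucc x) :=
    fun i j h x => DFunLike.congr_fun (hd n i j h) x
  ext x
  change (altSum d n).hom ((altSum d (n + 1)).hom x) = 0
  rw [altSum_apply d (n + 1) x, altSum_apply d n]
  simp only [map_sum, map_zsmul, smul_smul, Finset.smul_sum]
  rw [← Finset.sum_product']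
  let P := Fin (n + 2) × Fin (n + 3)
  let S : Finset P := {ij : P | (ij.2 : ℕ) ≤ (ij.1 : ℕ)}
  rw [Finset.univ_product_univ, ← Finset.sum_add_sum_compl S, ← eq_neg_iff_add_eq_zero,
    ← Finset.sum_neg_distrib]
  let φ : ∀ ij : P, ij ∈ S → P := fun ij hij =>
    (Fin.castLT ij.2 (lt_of_le_of_lt (Finset.mem_filter.mp hij).right (Fin.is_lt ij.1)), ij.1.succ)
  apply Finset.sum_bij φ
  · intro ij hij
    simp_rw [S, φ, Finset.compl_filter, Finset.mem_filter_univ, Fin.val_succ,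
      Fin.val_castLT] at hij ⊢
    lia
  · rintro ⟨i, j⟩ hij ⟨i', j'⟩ hij' h
    rw [Prod.mk_inj]
    exact ⟨by simpa [φ] using! congr_arg Prod.snd h,
      by simpa [φ, Fin.castSucc_castLT] using! congr_arg Fin.castSucc (congr_arg Prod.fst h)⟩
  · rintro ⟨i', j'⟩ hij'
    simp_rw [S, Finset.compl_filter, Finset.mem_filter_univ, not_le] at hij'
    refine ⟨(j'.pred <| ?_, Fin.castSucc i'), ?_, ?_⟩
    · rintro rfl
      simp only [Fin.val_zero, not_lt_zero] at hij'
    · simpa [S] using! Nat.le_sub_one_of_lt hij'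
    · simp only [φ, Fin.castLT_castSucc, Fin.succ_pred]
  · rintro ⟨i, j⟩ hij
    have hij' : (j : ℕ) ≤ (i : ℕ) := by simpa [S] using! hij
    have := key (Fin.castLT j (lt_of_le_of_lt hij' i.is_lt)) i (by
      rw [Fin.le_def]; simpa using! hij') x
    simp only [φ, Fin.castSucc_castLT] at this ⊢
    rw [this, ← neg_smul]
    congr 1
    simp only [Fin.val_succ, Fin.val_castLT, pow_add, pow_one]
    ring

/-- The chain complex `(C_*, ∑ (-1)^i d_i)` of a semi-simplicial abelian group. -/
noncomputable def altComplex {C : ℕ → Type u} [∀ n, AddCommGroup (C n)]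
    (d : ∀ n, Fin (n + 2) → C (n + 1) →+ C n)
    (hd : ∀ n (i j : Fin (n + 2)), i ≤ j →
      (d n i).comp (d (n + 1) j.succ) = (d n j).comp (d (n + 1) i.castSucc)) :
    ChainComplex AddCommGrpCat.{u} ℕ :=
  ChainComplex.of (fun n => AddCommGrpCat.of (C n)) (altSum d) (altSum_comp d hd)

theorem altComplex_d {C : ℕ → Type u} [∀ n, AddCommGroup (C n)]
    (d : ∀ n, Fin (n + 2) → C (n + 1) →+ C n)
    (hd : ∀ n (i j : Fin (n + 2)), i ≤ j →
      (d n i).comp (d (n + 1) j.succ) = (d n j).comp (d (n + 1) i.castSucc)) (n : ℕ) :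
    (altComplex d hd).d (n + 1) n = altSum d n :=
  ChainComplex.of_d (fun n => AddCommGrpCat.of (C n)) (altSum d) n

end Complex

/-- A semi-simplicial `G`-space: the face maps are equivariant étale maps. -/
structure SemisimplicialGSpace (G : AmpleGroupoid.{u}) where
  /-- The `G`-space of `n`-simplices. -/
  obj : ℕ → GSpace G
  /-- The face maps. -/
  face : ∀ n, Fin (n + 2) → GSpace.Hom (obj (n + 1)) (obj n)
  face_face : ∀ n (i j : Fin (n + 2)), i ≤ j → ∀ x,
    (face n i).toFun ((face (n + 1) j.succ).toFun x) =
      (face n j).toFun ((face (n + 1) i.castSucc).toFun x)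

namespace SemisimplicialGSpace

variable {G : AmpleGroupoid.{u}}

/-- Morphisms of semi-simplicial `G`-spaces. -/
structure Hom (X Y : SemisimplicialGSpace G) where
  /-- The map on `n`-simplices. -/
  app : ∀ n, GSpace.Hom (X.obj n) (Y.obj n)
  face_app : ∀ n (i : Fin (n + 2)) x,
    (Y.face n i).toFun ((app (n + 1)).toFun x) = (app n).toFun ((X.face n i).toFun x)

/-- The chain complex `(ℤ[X_*]_G, ∑ (-1)^i (∂_i)_*)`. -/
noncomputable def complex (X : SemisimplicialGSpace G) : ChainComplex AddCommGrpCat.{u} ℕ :=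
  altComplex (C := fun n => (X.obj n).Coinv) (fun n i => (X.face n i).coinvMap)
    fun n i j h => GSpace.coinvMap_comp_eq (X.face_face n i j h)

/-- The chain map induced by a morphism of semi-simplicial `G`-spaces. -/
noncomputable def Hom.chainMap {X Y : SemisimplicialGSpace G} (φ : Hom X Y) :
    X.complex ⟶ Y.complex :=
  ChainComplex.ofHom (fun n => AddCommGrpCat.ofHom (φ.app n).coinvMap) fun n => by
    simp only [complex, altComplex_d]
    refine AddCommGrpCat.hom_ext (AddMonoidHom.ext fun (x : (X.obj (n + 1)).Coinv) => ?_)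
    have key : ∀ i : Fin (n + 2), (Y.face n i).coinvMap ((φ.app (n + 1)).coinvMap x) =
        (φ.app n).coinvMap ((X.face n i).coinvMap x) := fun i =>
      DFunLike.congr_fun (GSpace.coinvMap_comp_eq (φ.face_app n i)) x
    change (altSum (C := fun n => (Y.obj n).Coinv) (fun n i => (Y.face n i).coinvMap) n).hom
        ((φ.app (n + 1)).coinvMap x) = (φ.app n).coinvMap
        ((altSum (C := fun n => (X.obj n).Coinv) (fun n i => (X.face n i).coinvMap) n).hom x)
    rw [altSum_apply (C := fun n => (Y.obj n).Coinv), altSum_apply (C := fun n => (X.obj n).Coinv),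
      map_sum]
    exact Finset.sum_congr rfl fun i _ => by rw [map_zsmul, key]

/-- The equivariant homology `H_n^G(X)`. -/
noncomputable def homology (X : SemisimplicialGSpace G) (n : ℕ) : AddCommGrpCat.{u} :=
  X.complex.homology n

/-- The map on equivariant homology induced by a morphism. -/
noncomputable def Hom.homologyMap {X Y : SemisimplicialGSpace G} (φ : Hom X Y) (n : ℕ) :
    X.homology n ⟶ Y.homology n :=
  HomologicalComplex.homologyMap φ.chainMap n

end SemisimplicialGSpace

/-- A semi-simplicial object in the category of locally compact Hausdorff spaces with étale face
maps. -/
structure SemisimplicialSpace where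
  /-- The space of `n`-simplices. -/
  obj : ℕ → Type u
  [top : ∀ n, TopologicalSpace (obj n)]
  [t2 : ∀ n, T2Space (obj n)]
  [lc : ∀ n, LocallyCompactSpace (obj n)]
  /-- The face maps. -/
  face : ∀ n, Fin (n + 2) → obj (n + 1) → obj n
  etale_face : ∀ n i, IsLocalHomeomorph (face n i)
  face_face : ∀ n (i j : Fin (n + 2)), i ≤ j → ∀ x,
    face n i (face (n + 1) j.succ x) = face n j (face (n + 1) i.castSucc x)

namespace SemisimplicialSpace

attribute [instance] top t2 lc

/-- The chain complex `(ℤ[X_*], ∑ (-1)^i (∂_i)_*)`. -/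
noncomputable def complex (X : SemisimplicialSpace.{u}) : ChainComplex AddCommGrpCat.{u} ℕ :=
  altComplex (C := fun n => C_c(X.obj n, ℤ)) (fun n i => pushforward (X.face n i) (X.etale_face n i))
    fun n i j h => AddMonoidHom.ext fun a => by
      rw [AddMonoidHom.comp_apply, AddMonoidHom.comp_apply, pushforward_comp, pushforward_comp]
      exact DFunLike.congr_fun (pushforward_congr _ _ (funext (X.face_face n i j h))) a

end SemisimplicialSpace

theorem succAbove_succAbove_of_le {n : ℕ} {i j : Fin (n + 2)} (h : i ≤ j) (k : Fin (n + 1)) :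
    j.succ.succAbove (i.succAbove k) = i.castSucc.succAbove (j.succAbove k) := by
  rw [Fin.le_def] at h
  ext
  simp only [Fin.succAbove, Fin.lt_def, Fin.val_castSucc, Fin.val_succ]
  split_ifs <;> simp_all <;> omega

theorem continuous_coord {X : Type u} [TopologicalSpace X] {n : ℕ} {P : (Fin n → X) → Prop}
    (i : Fin n) : Continuous fun γ : {γ : Fin n → X // P γ} => γ.1 i :=
  (continuous_apply i).comp continuous_subtype_val

namespace AmpleGroupoid

variable (G : AmpleGroupoid.{u})

/-- The space `EG_n` of `(n+1)`-tuples of arrows with a common range. -/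
abbrev EGSpace (n : ℕ) : Type u := {γ : Fin (n + 1) → G.Arr // ∀ i, G.r (γ i) = G.r (γ 0)}

/-- The space `EG_n` with `G` acting by left multiplication on all entries. -/
def EGObj (n : ℕ) : GSpace G where
  carrier := G.EGSpace n
  lc := locallyCompactSpace_of_isLocalHomeomorph (isLocalHomeomorph_fibrePower G.etale_r n)
  anchor γ := G.r (γ.1 0)
  smul g γ h := ⟨fun i => G.mul g (γ.1 i), fun i => by
    rw [G.r_mul _ _ (h.trans (γ.2 i).symm), G.r_mul _ _ h]⟩
  anchor_smul g γ h := G.r_mul _ _ h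
  unit_smul γ := Subtype.ext (funext fun i => by
    change G.mul (G.unit (G.r (γ.1 0))) (γ.1 i) = γ.1 i
    rw [← γ.2 i, G.unit_mul])
  mul_smul g h γ hg hγ := Subtype.ext (funext fun i =>
    G.mul_assoc g h (γ.1 i) hg (hγ.trans (γ.2 i).symm))
  etale_anchor := isLocalHomeomorph_fibrePower G.etale_r n
  continuous_smul := by
    refine Continuous.subtype_mk (continuous_pi fun i => ?_) _
    exact continuous_mul (by fun_prop) ((continuous_coord i).comp (by fun_prop))
      fun q => q.2.trans (q.1.2.2 i).symm

/-- The semi-simplicial `G`-space `EG_*`; the face map `∂_i` omits the `i`-th entry. -/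
def EG : SemisimplicialGSpace G where
  obj := G.EGObj
  face n i := GSpace.Hom.ofContinuous (X := G.EGObj (n + 1)) (Y := G.EGObj n)
    (fun γ => ⟨fun k => γ.1 (i.succAbove k), fun _ => (γ.2 _).trans (γ.2 _).symm⟩)
    (Continuous.subtype_mk (continuous_pi fun k => continuous_coord (i.succAbove k)) _)
    (fun γ => γ.2 _) (fun _ _ _ => rfl)
  face_face _ _ _ h γ := Subtype.ext (funext fun k =>
    congrArg γ.1 (succAbove_succAbove_of_le h k))

/-- The set `BG_n` of strings `(g_1, …, g_n)` of composable arrows, `r(g_i) = s(g_{i-1})`.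
A string is recorded together with the object `r(g_1)`; in this way `BG_0` is the base space. -/
def IsString (n : ℕ) (q : G.Obj × (Fin n → G.Arr)) : Prop :=
  (∀ h : 0 < n, q.1 = G.r (q.2 ⟨0, h⟩)) ∧
    ∀ (i : ℕ) (h : i + 1 < n), G.s (q.2 ⟨i, by omega⟩) = G.r (q.2 ⟨i + 1, h⟩)

/-- The space `BG_n`. -/
abbrev BGSpace (n : ℕ) : Type u := {q : G.Obj × (Fin n → G.Arr) // G.IsString n q}

/-- The `i`-th face of a string `(g_1, …, g_{n+1})`: it is `(g_2, …, g_{n+1})` (with initial object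
`s(g_1)`) for `i = 0`, it is `(g_1, …, g_i g_{i+1}, …, g_{n+1})` for `0 < i < n + 1`, and it is
`(g_1, …, g_n)` for `i = n + 1`. -/
def stringFace (n : ℕ) (i : Fin (n + 2)) (q : G.Obj × (Fin (n + 1) → G.Arr)) :
    G.Obj × (Fin n → G.Arr) :=
  Fin.cases (motive := fun _ => G.Obj × (Fin n → G.Arr))
    (G.s (q.2 0), fun k => q.2 k.succ) (fun j => (q.1, j.contractNth G.mul q.2)) i

/-- The string `(γ_0⁻¹ γ_1, …, γ_{n-1}⁻¹ γ_n)` attached to a point of `EG_n`. -/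
def stringOf (n : ℕ) (γ : Fin (n + 1) → G.Arr) : G.Obj × (Fin n → G.Arr) :=
  (G.s (γ 0), fun k => G.mul (G.inv (γ k.castSucc)) (γ k.succ))

variable {G}

theorem isString_stringOf {n : ℕ} (γ : G.EGSpace n) : G.IsString n (G.stringOf n γ.1) := by
  have hc : ∀ k l, G.s (G.inv (γ.1 k)) = G.r (γ.1 l) := fun k l => by
    rw [G.s_inv, γ.2 k, γ.2 l]
  refine ⟨fun h => ?_, fun i h => ?_⟩
  · change G.s (γ.1 0) = G.r (G.mul _ _)
    rw [G.r_mul _ _ (hc _ _), G.r_inv]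
    rfl
  · change G.s (G.mul _ _) = G.r (G.mul _ _)
    rw [G.r_mul _ _ (hc _ _), G.s_mul _ _ (hc _ _), G.r_inv]
    rfl

theorem stringFace_stringOf {n : ℕ} (i : Fin (n + 2)) (γ : G.EGSpace (n + 1)) :
    G.stringFace n i (G.stringOf (n + 1) γ.1) =
      G.stringOf n (fun k => γ.1 (i.succAbove k)) := by
  have hc : ∀ k l, G.s (G.inv (γ.1 k)) = G.r (γ.1 l) := fun k l => by
    rw [G.s_inv, γ.2 k, γ.2 l]
  induction i using Fin.cases with
  | zero =>
    refine Prod.ext ?_ (funext fun k => rfl)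
    exact G.s_mul _ _ (hc _ _)
  | succ j =>
    refine Prod.ext ?_ (funext fun k => ?_)
    · change G.s (γ.1 0) = G.s (γ.1 _)
      rw [Fin.succ_succAbove_zero]
    · change j.contractNth G.mul _ k = G.mul (G.inv (γ.1 _)) (γ.1 _)
      rcases lt_trichotomy (k : ℕ) j with h | h | h
      · rw [Fin.contractNth_apply_of_lt _ _ _ _ h,
          Fin.succAbove_of_castSucc_lt _ _ (by rw [Fin.lt_def]; simp; omega),
          Fin.succAbove_of_castSucc_lt _ _ (by rw [Fin.lt_def]; simp; omega)]
        rfl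
      · rw [Fin.contractNth_apply_of_eq _ _ _ _ h,
          Fin.succAbove_of_castSucc_lt _ _ (by rw [Fin.lt_def]; simp; omega),
          Fin.succAbove_of_le_castSucc _ _ (by rw [Fin.le_def]; simp; omega)]
        change G.mul (G.mul (G.inv (γ.1 k.castSucc.castSucc)) (γ.1 k.castSucc.succ))
          (G.mul (G.inv (γ.1 k.castSucc.succ)) (γ.1 k.succ.succ)) = _
        rw [G.mul_assoc _ _ _ (hc _ _), inv_mul_cancel]
        · rw [γ.2, γ.2 k.succ.succ]
        · rw [G.r_mul _ _ (hc _ _), G.r_inv]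
      · rw [Fin.contractNth_apply_of_gt _ _ _ _ h,
          Fin.succAbove_of_le_castSucc _ _ (by rw [Fin.le_def]; simp; omega),
          Fin.succAbove_of_le_castSucc _ _ (by rw [Fin.le_def]; simp; omega)]
        rfl

variable (G) in
/-- The partial products `g_0, g_0 g_1, …, g_0 g_1 ⋯ g_n`. -/
def partialProd {n : ℕ} (g₀ : G.Arr) (g : Fin n → G.Arr) (i : Fin (n + 1)) : G.Arr :=
  Fin.induction (motive := fun _ => G.Arr) g₀ (fun k a => G.mul a (g k)) i

theorem partialProd_spec {n : ℕ} {g₀ : G.Arr} {q : G.Obj × (Fin n → G.Arr)} (hq : G.IsString n q)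
    (h : G.s g₀ = q.1) (i : Fin (n + 1)) :
    G.r (G.partialProd g₀ q.2 i) = G.r g₀ ∧
      ∀ hi : (i : ℕ) < n, G.s (G.partialProd g₀ q.2 i) = G.r (q.2 ⟨i, hi⟩) := by
  induction i using Fin.induction with
  | zero => exact ⟨rfl, fun hi => h.trans (hq.1 hi)⟩
  | succ k ih =>
    have hk := ih.2 k.2
    refine ⟨?_, fun hi => ?_⟩
    · exact (G.r_mul _ _ hk).trans ih.1
    · exact (G.s_mul _ _ hk).trans (hq.2 k hi)

theorem continuous_partialProd {n : ℕ} (i : Fin (n + 1)) :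
    Continuous fun q : {q : G.Arr × G.BGSpace n // G.s q.1 = q.2.1.1} =>
      G.partialProd q.1.1 q.1.2.1.2 i := by
  induction i using Fin.induction with
  | zero => exact continuous_fst.comp continuous_subtype_val
  | succ k ih =>
    refine continuous_mul ih ?_ fun q => (partialProd_spec q.1.2.2 q.2 k.castSucc).2 k.2
    fun_prop

/-- `EG_n` is the fibre product of `G` and `BG_n` over the base space. -/
def egHomeomorph (n : ℕ) : G.EGSpace n ≃ₜ {q : G.Arr × G.BGSpace n // G.s q.1 = q.2.1.1} where
  toFun γ := ⟨(γ.1 0, ⟨G.stringOf n γ.1, isString_stringOf γ⟩), rfl⟩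
  invFun q := ⟨G.partialProd q.1.1 q.1.2.1.2, fun i =>
    (partialProd_spec q.1.2.2 q.2 i).1.trans (partialProd_spec q.1.2.2 q.2 0).1.symm⟩
  left_inv γ := by
    refine Subtype.ext (funext fun i => ?_)
    change G.partialProd (γ.1 0) (G.stringOf n γ.1).2 i = γ.1 i
    induction i using Fin.induction with
    | zero => rfl
    | succ k ih =>
      change G.mul (G.partialProd (γ.1 0) (G.stringOf n γ.1).2 k.castSucc)
        (G.mul (G.inv (γ.1 k.castSucc)) (γ.1 k.succ)) = _
      rw [ih, inv_mul_cancel]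
      rw [γ.2, γ.2 k.succ]
  right_inv q := by
    refine Subtype.ext (Prod.ext rfl (Subtype.ext (Prod.ext q.2 (funext fun k => ?_))))
    exact mul_inv_cancel ((partialProd_spec q.1.2.2 q.2 k.castSucc).2 k.2)
  continuous_toFun := by
    refine Continuous.subtype_mk (Continuous.prodMk (continuous_coord 0) (Continuous.subtype_mk
      (Continuous.prodMk ?_ (continuous_pi fun k => ?_)) _)) _
    · exact G.continuous_s.comp (continuous_coord 0)
    · refine continuous_mul (G.continuous_inv.comp (continuous_coord k.castSucc))
        (continuous_coord k.succ) fun γ => ?_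
      rw [G.s_inv, γ.2, γ.2 k.succ]
  continuous_invFun :=
    Continuous.subtype_mk (continuous_pi fun i => continuous_partialProd i) _

/-- The quotient map `EG_n → BG_n`. -/
def egToBG (n : ℕ) (γ : G.EGSpace n) : G.BGSpace n := ⟨G.stringOf n γ.1, isString_stringOf γ⟩

theorem etale_egToBG (n : ℕ) : IsLocalHomeomorph (egToBG (G := G) n) :=
  (isLocalHomeomorph_pullback_snd (f := G.s) (g := fun b : G.BGSpace n => b.1.1) G.etale_s
    (by fun_prop)).comp (egHomeomorph n).isLocalHomeomorph

theorem egToBG_surjective (n : ℕ) : Function.Surjective (egToBG (G := G) n) := fun b =>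
  ⟨(egHomeomorph n).symm ⟨(G.unit b.1.1, b), G.s_unit _⟩,
    congrArg (fun q => q.1.2) ((egHomeomorph n).apply_symm_apply ⟨(G.unit b.1.1, b), G.s_unit _⟩)⟩

variable (G) in
/-- The face maps of `BG_*`. -/
def bgFace (n : ℕ) (i : Fin (n + 2)) (b : G.BGSpace (n + 1)) : G.BGSpace n :=
  ⟨G.stringFace n i b.1, by
    obtain ⟨γ, rfl⟩ := egToBG_surjective _ b
    change G.IsString n (G.stringFace n i (G.stringOf (n + 1) γ.1))
    rw [stringFace_stringOf]
    exact isString_stringOf (((G.EG).face n i).toFun γ)⟩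

theorem bgFace_egToBG (n : ℕ) (i : Fin (n + 2)) (γ : G.EGSpace (n + 1)) :
    G.bgFace n i (egToBG (n + 1) γ) = egToBG n ((G.EG.face n i).toFun γ) :=
  Subtype.ext (stringFace_stringOf i γ)

theorem isClosed_isString (n : ℕ) : IsClosed {q | G.IsString n q} := by
  have hs := G.continuous_s
  have hr := G.continuous_r
  simp only [IsString, Set.ofPred_and, Set.ofPred_forall]
  refine IsClosed.inter ?_ ?_
  · exact isClosed_iInter fun h => isClosed_eq (by fun_prop) (by fun_prop)
  · exact isClosed_iInter fun i => isClosed_iInter fun h => isClosed_eq (by fun_prop) (by fun_prop)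

variable (G) in
/-- The classifying space `BG_*` of `G`, as a semi-simplicial space. -/
def BG : SemisimplicialSpace.{u} where
  obj := G.BGSpace
  lc n := (isClosed_isString n).isClosedEmbedding_subtypeVal.locallyCompactSpace
  face := G.bgFace
  etale_face n i := by
    refine isLocalHomeomorph_of_surjective (etale_egToBG (n + 1)) (egToBG_surjective (n + 1)) ?_
    rw [show G.bgFace n i ∘ egToBG (n + 1) = egToBG n ∘ (G.EG.face n i).toFun from
      funext (bgFace_egToBG n i)]
    exact (etale_egToBG n).comp (G.EG.face n i).etale
  face_face n i j h b := by
    obtain ⟨γ, rfl⟩ := egToBG_surjective _ b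
    rw [bgFace_egToBG, bgFace_egToBG]
    exact (bgFace_egToBG n i _).trans ((congrArg (egToBG n) (G.EG.face_face n i j h γ)).trans
      (bgFace_egToBG n j _).symm)

variable (G) in
/-- The groupoid homology `H_n(G)` of Crainic–Moerdijk and Matui: the homology of the complex
`(ℤ[BG_*], ∑ (-1)^i (∂_i)_*)`. -/
noncomputable def homology (n : ℕ) : AddCommGrpCat.{u} := G.BG.complex.homology n

end AmpleGroupoid
/-- A compact open subgroupoid. -/
structure IsCompactOpenSubgroupoid (G : AmpleGroupoid.{u}) (H : Set G.Arr) : Prop where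
  isCompact : IsCompact H
  isOpen : IsOpen H
  inv_mem : ∀ g ∈ H, G.inv g ∈ H
  mul_mem : ∀ g ∈ H, ∀ h ∈ H, G.s g = G.r h → G.mul g h ∈ H

/-- A colouring `(G_0, …, G_d)`: compact open subgroupoids whose unit spaces cover the base
space. -/
structure Colouring (G : AmpleGroupoid.{u}) where
  /-- The colours are `0, …, d`. -/
  d : ℕ
  /-- The subgroupoids. -/
  sub : Fin (d + 1) → Set G.Arr
  isSub : ∀ i, IsCompactOpenSubgroupoid G (sub i)
  cover : ∀ x, ∃ i, G.unit x ∈ sub i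

namespace Colouring

variable {G : AmpleGroupoid.{u}} (C : Colouring G)

/-- The set `g G_i^{s(g)}`. -/
def coset (i : Fin (C.d + 1)) (g : G.Arr) : Set G.Arr :=
  {k | ∃ h ∈ C.sub i, G.r h = G.s g ∧ k = G.mul g h}

/-- The cover associated to a colouring: the pairs `(g G_i^{s(g)}, i)` with
`G_i^{s(g)} ≠ ∅`. -/
def Cover : Type u :=
  {U : Set G.Arr × Fin (C.d + 1) //
    ∃ g, (∃ h ∈ C.sub U.2, G.r h = G.s g) ∧ U.1 = C.coset U.2 g}

variable {C}

/-- The subset of `G` underlying an element of the cover. -/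
def Cover.set (U : C.Cover) : Set G.Arr := U.1.1

/-- The colour of an element of the cover. -/
def Cover.colour (U : C.Cover) : Fin (C.d + 1) := U.1.2

variable (C)

/-- The open sets `{(g G_i^{s(g)}, i) | g ∈ V}` generating the topology of the cover. -/
def basicOpen (i : Fin (C.d + 1)) (V : Set G.Arr) : Set C.Cover :=
  {U | U.colour = i ∧ ∃ g ∈ V, U.set = C.coset i g}

instance : TopologicalSpace C.Cover :=
  TopologicalSpace.generateFrom
    {W | ∃ (i : Fin (C.d + 1)) (V : Set G.Arr), IsOpen V ∧
      (∀ g ∈ V, ∃ h ∈ C.sub i, G.r h = G.s g) ∧ W = C.basicOpen i V}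

variable {C}

theorem exists_mem_sub_iff {i : Fin (C.d + 1)} {x : G.Obj} :
    (∃ h ∈ C.sub i, G.r h = x) ↔ G.unit x ∈ C.sub i := by
  constructor
  · rintro ⟨h, hh, rfl⟩
    rw [← G.mul_inv]
    exact (C.isSub i).mul_mem _ hh _ ((C.isSub i).inv_mem _ hh) (G.r_inv h).symm
  · intro h
    exact ⟨_, h, G.r_unit x⟩

theorem mem_coset_iff {i : Fin (C.d + 1)} {g k : G.Arr} :
    k ∈ C.coset i g ↔ G.r k = G.r g ∧ G.mul (G.inv g) k ∈ C.sub i := by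
  constructor
  · rintro ⟨h, hh, hr, rfl⟩
    exact ⟨G.r_mul _ _ hr.symm, by rwa [AmpleGroupoid.mul_inv_cancel hr.symm]⟩
  · rintro ⟨hr, hk⟩
    refine ⟨_, hk, ?_, (AmpleGroupoid.inv_mul_cancel hr.symm).symm⟩
    rw [G.r_mul _ _ (by rw [G.s_inv, hr]), G.r_inv]

theorem self_mem_coset {i : Fin (C.d + 1)} {g : G.Arr} (hg : G.unit (G.s g) ∈ C.sub i) :
    g ∈ C.coset i g :=
  mem_coset_iff.2 ⟨rfl, by rwa [G.inv_mul]⟩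

theorem unit_mem_of_mem_coset {i : Fin (C.d + 1)} {g k : G.Arr} (h : k ∈ C.coset i g) :
    G.unit (G.s k) ∈ C.sub i ∧ G.unit (G.s g) ∈ C.sub i := by
  obtain ⟨l, hl, hr, rfl⟩ := h
  refine ⟨?_, exists_mem_sub_iff.1 ⟨l, hl, hr⟩⟩
  rw [G.s_mul _ _ hr.symm, ← G.inv_mul]
  exact (C.isSub i).mul_mem _ ((C.isSub i).inv_mem _ hl) _ hl (G.s_inv l)

theorem coset_eq_of_mem {i : Fin (C.d + 1)} {g k : G.Arr} (h : k ∈ C.coset i g) :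
    C.coset i k = C.coset i g := by
  obtain ⟨l, hl, hr, rfl⟩ := h
  ext m
  rw [mem_coset_iff, mem_coset_iff, G.r_mul _ _ hr.symm]
  refine and_congr_right fun hm => ?_
  rw [AmpleGroupoid.inv_mul_eq hr.symm hm.symm]
  have hrm : G.r (G.mul (G.inv g) m) = G.s g := by
    rw [G.r_mul _ _ (by rw [G.s_inv, hm]), G.r_inv]
  constructor
  · intro h
    have h2 := (C.isSub i).mul_mem _ hl _ h (by
      rw [G.r_mul _ _ (by rw [G.s_inv, hrm, hr]), G.r_inv])
    rwa [AmpleGroupoid.inv_mul_cancel (by rw [hrm, hr])] at h2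
  · intro h
    exact (C.isSub i).mul_mem _ ((C.isSub i).inv_mem _ hl) _ h (by rw [G.s_inv, hrm, hr])

variable (C) in
/-- The element `(g G_i^{s(g)}, i)` of the cover. -/
def cls (i : Fin (C.d + 1)) (g : G.Arr) (hg : G.unit (G.s g) ∈ C.sub i) : C.Cover :=
  ⟨(C.coset i g, i), g, exists_mem_sub_iff.2 hg, rfl⟩

theorem cls_congr {i : Fin (C.d + 1)} {g k : G.Arr} (h : g = k)
    (hg : G.unit (G.s g) ∈ C.sub i) : C.cls i g hg = C.cls i k (h ▸ hg) := by
  subst h; rfl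

theorem Cover.exists_set_eq (U : C.Cover) :
    ∃ g, G.unit (G.s g) ∈ C.sub U.colour ∧ U.set = C.coset U.colour g := by
  obtain ⟨g, hg, h⟩ := U.2
  exact ⟨g, exists_mem_sub_iff.1 hg, h⟩

theorem Cover.ext {U U' : C.Cover} (h1 : U.set = U'.set) (h2 : U.colour = U'.colour) : U = U' :=
  Subtype.ext (Prod.ext h1 h2)

theorem eq_cls_of_mem {U : C.Cover} {k : G.Arr} (hk : k ∈ U.set) :
    ∃ h : G.unit (G.s k) ∈ C.sub U.colour, U = C.cls U.colour k h := by
  obtain ⟨g, hg, hS⟩ := U.exists_set_eq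
  rw [hS] at hk
  exact ⟨(unit_mem_of_mem_coset hk).1, Cover.ext (hS.trans (coset_eq_of_mem hk).symm) rfl⟩

theorem Cover.set_eq_of_mem {U : C.Cover} {k : G.Arr} (hk : k ∈ U.set) :
    U.set = C.coset U.colour k := by
  obtain ⟨_, e⟩ := eq_cls_of_mem hk
  exact congrArg Cover.set e

theorem Cover.nonempty (U : C.Cover) : U.set.Nonempty := by
  obtain ⟨g, hg, hS⟩ := U.exists_set_eq
  exact ⟨g, hS ▸ self_mem_coset hg⟩

/-- The anchor map of the cover: the common range of all elements of `U`. -/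
noncomputable def Cover.anchor (U : C.Cover) : G.Obj := G.r U.nonempty.some

theorem Cover.r_eq {U : C.Cover} {k : G.Arr} (hk : k ∈ U.set) : G.r k = U.anchor := by
  exact (mem_coset_iff.1 ((Set.ext_iff.1 (Cover.set_eq_of_mem hk) _).1
    U.nonempty.some_mem)).1.symm

theorem mem_cls {i : Fin (C.d + 1)} {g : G.Arr} (hg : G.unit (G.s g) ∈ C.sub i) :
    g ∈ (C.cls i g hg).set := self_mem_coset hg

theorem anchor_cls {i : Fin (C.d + 1)} {g : G.Arr} (hg : G.unit (G.s g) ∈ C.sub i) :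
    (C.cls i g hg).anchor = G.r g := (Cover.r_eq (mem_cls hg)).symm

theorem isOpen_units (i : Fin (C.d + 1)) : IsOpen {g | G.unit (G.s g) ∈ C.sub i} :=
  (C.isSub i).isOpen.preimage (G.continuous_unit.comp G.continuous_s)

theorem isOpen_basicOpen {i : Fin (C.d + 1)} {V : Set G.Arr} (hV : IsOpen V)
    (h : ∀ g ∈ V, G.unit (G.s g) ∈ C.sub i) : IsOpen (C.basicOpen i V) :=
  TopologicalSpace.isOpen_generateFrom_of_mem
    ⟨i, V, hV, fun g hg => exists_mem_sub_iff.2 (h g hg), rfl⟩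

theorem cls_mem_basicOpen {i : Fin (C.d + 1)} {V : Set G.Arr} {g : G.Arr} (hg : g ∈ V)
    (h : G.unit (G.s g) ∈ C.sub i) : C.cls i g h ∈ C.basicOpen i V := ⟨rfl, g, hg, rfl⟩

theorem continuous_cls (i : Fin (C.d + 1)) :
    Continuous fun g : {g : G.Arr // G.unit (G.s g) ∈ C.sub i} => C.cls i g.1 g.2 := by
  refine continuous_generateFrom_iff.2 ?_
  rintro _ ⟨j, V, hV, hVj, rfl⟩
  refine isOpen_iff_mem_nhds.2 ?_
  rintro ⟨g, hg⟩ ⟨hij, v, hv, hgv⟩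
  change i = j at hij
  subst hij
  change C.coset i g = C.coset i v at hgv
  have hmem : g ∈ C.coset i v := hgv ▸ self_mem_coset hg
  obtain ⟨k, hk, hkr, hgk⟩ := hmem
  obtain ⟨τ, h1, h2, h3, -⟩ := exists_section G.etale_s k
  have hsk : G.s g = G.s k := by rw [hgk, G.s_mul _ _ hkr.symm]
  have hs : Tendsto G.s (𝓝 g) (𝓝 (G.s k)) := by
    rw [← hsk]; exact G.continuous_s.continuousAt
  have hτ : ContinuousAt (fun g' => τ (G.s g')) g := by
    have : ContinuousAt τ (G.s g) := by rw [hsk]; exact h1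
    exact this.comp G.continuous_s.continuousAt
  have hτg : τ (G.s g) = k := by rw [hsk, h2]
  have hvk : G.mul g (G.inv k) = v := by
    rw [hgk, G.mul_assoc _ _ _ hkr.symm (G.r_inv k).symm, G.mul_inv, hkr, G.mul_unit]
  have hcomp : ∀ᶠ g' in 𝓝 g, G.s g' = G.s (τ (G.s g')) :=
    (hs.eventually h3).mono fun _ h => h.symm
  have hcont : ContinuousAt (fun g' => G.mul g' (G.inv (τ (G.s g')))) g := by
    refine AmpleGroupoid.continuousAt_mul continuousAt_id
      (G.continuous_inv.continuousAt.comp hτ) ?_ ?_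
    · rw [G.r_inv, hτg, hsk]
    · filter_upwards [hcomp] with g' h
      rw [G.r_inv]; exact h
  have hV' : ∀ᶠ g' in 𝓝 g, G.mul g' (G.inv (τ (G.s g'))) ∈ V := by
    refine hcont.eventually (hV.mem_nhds ?_)
    change G.mul g (G.inv (τ (G.s g))) ∈ V
    rwa [hτg, hvk]
  have hK' : ∀ᶠ g' in 𝓝 g, τ (G.s g') ∈ C.sub i := by
    refine hτ.eventually ((C.isSub i).isOpen.mem_nhds ?_)
    change τ (G.s g) ∈ C.sub i
    rwa [hτg]
  have hval : Tendsto (Subtype.val : {g : G.Arr // G.unit (G.s g) ∈ C.sub i} → G.Arr)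
      (𝓝 ⟨g, hg⟩) (𝓝 g) := continuous_subtype_val.continuousAt
  filter_upwards [hval.eventually hcomp, hval.eventually hV', hval.eventually hK']
    with g' e1 e2 e3
  refine ⟨rfl, _, e2, ?_⟩
  refine coset_eq_of_mem ⟨τ (G.s g'.1), e3, ?_, (AmpleGroupoid.mul_mul_inv_cancel e1).symm⟩
  rw [G.s_mul _ _ (e1.trans (G.r_inv _).symm), G.s_inv]

theorem continuous_anchor : Continuous (Cover.anchor (C := C)) := by
  refine continuous_def.2 fun O hO => isOpen_iff_mem_nhds.2 fun U hU => ?_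
  obtain ⟨g, hg⟩ := U.nonempty
  obtain ⟨h, e⟩ := eq_cls_of_mem hg
  have hV : IsOpen ({g | G.unit (G.s g) ∈ C.sub U.colour} ∩ G.r ⁻¹' O) :=
    (isOpen_units _).inter (hO.preimage G.continuous_r)
  refine Filter.mem_of_superset ((isOpen_basicOpen (i := U.colour) hV fun g hg => hg.1).mem_nhds
    ⟨rfl, g, ⟨h, ?_⟩, ?_⟩) ?_
  · change G.r g ∈ O
    rwa [Cover.r_eq hg]
  · exact congrArg Cover.set e
  · rintro U' ⟨-, g', ⟨h1, h2⟩, hU'⟩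
    have : g' ∈ U'.set := hU' ▸ self_mem_coset h1
    change U'.anchor ∈ O
    rw [← Cover.r_eq this]
    exact h2

instance : T2Space C.Cover := by
  refine ⟨fun U U' hne => ?_⟩
  by_cases hc : U.colour = U'.colour
  swap
  · refine ⟨C.basicOpen U.colour {g | G.unit (G.s g) ∈ C.sub U.colour},
      C.basicOpen U'.colour {g | G.unit (G.s g) ∈ C.sub U'.colour},
      isOpen_basicOpen (isOpen_units _) fun g hg => hg,
      isOpen_basicOpen (isOpen_units _) fun g hg => hg, ?_, ?_, ?_⟩
    · obtain ⟨g, hg⟩ := U.nonempty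
      obtain ⟨h, e⟩ := eq_cls_of_mem hg
      exact ⟨rfl, g, h, congrArg Cover.set e⟩
    · obtain ⟨g, hg⟩ := U'.nonempty
      obtain ⟨h, e⟩ := eq_cls_of_mem hg
      exact ⟨rfl, g, h, congrArg Cover.set e⟩
    · exact Set.disjoint_left.2 fun W h1 h2 => hc (h1.1.symm.trans h2.1)
  by_cases hr : U.anchor = U'.anchor
  swap
  · exact separated_by_continuous continuous_anchor hr
  obtain ⟨g, hg⟩ := U.nonempty
  obtain ⟨k, hk⟩ := U'.nonempty
  have e1 := Cover.set_eq_of_mem hg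
  have e2 := Cover.set_eq_of_mem hk
  have h1 : G.unit (G.s g) ∈ C.sub U.colour := (eq_cls_of_mem hg).1
  have h2 : G.unit (G.s k) ∈ C.sub U'.colour := (eq_cls_of_mem hk).1
  rw [← hc] at h2 e2
  set i := U.colour with hi
  have hgk : G.r g = G.r k := by rw [Cover.r_eq hg, Cover.r_eq hk, hr]
  have hnot : G.mul (G.inv k) g ∉ C.sub i := fun hmem => by
    refine hne (Cover.ext (e1.trans (Eq.trans ?_ e2.symm)) hc)
    exact coset_eq_of_mem (mem_coset_iff.2 ⟨hgk, hmem⟩)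
  have hclosed : IsClosed (C.sub i) := (C.isSub i).isCompact.isClosed
  have hcont : ContinuousWithinAt (fun q : G.Arr × G.Arr => G.mul (G.inv q.1) q.2)
      {q | G.r q.1 = G.r q.2} (k, g) := by
    refine ContinuousWithinAt.comp (t := {q : G.Arr × G.Arr | G.s q.1 = G.r q.2})
      (f := fun q : G.Arr × G.Arr => (G.inv q.1, q.2)) (x := (k, g))
      (g := fun q : G.Arr × G.Arr => G.mul q.1 q.2)
      (G.continuousOn_mul (G.inv k, g) ((G.s_inv k).trans hgk.symm)) ?_ ?_
    · exact ((G.continuous_inv.comp continuous_fst).prodMk continuous_snd).continuousWithinAt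
    · intro q hq
      exact (G.s_inv q.1).trans hq
  have hev := hcont.eventually (hclosed.isOpen_compl.mem_nhds hnot)
  rw [eventually_nhdsWithin_iff, nhds_prod_eq, Filter.eventually_prod_iff] at hev
  obtain ⟨p, hp, p', hp', hpp⟩ := hev
  obtain ⟨A, hA, hAo, hkA⟩ := eventually_nhds_iff.1 hp
  obtain ⟨B, hB, hBo, hgB⟩ := eventually_nhds_iff.1 hp'
  refine ⟨C.basicOpen i (B ∩ {g | G.unit (G.s g) ∈ C.sub i}),
      C.basicOpen i (A ∩ {g | G.unit (G.s g) ∈ C.sub i}),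
      isOpen_basicOpen (hBo.inter (isOpen_units _)) fun g hg => hg.2,
      isOpen_basicOpen (hAo.inter (isOpen_units _)) fun g hg => hg.2,
      ⟨rfl, g, ⟨hgB, h1⟩, e1⟩,
      ⟨hc.symm, k, ⟨hkA, h2⟩, e2⟩, ?_⟩
  refine Set.disjoint_left.2 ?_
  rintro W ⟨-, b, ⟨hb, hb'⟩, hWb⟩ ⟨-, a, ⟨ha, -⟩, hWa⟩
  have : b ∈ C.coset i a := by
    rw [← hWa, hWb]; exact self_mem_coset hb'
  obtain ⟨h3, h4⟩ := mem_coset_iff.1 this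
  exact hpp (hA a ha) (hB b hb) h3.symm h4

theorem smul_image {i : Fin (C.d + 1)} {g k : G.Arr} (h : G.s g = G.r k) :
    G.mul g '' C.coset i k = C.coset i (G.mul g k) := by
  ext m
  rw [mem_coset_iff, G.r_mul _ _ h]
  constructor
  · rintro ⟨l, hl, rfl⟩
    obtain ⟨h1, h2⟩ := mem_coset_iff.1 hl
    refine ⟨G.r_mul _ _ (h.trans h1.symm), ?_⟩
    rw [AmpleGroupoid.inv_mul_eq h (G.r_mul _ _ (h.trans h1.symm)).symm,
      AmpleGroupoid.mul_inv_cancel (h.trans h1.symm)]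
    exact h2
  · rintro ⟨h1, h2⟩
    refine ⟨G.mul (G.inv g) m, mem_coset_iff.2 ⟨?_, ?_⟩, AmpleGroupoid.inv_mul_cancel h1.symm⟩
    · rw [G.r_mul _ _ (by rw [G.s_inv, h1]), G.r_inv, h]
    · rwa [AmpleGroupoid.inv_mul_eq h h1.symm] at h2

/-- The action of an arrow `g` on an element `U` of the cover with `s g = r(U)`:
`g (U, i) = (g U, i)`. -/
def Cover.smul (g : G.Arr) (U : C.Cover) (h : G.s g = U.anchor) : C.Cover :=
  ⟨(G.mul g '' U.set, U.colour), by
    obtain ⟨k, hk⟩ := U.nonempty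
    have hgk : G.s g = G.r k := h.trans (Cover.r_eq hk).symm
    refine ⟨G.mul g k, ?_, ?_⟩
    · rw [G.s_mul _ _ hgk]
      exact exists_mem_sub_iff.2 (eq_cls_of_mem hk).1
    · rw [Cover.set_eq_of_mem hk]
      exact smul_image hgk⟩

theorem smul_cls {i : Fin (C.d + 1)} {g k : G.Arr} (hk : G.unit (G.s k) ∈ C.sub i)
    (h : G.s g = (C.cls i k hk).anchor) :
    Cover.smul g (C.cls i k hk) h = C.cls i (G.mul g k)
      (by rwa [G.s_mul _ _ (h.trans (anchor_cls hk))]) :=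
  Cover.ext (smul_image (h.trans (anchor_cls hk))) rfl

theorem Cover.mem_smul {g k : G.Arr} {U : C.Cover} (h : G.s g = U.anchor) (hk : k ∈ U.set) :
    G.mul g k ∈ (Cover.smul g U h).set := Set.mem_image_of_mem _ hk

theorem Cover.anchor_smul {g : G.Arr} {U : C.Cover} (h : G.s g = U.anchor) :
    (Cover.smul g U h).anchor = G.r g := by
  obtain ⟨k, hk⟩ := U.nonempty
  rw [← Cover.r_eq (Cover.mem_smul h hk), G.r_mul _ _ (h.trans (Cover.r_eq hk).symm)]

theorem continuous_smul : Continuous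
    fun q : {q : G.Arr × C.Cover // G.s q.1 = q.2.anchor} => Cover.smul q.1.1 q.1.2 q.2 := by
  refine continuous_iff_continuousAt.2 ?_
  rintro ⟨⟨g, U⟩, hgU⟩
  obtain ⟨k, hk⟩ := U.nonempty
  obtain ⟨i, hks, rfl⟩ : ∃ i, ∃ h : G.unit (G.s k) ∈ C.sub i, U = C.cls i k h :=
    ⟨U.colour, eq_cls_of_mem hk⟩
  change G.s g = (C.cls i k hks).anchor at hgU
  intro W hW
  obtain ⟨W', hW', hWo, hgW⟩ := mem_nhds_iff.1 hW
  change Cover.smul g (C.cls i k hks) hgU ∈ W' at hgW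
  rw [smul_cls] at hgW
  obtain ⟨τ, h1, h2, h3, h4⟩ := exists_section G.etale_r k
  have hak : (C.cls i k hks).anchor = G.r k := anchor_cls hks
  have hgk : G.s g = G.r k := hgU.trans hak
  -- the cover elements near `U` are the classes of `τ` of their anchors
  obtain ⟨O, hO, hOo, hkO⟩ := eventually_nhds_iff.1 h4
  have hnear : ∀ᶠ U' in 𝓝 (C.cls i k hks), ∃ h : G.unit (G.s (τ U'.anchor)) ∈ C.sub i,
      U' = C.cls i (τ U'.anchor) h := by
    have hop := isOpen_basicOpen (C := C) (i := i) (hOo.inter (isOpen_units i)) fun g hg => hg.2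
    filter_upwards [hop.mem_nhds ⟨rfl, k, ⟨hkO, hks⟩, rfl⟩]
    rintro U' ⟨hc, k', ⟨hk', hu⟩, hU'⟩
    have hm : k' ∈ U'.set := hU' ▸ self_mem_coset hu
    have he : τ U'.anchor = k' := by rw [← Cover.r_eq hm, hO k' hk']
    refine ⟨he.symm ▸ hu, Cover.ext (hU'.trans ?_) hc⟩
    change C.coset i k' = C.coset i (τ U'.anchor)
    rw [he]
  -- the open set of arrows whose class lies in `W'`
  have hA := (isOpen_units i).isOpenMap_subtype_val _ (hWo.preimage (continuous_cls (C := C) i))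
  set A : Set G.Arr := Subtype.val '' ((fun g : {g : G.Arr // G.unit (G.s g) ∈ C.sub i} =>
    C.cls i g.1 g.2) ⁻¹' W') with hAdef
  have hgA : G.mul g k ∈ A :=
    ⟨⟨G.mul g k, (G.s_mul _ _ hgk).symm ▸ hks⟩, hgW, rfl⟩
  have hsnd : Tendsto (fun q : {q : G.Arr × C.Cover // G.s q.1 = q.2.anchor} => q.1.2)
      (𝓝 ⟨(g, C.cls i k hks), hgU⟩) (𝓝 (C.cls i k hks)) :=
    (continuous_snd.comp continuous_subtype_val).continuousAt
  have hanc : Tendsto (fun q : {q : G.Arr × C.Cover // G.s q.1 = q.2.anchor} => q.1.2.anchor)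
      (𝓝 ⟨(g, C.cls i k hks), hgU⟩) (𝓝 (G.r k)) := by
    rw [← hak]
    exact continuous_anchor.continuousAt.tendsto.comp hsnd
  have hτk : τ (C.cls i k hks).anchor = k := by rw [hak, h2]
  have hcont : ContinuousAt (fun q : {q : G.Arr × C.Cover // G.s q.1 = q.2.anchor} =>
      G.mul q.1.1 (τ q.1.2.anchor)) ⟨(g, C.cls i k hks), hgU⟩ := by
    refine AmpleGroupoid.continuousAt_mul
      (continuous_fst.comp continuous_subtype_val).continuousAt ?_ ?_ ?_
    · change Tendsto _ _ (𝓝 (τ (C.cls i k hks).anchor))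
      have : Tendsto τ (𝓝 (G.r k)) (𝓝 (τ (C.cls i k hks).anchor)) := by rw [hak]; exact h1
      exact this.comp hanc
    · change G.s g = G.r (τ (C.cls i k hks).anchor)
      rw [hτk, hgk]
    · filter_upwards [hanc.eventually h3] with q hq
      rw [hq, q.2]
  have hev : ∀ᶠ q in 𝓝 (⟨(g, C.cls i k hks), hgU⟩ :
      {q : G.Arr × C.Cover // G.s q.1 = q.2.anchor}), G.mul q.1.1 (τ q.1.2.anchor) ∈ A := by
    refine hcont.eventually (hA.mem_nhds ?_)
    change G.mul g (τ (C.cls i k hks).anchor) ∈ A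
    rwa [hτk]
  rw [Filter.mem_map]
  filter_upwards [hev, hsnd.eventually hnear] with q hqA hq
  obtain ⟨hu, hq⟩ := hq
  obtain ⟨a, haW, ha⟩ := hqA
  refine hW' ?_
  have hh : G.s q.1.1 = (C.cls i (τ q.1.2.anchor) hu).anchor := hq ▸ q.2
  have e1 : Cover.smul q.1.1 q.1.2 q.2 = Cover.smul q.1.1 (C.cls i (τ q.1.2.anchor) hu) hh :=
    Cover.ext (congrArg (fun U => G.mul q.1.1 '' Cover.set U) hq)
      (show q.1.2.colour = (C.cls i (τ q.1.2.anchor) hu).colour from congrArg Cover.colour hq)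
  change Cover.smul q.1.1 q.1.2 q.2 ∈ W'
  rw [e1, smul_cls, ← cls_congr ha a.2]
  exact haW

variable (C)

/-- The `n`-simplices of the nerve: tuples `(U_0, …, U_n)` of elements of the cover with
`U_0 ∩ ⋯ ∩ U_n ≠ ∅`. -/
abbrev NerveSpace (n : ℕ) : Type u :=
  {U : Fin (n + 1) → C.Cover // (⋂ j, (U j).set).Nonempty}

variable {C}

theorem NerveSpace.anchor_eq {n : ℕ} (U : C.NerveSpace n) (j : Fin (n + 1)) :
    (U.1 j).anchor = (U.1 0).anchor := by
  obtain ⟨k, hk⟩ := U.2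
  rw [Set.mem_iInter] at hk
  rw [← Cover.r_eq (hk j), ← Cover.r_eq (hk 0)]

theorem NerveSpace.nonempty_face {n : ℕ} (U : C.NerveSpace (n + 1)) (i : Fin (n + 2)) :
    (⋂ k, (U.1 (i.succAbove k)).set).Nonempty := by
  obtain ⟨g, hg⟩ := U.2
  rw [Set.mem_iInter] at hg
  exact ⟨g, Set.mem_iInter.2 fun k => hg _⟩

theorem continuous_nerve_anchor (n : ℕ) :
    Continuous fun U : C.NerveSpace n => (U.1 0).anchor :=
  continuous_anchor.comp (continuous_coord 0)

theorem isLocalHomeomorph_nerve_anchor (n : ℕ) :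
    IsLocalHomeomorph fun U : C.NerveSpace n => (U.1 0).anchor := by
  refine isLocalHomeomorph_of_injOn (continuous_nerve_anchor n)
    (IsOpenMap.of_nhds_le fun U => ?_) fun U => ?_
  · obtain ⟨k, hk⟩ := U.2
    rw [Set.mem_iInter] at hk
    have hu : ∀ j, G.unit (G.s k) ∈ C.sub (U.1 j).colour := fun j => (eq_cls_of_mem (hk j)).1
    let D : Set G.Arr := ⋂ j, {g | G.unit (G.s g) ∈ C.sub (U.1 j).colour}
    have hD : IsOpen D := isOpen_iInter_of_finite fun j => isOpen_units _
    have hmem : ∀ g : D, ∀ j, G.unit (G.s g.1) ∈ C.sub (U.1 j).colour := fun g j =>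
      Set.iInter_subset (fun j => {g | G.unit (G.s g) ∈ C.sub (U.1 j).colour}) j g.2
    let Θ : D → C.NerveSpace n := fun g => ⟨fun j => C.cls (U.1 j).colour g.1 (hmem g j),
      g.1, Set.mem_iInter.2 fun j => mem_cls _⟩
    have hΘ : Continuous Θ := by
      refine Continuous.subtype_mk (continuous_pi fun j => ?_) _
      exact (continuous_cls (C := C) (U.1 j).colour).comp
        (Continuous.subtype_mk continuous_subtype_val fun g => hmem g j)
    have hkD : k ∈ D := Set.mem_iInter.2 hu
    have hΘk : Θ ⟨k, hkD⟩ = U := Subtype.ext (funext fun j => (eq_cls_of_mem (hk j)).2.symm)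
    have hcomp : ∀ g : D, ((Θ g).1 0).anchor = G.r g.1 := fun g => anchor_cls (hmem g 0)
    have hopen : IsOpenMap fun g : D => G.r g.1 :=
      G.etale_r.isOpenMap.comp hD.isOpenMap_subtype_val
    have h1 := hopen.nhds_le ⟨k, hkD⟩
    have h2 : (fun g : D => G.r g.1) = (fun U : C.NerveSpace n => (U.1 0).anchor) ∘ Θ :=
      funext fun g => (hcomp g).symm
    rw [h2, ← Filter.map_map] at h1
    change 𝓝 (G.r k) ≤ _ at h1
    have h3 := hΘ.continuousAt (x := ⟨k, hkD⟩)
    rw [ContinuousAt, hΘk] at h3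
    rw [Cover.r_eq (hk 0)] at h1
    exact h1.trans (Filter.map_mono h3)
  · have hloc : ∀ j, ∃ N ∈ 𝓝 (U.1 j), ∀ W ∈ N, ∀ W' ∈ N, W.anchor = W'.anchor → W = W' := by
      intro j
      obtain ⟨k, hk⟩ := (U.1 j).nonempty
      have hu : G.unit (G.s k) ∈ C.sub (U.1 j).colour := (eq_cls_of_mem hk).1
      obtain ⟨O, hO, hkO, hinj⟩ := G.etale_r.isLocallyInjective k
      have hop := isOpen_basicOpen (C := C) (i := (U.1 j).colour)
        (hO.inter (isOpen_units _)) fun g hg => hg.2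
      refine ⟨_, hop.mem_nhds ⟨rfl, k, ⟨hkO, hu⟩, Cover.set_eq_of_mem hk⟩, ?_⟩
      rintro W ⟨hc, a, ⟨ha, hau⟩, hW⟩ W' ⟨hc', b, ⟨hb, hbu⟩, hW'⟩ hWW
      have h1 : G.r a = W.anchor := Cover.r_eq (by rw [hW]; exact self_mem_coset hau)
      have h2 : G.r b = W'.anchor := Cover.r_eq (by rw [hW']; exact self_mem_coset hbu)
      have hab : a = b := hinj ha hb (by rw [h1, h2, hWW])
      exact Cover.ext (by rw [hW, hW', hab]) (hc.trans hc'.symm)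
    choose N hN hNinj using hloc
    refine ⟨{V | ∀ j, V.1 j ∈ N j}, ?_, ?_⟩
    · exact eventually_all.2 fun j => (continuous_coord j).continuousAt.eventually (hN j)
    · intro V hV V' hV' h
      refine Subtype.ext (funext fun j => hNinj j _ (hV j) _ (hV' j) ?_)
      rw [V.anchor_eq, V'.anchor_eq]
      exact h

variable (C)

/-- The `G`-space `N_n` of `n`-simplices of the nerve, with `G` acting by
`g (U_0, …, U_n) = (g U_0, …, g U_n)`. -/
noncomputable def nerveObj (n : ℕ) : GSpace G where
  carrier := C.NerveSpace n
  lc := locallyCompactSpace_of_isLocalHomeomorph (isLocalHomeomorph_nerve_anchor n)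
  anchor U := (U.1 0).anchor
  smul g U h := ⟨fun j => Cover.smul g (U.1 j) (h.trans (U.anchor_eq j).symm), by
    obtain ⟨k, hk⟩ := U.2
    rw [Set.mem_iInter] at hk
    exact ⟨G.mul g k, Set.mem_iInter.2 fun j => Cover.mem_smul _ (hk j)⟩⟩
  anchor_smul g U h := Cover.anchor_smul h
  unit_smul U := by
    refine Subtype.ext (funext fun j => Cover.ext ?_ rfl)
    change G.mul (G.unit (U.1 0).anchor) '' (U.1 j).set = (U.1 j).set
    refine (Set.image_congr (g := id) fun k hk => ?_).trans (Set.image_id _)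
    rw [← U.anchor_eq j, ← Cover.r_eq hk, G.unit_mul]
    rfl
  mul_smul g h U hg hU := by
    refine Subtype.ext (funext fun j => Cover.ext ?_ rfl)
    change G.mul (G.mul g h) '' (U.1 j).set = G.mul g '' (G.mul h '' (U.1 j).set)
    rw [Set.image_image]
    refine Set.image_congr fun k hk => G.mul_assoc _ _ _ hg ?_
    rw [Cover.r_eq hk, U.anchor_eq j, hU]
  etale_anchor := isLocalHomeomorph_nerve_anchor n
  continuous_smul := by
    refine Continuous.subtype_mk (continuous_pi fun j => ?_) _
    refine continuous_smul.comp (Continuous.subtype_mk (f := fun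
      q : {q : G.Arr × C.NerveSpace n // G.s q.1 = (q.2.1 0).anchor} => (q.1.1, q.1.2.1 j)) ?_
      fun q => q.2.trans (q.1.2.anchor_eq j).symm)
    exact (continuous_fst.comp continuous_subtype_val).prodMk
      ((continuous_coord j).comp (continuous_snd.comp continuous_subtype_val))

/-- The nerve of a colouring, as a semi-simplicial `G`-space; the face map `∂_i` omits the `i`-th
entry. -/
noncomputable def nerve : SemisimplicialGSpace G where
  obj := C.nerveObj
  face n i := GSpace.Hom.ofContinuous (X := C.nerveObj (n + 1)) (Y := C.nerveObj n)
    (fun U => ⟨fun k => U.1 (i.succAbove k), NerveSpace.nonempty_face U i⟩)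
    (Continuous.subtype_mk (continuous_pi fun k => continuous_coord (i.succAbove k)) _)
    (fun U => NerveSpace.anchor_eq U _) (fun _ _ _ => rfl)
  face_face _ _ _ h U := Subtype.ext (funext fun k =>
    congrArg U.1 (succAbove_succAbove_of_le h k))

/-- The homology `H_n(C)` of a colouring: the equivariant homology of its nerve. -/
noncomputable def homology (n : ℕ) : AddCommGrpCat.{u} := C.nerve.homology n

variable {C}

/-- The subset of `G` underlying a point of `N_0`. -/
def vertexSet (U : (C.nerve.obj 0).carrier) : Set G.Arr := (Subtype.val U 0).set

end Colouring

/-- The product `A B = {g h | g ∈ A, h ∈ B, s(g) = r(h)}` of sets of arrows. -/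
def setMul (G : AmpleGroupoid.{u}) (A B : Set G.Arr) : Set G.Arr :=
  {k | ∃ g ∈ A, ∃ h ∈ B, G.s g = G.r h ∧ k = G.mul g h}

/-- An anti-Čech sequence for `G`. The morphism `map m` goes from the nerve of the `m`-th colouring
to that of the `(m+1)`-st. -/
structure AntiCechSequence (G : AmpleGroupoid.{u}) where
  /-- The colourings. -/
  colouring : ℕ → Colouring G
  /-- The morphisms between the nerves. -/
  map : ∀ m, SemisimplicialGSpace.Hom (colouring m).nerve (colouring (m + 1)).nerve
  subset_map : ∀ m (U : ((colouring m).nerve.obj 0).carrier),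
    Colouring.vertexSet U ⊆ Colouring.vertexSet (((map m).app 0).toFun U)
  absorbing : ∀ K : Set G.Arr, IsCompact K → IsOpen K →
    ∃ m₀, ∀ m, m₀ ≤ m → ∀ U : ((colouring m).nerve.obj 0).carrier,
      setMul G (Colouring.vertexSet U) K ⊆ Colouring.vertexSet (((map m).app 0).toFun U)

/-- The homology `H_n(A)` of an anti-Čech sequence: the direct limit of the homology groups of the
colourings along the maps induced by the given morphisms of nerves. -/
noncomputable def AntiCechSequence.homology {G : AmpleGroupoid.{u}} (A : AntiCechSequence G)
    (n : ℕ) : AddCommGrpCat.{u} :=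
  Limits.colimit (Functor.ofSequence (X := fun m => (A.colouring m).homology n)
    fun m => (A.map m).homologyMap n)

end AntiCech

/-!
The homology of `G` and the homology of a colouring are both equivariant homology groups of
semi-simplicial `G`-spaces, and they are compared inside the simplicial space `EG`, whose
`n`-simplices are the tuples `(g_0, …, g_n)` of arrows with a common range. Summation along the
quotient map identifies the coinvariants of `ℤ[EG_n]` with `ℤ[BG_n]`, so that the homology of `G`
is the equivariant homology of `EG` (`AmpleGroupoid.complexIso`).

*From the nerves to `EG`.* A compact open subgroupoid `G_i` of a principal groupoid has an open
fundamental domain in its unit space, assembled from finitely many compact open sets to which `G_i`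
restricts trivially. Every coset `g G_i` therefore contains exactly one arrow whose source
lies in the domain. Choosing it is continuous and equivariant, and entrywise choice is a morphism
from the nerve of a colouring to `EG` (`Colouring.Representative.toEG`).

*From `EG` to the nerves.* For a compact open `K ⊆ G`, the tuples of `EG` with all `g_i⁻¹ g_j` in
`K` form an open invariant subspace, the Rips space of `K`. These spaces exhaust `EG`, and homology
commutes with this directed union (`OpenSub.exists_homologyMap_incl_eq` and
`OpenSub.exists_homologyMap_inclusion_eq_zero`). If the morphism from `N` to `N'` in the anti-Čech
sequence satisfies `ι(U) ⊇ U K`, then sending `g` to `ι(V)` for a continuously chosen coset `V`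
containing `g` maps the Rips space of `K` to `N'`: the sets assigned to `g_0, …, g_n` have the
common point `g_0` (`Colouring.exists_ripsToNerve`).

*Homotopies.* The prism operator shows that two morphisms `φ`, `ψ` induce the same map on homology
as soon as all the tuples `(φ_0, …, φ_i, ψ_i, …, ψ_n)` are again simplices. In `EG` this is always
the case (`AmpleGroupoid.homologyMap_eq`), in a nerve it is the case when the sets in `φ(x)` and
`ψ(x)` together have a common point (`Colouring.homologyMap_eq`).

Consequently the morphisms from the nerves to `EG` induce a map from the direct limit to the
homology of `EG`. It is surjective since every class comes from a Rips space, and injective since a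
class of a nerve that dies in `EG` dies in a Rips space, while the composition from the nerve
through a Rips space to a later nerve is contiguous to the structure map of the sequence.
-/

namespace AntiCech

open Topology Filter CategoryTheory
open scoped CompactlySupported

universe u v w

/-! ### Integer-valued functions of compact support -/

section Functions

variable {X : Type u} {Y : Type v} [TopologicalSpace X] [TopologicalSpace Y]

/-- A subring of `ℤ[X]` (not assumed unital) which contains bump functions near every point is
all of `ℤ[X]`. This replaces decompositions of functions into disjoint indicators. -/
theorem addSubgroup_eq_top_of_bump (M : AddSubgroup C_c(X, ℤ))
    (hmul : ∀ a ∈ M, ∀ b ∈ M, a * b ∈ M)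
    (hM : ∀ x, ∀ W ∈ 𝓝 x, ∃ m ∈ M, m x = 1 ∧ Function.support m ⊆ W) : M = ⊤ := by
  classical
  refine (AddSubgroup.eq_top_iff' _).2 fun a => ?_
  have hW : ∀ x, {y | a y = a x} ∈ 𝓝 x := fun x =>
    a.continuous.continuousAt (x := x) (show ({a x} : Set ℤ) ∈ 𝓝 (a x) by simp)
  choose m hmM hmx hms using fun x => hM x _ (hW x)
  have ham : ∀ x, a * m x = a x • m x := by
    intro x
    ext y
    by_cases hy : m x y = 0
    · simp [hy]
    · have h : a y = a x := hms x hy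
      simp [h]
  have hU : ∀ x, {y | m x y = 1} ∈ 𝓝 x := fun x =>
    (m x).continuous.continuousAt (x := x) (show ({1} : Set ℤ) ∈ 𝓝 (m x x) by simp [hmx])
  -- the `e` for which `a * e` is in `M` are closed under `(e, m) ↦ e + m - e * m`, which turns
  -- functions equal to `1` on two sets into one equal to `1` on the union
  have key : ∀ t : Finset X, ∃ e ∈ M, a * e ∈ M ∧ ∀ x ∈ t, ∀ y, m x y = 1 → e y = 1 := by
    intro t
    induction t using Finset.induction with
    | empty => exact ⟨0, M.zero_mem, by simp [M.zero_mem], by simp⟩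
    | insert x t _ ih =>
      obtain ⟨e, heM, hae, he⟩ := ih
      have hamx : a * m x ∈ M := by rw [ham]; exact M.zsmul_mem (hmM x) _
      refine ⟨e + m x - e * m x, M.sub_mem (M.add_mem heM (hmM x)) (hmul _ heM _ (hmM x)), ?_, ?_⟩
      · rw [mul_sub, mul_add, ← mul_assoc]
        exact M.sub_mem (M.add_mem hae hamx) (hmul _ hae _ (hmM x))
      · intro z hz y hy
        simp only [CompactlySupportedContinuousMap.coe_sub,
          CompactlySupportedContinuousMap.coe_add, CompactlySupportedContinuousMap.coe_mul,
          Pi.sub_apply, Pi.add_apply, Pi.mul_apply]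
        rcases Finset.mem_insert.1 hz with rfl | hz
        · rw [hy]; ring
        · rw [he z hz y hy]; ring
  obtain ⟨t, -, ht⟩ := a.hasCompactSupport.isCompact.elim_nhds_subcover _ fun x _ => hU x
  obtain ⟨e, -, hae, he⟩ := key t
  have : a * e = a := by
    ext y
    by_cases hy : a y = 0
    · simp [hy]
    · obtain ⟨x, hx, hxy⟩ := Set.mem_iUnion₂.1 (ht (subset_tsupport _ hy))
      simp [he x hx y hxy]
  rwa [this] at hae

/-- The indicator function of a compact open set. -/
noncomputable def compactOpenIndicator [T2Space X] (A : Set X) (hc : IsCompact A)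
    (ho : IsOpen A) : C_c(X, ℤ) where
  toFun := A.indicator 1
  continuous_toFun := by
    refine continuous_const.indicator fun x hx => ?_
    have hA : IsClopen A := ⟨hc.isClosed, ho⟩
    rw [hA.frontier_eq] at hx
    exact hx.elim
  hasCompactSupport' := HasCompactSupport.intro hc fun x hx => Set.indicator_of_notMem hx _

theorem exists_isCompact_isOpen [PrespectralSpace X] {x : X} {W : Set X} (hW : W ∈ 𝓝 x) :
    ∃ A, IsCompact A ∧ IsOpen A ∧ x ∈ A ∧ A ⊆ W := by
  obtain ⟨A, ⟨h1, h2⟩, h3, h4⟩ :=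
    (PrespectralSpace.isTopologicalBasis (X := X)).mem_nhds_iff.1 hW
  exact ⟨A, h2, h1, h3, h4⟩

theorem exists_isCompact_isOpen_superset [PrespectralSpace X] {S : Set X} (hS : IsCompact S) :
    ∃ K, IsCompact K ∧ IsOpen K ∧ S ⊆ K := by
  choose A hc ho hx _ using fun x : X => exists_isCompact_isOpen (x := x) univ_mem
  obtain ⟨t, -, ht⟩ := hS.elim_nhds_subcover A fun x _ => (ho x).mem_nhds (hx x)
  exact ⟨_, t.isCompact_biUnion fun x _ => hc x, isOpen_biUnion fun x _ => ho x, ht⟩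

theorem prespectralSpace_of_isLocalHomeomorph [PrespectralSpace Y] {f : X → Y}
    (hf : IsLocalHomeomorph f) : PrespectralSpace X := by
  refine ⟨TopologicalSpace.isTopologicalBasis_of_isOpen_of_nhds (fun _ h => h.1) ?_⟩
  intro x W hxW hW
  obtain ⟨e, hx, rfl⟩ := hf x
  have ho : IsOpen (e '' (e.source ∩ W)) :=
    e.isOpen_image_of_subset_source (e.open_source.inter hW) Set.inter_subset_left
  obtain ⟨A, hAc, hAo, hxA, hA⟩ := exists_isCompact_isOpen
    (ho.mem_nhds (Set.mem_image_of_mem e ⟨hx, hxW⟩))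
  have hAt : A ⊆ e.target := hA.trans (Set.image_subset_iff.2 fun y hy => e.map_source hy.1)
  refine ⟨e.symm '' A, ⟨e.symm.isOpen_image_of_subset_source hAo hAt,
    hAc.image_of_continuousOn (e.continuousOn_symm.mono hAt)⟩, ?_, ?_⟩
  · exact ⟨e x, hxA, e.left_inv hx⟩
  · rintro _ ⟨y, hy, rfl⟩
    obtain ⟨z, hz, rfl⟩ := hA hy
    rw [e.left_inv hz.1]
    exact hz.2

variable [T2Space X] [T2Space Y]

theorem pushforward_apply_of_injective {f : X → Y} (hf : IsLocalHomeomorph f)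
    (hi : Function.Injective f) (a : C_c(X, ℤ)) (x : X) : pushforward f hf a (f x) = a x := by
  rw [pushforward_apply, show f ⁻¹' {f x} = {x} from by ext y; simp [hi.eq_iff]]
  exact finsum_mem_singleton

theorem pushforward_injective {f : X → Y} (hf : IsLocalHomeomorph f)
    (hi : Function.Injective f) : Function.Injective (pushforward f hf) := by
  intro a b h
  ext x
  rw [← pushforward_apply_of_injective hf hi a, h, pushforward_apply_of_injective hf hi]

theorem pushforward_id {f : X → X} (hf : IsLocalHomeomorph f) (h : ∀ x, f x = x)
    (a : C_c(X, ℤ)) : pushforward f hf a = a := by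
  ext x
  have := pushforward_apply_of_injective hf (fun x y hxy => by rwa [h, h] at hxy) a x
  rwa [h] at this

/-- Functions supported in the range of an injective étale map are extensions by zero. -/
theorem exists_pushforward_eq {f : X → Y} (hf : IsLocalHomeomorph f)
    (hi : Function.Injective f) (a : C_c(Y, ℤ)) (ha : tsupport a ⊆ Set.range f) :
    ∃ a', pushforward f hf a' = a := by
  have he : IsOpenEmbedding f := .of_continuous_injective_isOpenMap hf.continuous hi hf.isOpenMap
  let a' : C_c(X, ℤ) :=
    { toFun := fun x => a (f x)
      continuous_toFun := a.continuous.comp hf.continuous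
      hasCompactSupport' := by
        have hK : IsCompact (f ⁻¹' tsupport a) :=
          he.isInducing.isCompact_preimage_iff ha |>.2 a.hasCompactSupport
        exact HasCompactSupport.intro hK fun x hx => image_eq_zero_of_notMem_tsupport hx }
  refine ⟨a', ?_⟩
  ext y
  by_cases hy : y ∈ Set.range f
  · obtain ⟨x, rfl⟩ := hy
    exact pushforward_apply_of_injective hf hi a' x
  · rw [pushforward_apply, image_eq_zero_of_notMem_tsupport fun h => hy (ha h)]
    exact finsum_mem_eq_zero_of_forall_eq_zero fun x hx => (hy ⟨x, hx⟩).elim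

end Functions

instance AmpleGroupoid.prespectralSpace_arr (G : AmpleGroupoid.{u}) : PrespectralSpace G.Arr := by
  refine ⟨TopologicalSpace.isTopologicalBasis_of_isOpen_of_nhds (fun _ h => h.1) ?_⟩
  intro g W hg hW
  obtain ⟨A, ⟨h1, h2, -⟩, h3, h4⟩ := G.ample.basis.exists_subset_of_mem_open hg hW
  exact ⟨A, ⟨h2, h1⟩, h3, h4⟩

instance AmpleGroupoid.prespectralSpace_obj (G : AmpleGroupoid.{u}) : PrespectralSpace G.Obj :=
  prespectralSpace_of_isLocalHomeomorph G.etale_unit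

/-! ### Coinvariants -/

theorem AmpleGroupoid.inv_unit {G : AmpleGroupoid.{u}} (x : G.Obj) :
    G.inv (G.unit x) = G.unit x := by
  have := G.mul_unit (G.inv (G.unit x))
  rwa [G.s_inv, G.r_unit, G.inv_mul, G.s_unit, eq_comm] at this

namespace GSpace

variable {G : AmpleGroupoid.{u}} (X : GSpace G)

instance : PrespectralSpace X.carrier := prespectralSpace_of_isLocalHomeomorph X.etale_anchor

/-- The projection `G ×_{s,p} X → X`. -/
def proj (q : X.Pairs) : X.carrier := q.1.2

theorem etale_proj : IsLocalHomeomorph X.proj :=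
  isLocalHomeomorph_pullback_snd G.etale_s X.etale_anchor.continuous

/-- The functions `f ⊗ a` span `ℤ[G ×_{s,p} X]`. -/
theorem closure_tensor_eq_top :
    AddSubgroup.closure {c | ∃ f a, c = X.tensor f a} = ⊤ := by
  refine addSubgroup_eq_top_of_bump _ (fun a ha b hb => ?_) fun q W hW => ?_
  · induction ha, hb using AddSubgroup.closure_induction₂ with
    | mem x y hx hy =>
      obtain ⟨f, a, rfl⟩ := hx
      obtain ⟨f', a', rfl⟩ := hy
      refine AddSubgroup.subset_closure ⟨f * f', a * a', ?_⟩
      ext q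
      exact mul_mul_mul_comm _ _ _ _
    | zero_left x _ => rw [zero_mul]; exact AddSubgroup.zero_mem _
    | zero_right x _ => rw [mul_zero]; exact AddSubgroup.zero_mem _
    | add_left x y z _ _ _ h1 h2 => rw [add_mul]; exact AddSubgroup.add_mem _ h1 h2
    | add_right x y z _ _ _ h1 h2 => rw [mul_add]; exact AddSubgroup.add_mem _ h1 h2
    | neg_left x y _ _ h =>
      have : -x * y = -(x * y) := by ext q; exact neg_mul _ _
      rw [this]
      exact AddSubgroup.neg_mem _ h
    | neg_right x y _ _ h =>
      have : x * -y = -(x * y) := by ext q; exact mul_neg _ _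
      rw [this]
      exact AddSubgroup.neg_mem _ h
  · rw [nhds_subtype_eq_comap, Filter.mem_comap] at hW
    obtain ⟨V, hV, hVW⟩ := hW
    obtain ⟨S, hS, T, hT, hST⟩ := mem_nhds_prod_iff.1 hV
    obtain ⟨A, hAc, hAo, hqA, hAS⟩ := exists_isCompact_isOpen hS
    obtain ⟨B, hBc, hBo, hqB, hBT⟩ := exists_isCompact_isOpen hT
    refine ⟨_, AddSubgroup.subset_closure ⟨compactOpenIndicator A hAc hAo,
      compactOpenIndicator B hBc hBo, rfl⟩, ?_, ?_⟩
    · change A.indicator (1 : G.Arr → ℤ) q.1.1 * B.indicator (1 : X.carrier → ℤ) q.1.2 = 1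
      simp [hqA, hqB]
    · intro q' hq'
      change A.indicator (1 : G.Arr → ℤ) q'.1.1 * B.indicator (1 : X.carrier → ℤ) q'.1.2 ≠ 0 at hq'
      refine hVW (hST ⟨hAS ?_, hBT ?_⟩)
      · exact Set.mem_of_indicator_ne_zero (left_ne_zero_of_mul hq')
      · exact Set.mem_of_indicator_ne_zero (right_ne_zero_of_mul hq')

/-- The action of `ℤ[G⁰] ⊆ ℤ[G]` on `ℤ[X]` is pointwise multiplication. -/
theorem convolve_pushforward_unit (b : C_c(G.Obj, ℤ)) (a : C_c(X.carrier, ℤ)) (x : X.carrier) :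
    X.convolve (pushforward G.unit G.etale_unit b) a x = b (X.anchor x) * a x := by
  have hinj : Function.Injective G.unit := fun x y h => by rw [← G.r_unit x, h, G.r_unit]
  change ∑ᶠ g : {g : G.Arr // G.r g = X.anchor x}, pushforward G.unit G.etale_unit b g.1 *
    a (X.smul (G.inv g.1) x ((G.s_inv g.1).trans g.2)) = _
  rw [finsum_eq_single _ ⟨G.unit (X.anchor x), G.r_unit _⟩]
  · rw [pushforward_apply_of_injective _ hinj]
    congr 2
    exact (smul_congr (AmpleGroupoid.inv_unit _) rfl _).trans (X.unit_smul x)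
  · intro g hg
    refine mul_eq_zero_of_left ?_ _
    rw [pushforward_apply]
    refine finsum_mem_eq_zero_of_forall_eq_zero fun y hy => (hg (Subtype.ext ?_)).elim
    have hy' : G.unit y = g.1 := hy
    have hyx : y = X.anchor x := by rw [← g.2, ← hy', G.r_unit]
    exact hy'.symm.trans (congrArg G.unit hyx)

theorem pushforward_proj_tensor (f : C_c(G.Arr, ℤ)) (a : C_c(X.carrier, ℤ)) :
    pushforward X.proj X.etale_proj (X.tensor f a) = X.convolve (augmentation G f) a := by
  ext x
  refine Eq.trans ?_ (X.convolve_pushforward_unit (pushforward G.s G.etale_s f) a x).symm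
  rw [pushforward_apply, pushforward_apply, finsum_mem_mul]
  · refine finsum_mem_eq_of_bijOn (fun q : X.Pairs => q.1.1) ⟨?_, ?_, ?_⟩ ?_
    · rintro q rfl
      exact q.2
    · rintro q hq q' hq' h
      exact Subtype.ext (Prod.ext h (Eq.trans hq (Eq.symm hq')))
    · intro g hg
      exact ⟨⟨(g, x), hg⟩, rfl, rfl⟩
    · rintro q rfl
      rfl

/-- The difference of the pushforwards along the action and the projection
`G ×_{s,p} X ⇉ X`. -/
noncomputable def actSubProj : C_c(X.Pairs, ℤ) →+ C_c(X.carrier, ℤ) :=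
  pushforward X.act X.etale_act - pushforward X.proj X.etale_proj

/-- The coinvariants are the coequaliser of the action and the projection. -/
theorem coinvKer_eq_range : X.coinvKer = X.actSubProj.range := by
  rw [AddMonoidHom.range_eq_map, ← X.closure_tensor_eq_top, AddMonoidHom.map_closure]
  unfold coinvKer
  congr 1
  have h : ∀ f a, X.actSubProj (X.tensor f a) =
      X.convolve f a - X.convolve (augmentation G f) a := fun f a => by
    rw [← pushforward_proj_tensor]
    have hf : X.convolve f a = pushforward X.act X.etale_act (X.tensor f a) :=
      CompactlySupportedContinuousMap.copy_eq _ _ _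
    rw [hf]
    rfl
  ext b
  constructor
  · rintro ⟨f, a, rfl⟩
    exact ⟨_, ⟨f, a, rfl⟩, h f a⟩
  · rintro ⟨_, ⟨f, a, rfl⟩, rfl⟩
    exact ⟨f, a, h f a⟩

variable {X}

/-- If `π : X → B` is an invariant étale map with a continuous section `σ`, and `x` is obtained
from `σ (π x)` by the action of an arrow that depends continuously on `x`, then `π` identifies
`ℤ[X]_G` with `ℤ[B]`. -/
theorem exists_coinvEquiv {B : Type u} [TopologicalSpace B] [T2Space B] {π : X.carrier → B}
    (hπ : IsLocalHomeomorph π) (hinv : ∀ q, π (X.act q) = π (X.proj q)) {σ : B → X.carrier}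
    (hσ : Continuous σ) (hπσ : ∀ b, π (σ b) = b) {β : X.carrier → X.Pairs} (hβ : Continuous β)
    (hact : ∀ x, X.act (β x) = x) (hproj : ∀ x, X.proj (β x) = σ (π x)) :
    ∃ e : X.Coinv ≃+ C_c(B, ℤ), ∀ a : C_c(X.carrier, ℤ), e (a : X.Coinv) = pushforward π hπ a := by
  have hσ' : IsLocalHomeomorph σ := by
    refine IsLocalHomeomorph.of_comp (g := π) ?_ hπ hσ
    rw [show π ∘ σ = id from funext hπσ]
    exact (Homeomorph.refl B).isLocalHomeomorph
  have hβ' : IsLocalHomeomorph β := by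
    refine IsLocalHomeomorph.of_comp (g := X.act) ?_ X.etale_act hβ
    rw [show X.act ∘ β = id from funext hact]
    exact (Homeomorph.refl X.carrier).isLocalHomeomorph
  have hker : X.coinvKer = (pushforward π hπ).ker := by
    refine le_antisymm ?_ fun a ha => ?_
    · rw [coinvKer_eq_range]
      rintro _ ⟨c, rfl⟩
      rw [AddMonoidHom.mem_ker, actSubProj, AddMonoidHom.sub_apply, map_sub, pushforward_comp,
        pushforward_comp, sub_eq_zero]
      exact DFunLike.congr_fun (pushforward_congr _ _ (funext hinv)) c
    · rw [coinvKer_eq_range]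
      refine ⟨pushforward β hβ' a, ?_⟩
      have h1 : pushforward (X.act ∘ β) (X.etale_act.comp hβ') a = a := pushforward_id _ hact a
      rw [actSubProj, AddMonoidHom.sub_apply, pushforward_comp, pushforward_comp, h1,
        pushforward_congr (X.etale_proj.comp hβ') (hσ'.comp hπ) (funext hproj),
        ← pushforward_comp hπ hσ', AddMonoidHom.mem_ker.1 ha, map_zero, sub_zero]
  have hsurj : Function.Surjective (pushforward π hπ) := fun b =>
    ⟨pushforward σ hσ' b, by rw [pushforward_comp]; exact pushforward_id _ hπσ b⟩
  exact ⟨(QuotientAddGroup.quotientAddEquivOfEq hker).trans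
    (QuotientAddGroup.quotientKerEquivOfSurjective _ hsurj), fun a => rfl⟩

end GSpace

/-! ### Groupoid homology is the homology of the coinvariants of `EG` -/

namespace AmpleGroupoid

variable {G : AmpleGroupoid.{u}}

theorem egToBG_smul {n : ℕ} (g : G.Arr) (γ : G.EGSpace n) (h : G.s g = G.r (γ.1 0)) :
    egToBG n ((G.EGObj n).smul g γ h) = egToBG n γ := by
  have hk : ∀ k, G.s g = G.r (γ.1 k) := fun k => h.trans (γ.2 k).symm
  refine Subtype.ext (Prod.ext (G.s_mul _ _ (hk 0)) (funext fun k => ?_))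
  change G.mul (G.inv (G.mul g (γ.1 k.castSucc))) (G.mul g (γ.1 k.succ)) = _
  rw [inv_mul_eq (hk _) (G.r_mul _ _ (hk _)).symm, mul_inv_cancel (hk _)]
  rfl

/-- The section of `EG_n → BG_n` whose values start with a unit. -/
def bgToEG (n : ℕ) (b : G.BGSpace n) : G.EGSpace n :=
  (egHomeomorph n).symm ⟨(G.unit b.1.1, b), G.s_unit _⟩

theorem continuous_bgToEG (n : ℕ) : Continuous (bgToEG (G := G) n) :=
  (egHomeomorph n).symm.continuous.comp (Continuous.subtype_mk
    ((G.continuous_unit.comp (continuous_fst.comp continuous_subtype_val)).prodMk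
      continuous_id) _)

theorem egToBG_bgToEG (n : ℕ) (b : G.BGSpace n) : egToBG n (bgToEG n b) = b :=
  congrArg (fun q => q.1.2) ((egHomeomorph n).apply_symm_apply ⟨(G.unit b.1.1, b), G.s_unit _⟩)

theorem bgToEG_egToBG {n : ℕ} (γ : G.EGSpace n) :
    bgToEG n (egToBG n γ) = (G.EGObj n).smul (G.inv (γ.1 0)) γ (G.s_inv _) := by
  refine (egHomeomorph n).injective ?_
  rw [bgToEG, Homeomorph.apply_symm_apply]
  refine Subtype.ext (Prod.ext ?_ ?_)
  · exact (G.inv_mul _).symm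
  · exact (egToBG_smul _ γ (G.s_inv _)).symm

theorem exists_coinvEquiv_eg (n : ℕ) :
    ∃ e : (G.EGObj n).Coinv ≃+ C_c(G.BGSpace n, ℤ), ∀ a : C_c((G.EGObj n).carrier, ℤ),
      e (a : (G.EGObj n).Coinv) = pushforward (egToBG n) (etale_egToBG n) a := by
  have hs : ∀ γ : G.EGSpace n, G.s (γ.1 0) = (G.EGObj n).anchor (bgToEG n (egToBG n γ)) :=
    fun γ => (G.r_inv _).symm.trans (((G.EGObj n).anchor_smul _ γ (G.s_inv _)).symm.trans
      (congrArg (G.EGObj n).anchor (bgToEG_egToBG γ).symm))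
  refine GSpace.exists_coinvEquiv (X := G.EGObj n) (σ := bgToEG n)
    (β := fun γ => ⟨(γ.1 0, bgToEG n (egToBG n γ)), hs γ⟩) (etale_egToBG n) ?_
    (continuous_bgToEG n) (egToBG_bgToEG n) ?_ ?_ fun _ => rfl
  · exact fun q => egToBG_smul _ _ q.2
  · exact Continuous.subtype_mk ((continuous_coord 0).prodMk
      ((continuous_bgToEG n).comp (etale_egToBG n).continuous)) _
  · intro γ
    refine (GSpace.smul_congr rfl (bgToEG_egToBG γ) _).trans ?_
    exact GSpace.smul_inv_smul (X := G.EGObj n) (γ.1 0) γ rfl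

/-- The coinvariants of `ℤ[EG_n]` are `ℤ[BG_n]`. -/
noncomputable def coinvEquiv (n : ℕ) : (G.EGObj n).Coinv ≃+ C_c(G.BGSpace n, ℤ) :=
  (exists_coinvEquiv_eg n).choose

theorem coinvEquiv_mk (n : ℕ) (a : C_c((G.EGObj n).carrier, ℤ)) :
    coinvEquiv n (a : (G.EGObj n).Coinv) = pushforward (egToBG n) (etale_egToBG n) a :=
  (exists_coinvEquiv_eg n).choose_spec a

variable (G) in
/-- The complex of coinvariants of `EG_*` is the complex `ℤ[BG_*]`. -/
noncomputable def complexIso : G.EG.complex ≅ G.BG.complex := by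
  refine HomologicalComplex.Hom.isoOfComponents
    (fun n => (coinvEquiv (G := G) n).toAddCommGrpIso) ?_
  rintro _ n rfl
  simp only [SemisimplicialGSpace.complex, SemisimplicialSpace.complex, altComplex_d]
  refine AddCommGrpCat.hom_ext (AddMonoidHom.ext fun (x : (G.EGObj (n + 1)).Coinv) => ?_)
  obtain ⟨a, rfl⟩ := QuotientAddGroup.mk_surjective x
  change (altSum (C := fun n => C_c(G.BGSpace n, ℤ))
      (fun n i => pushforward (G.BG.face n i) (G.BG.etale_face n i)) n).hom
        (coinvEquiv (n + 1) (a : (G.EGObj (n + 1)).Coinv)) =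
    coinvEquiv n ((altSum (C := fun n => (G.EGObj n).Coinv)
      (fun n i => (G.EG.face n i).coinvMap) n).hom (a : (G.EGObj (n + 1)).Coinv))
  refine (altSum_apply (C := fun n => C_c(G.BGSpace n, ℤ)) _ _ _).trans (Eq.trans ?_
    (congrArg (coinvEquiv n) (altSum_apply (C := fun n => (G.EGObj n).Coinv) _ _ _).symm))
  rw [map_sum]
  refine Finset.sum_congr rfl fun i _ => ?_
  rw [map_zsmul, coinvEquiv_mk]
  congr 1
  refine Eq.trans ?_ (coinvEquiv_mk n (pushforward (G.EG.face n i).toFun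
    (G.EG.face n i).etale a)).symm
  refine (pushforward_comp _ _ _).trans (Eq.trans ?_ (pushforward_comp _ _ _).symm)
  exact DFunLike.congr_fun (pushforward_congr _ _ (funext (bgFace_egToBG n i))) a

end AmpleGroupoid

/-! ### Homology classes and cycles -/

section Cycles

variable {C D : ChainComplex AddCommGrpCat.{u} ℕ}

theorem exists_homologyπ_eq (n : ℕ) (c : C.homology n) : ∃ z : C.cycles n, C.homologyπ n z = c :=
  (AddCommGrpCat.epi_iff_surjective _).1 inferInstance c

theorem iCycles_injective (C : ChainComplex AddCommGrpCat.{u} ℕ) (n : ℕ) :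
    Function.Injective (C.iCycles n) :=
  (AddCommGrpCat.mono_iff_injective _).1 inferInstance

theorem d_iCycles (n j : ℕ) (z : C.cycles n) : C.d n j (C.iCycles n z) = 0 := by
  rw [← ConcreteCategory.comp_apply, C.iCycles_d]
  rfl

theorem exists_iCycles_eq {n : ℕ} (z : C.X n) (hz : ∀ j, C.d n j z = 0) :
    ∃ z', C.iCycles n z' = z :=
  (ShortComplex.ab_exact_iff _).1 (ShortComplex.exact_of_f_is_kernel
    (ShortComplex.mk (C.iCycles n) (C.d n _) (C.iCycles_d n _)) (C.cyclesIsKernel n _ rfl))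
    z (hz _)

theorem homologyπ_eq_zero_iff {n : ℕ} (z : C.cycles n) :
    C.homologyπ n z = 0 ↔ ∃ w, C.d (n + 1) n w = C.iCycles n z := by
  have hex := (ShortComplex.ab_exact_iff _).1 (ShortComplex.exact_of_g_is_cokernel
    (ShortComplex.mk (C.toCycles (n + 1) n) (C.homologyπ n) (C.toCycles_comp_homologyπ _ _))
    (C.homologyIsCokernel (n + 1) n (by simp)))
  constructor
  · intro h
    obtain ⟨w, hw⟩ := hex z h
    refine ⟨w, ?_⟩
    rw [← C.toCycles_i (n + 1) n, ConcreteCategory.comp_apply]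
    exact congrArg _ hw
  · rintro ⟨w, hw⟩
    have : C.toCycles (n + 1) n w = z := by
      refine iCycles_injective C n ?_
      rw [← hw, ← ConcreteCategory.comp_apply, C.toCycles_i]
    rw [← this, ← ConcreteCategory.comp_apply, C.toCycles_comp_homologyπ]
    rfl

theorem homologyMap_homologyπ (φ : C ⟶ D) (n : ℕ) (z : C.cycles n) :
    HomologicalComplex.homologyMap φ n (C.homologyπ n z) =
      D.homologyπ n (HomologicalComplex.cyclesMap φ n z) := by
  rw [← ConcreteCategory.comp_apply, HomologicalComplex.homologyπ_naturality,
    ConcreteCategory.comp_apply]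

theorem iCycles_cyclesMap (φ : C ⟶ D) (n : ℕ) (z : C.cycles n) :
    D.iCycles n (HomologicalComplex.cyclesMap φ n z) = φ.f n (C.iCycles n z) := by
  rw [← ConcreteCategory.comp_apply, HomologicalComplex.cyclesMap_i,
    ConcreteCategory.comp_apply]

theorem homologyMap_eq_of_forall_cycle (φ ψ : C ⟶ D) (n : ℕ)
    (h : ∀ z : C.X n, (∀ j, C.d n j z = 0) → ∃ w, D.d (n + 1) n w = φ.f n z - ψ.f n z) :
    HomologicalComplex.homologyMap φ n = HomologicalComplex.homologyMap ψ n := by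
  refine AddCommGrpCat.hom_ext (AddMonoidHom.ext fun c => ?_)
  obtain ⟨z, rfl⟩ := exists_homologyπ_eq n c
  change HomologicalComplex.homologyMap φ n (C.homologyπ n z) =
    HomologicalComplex.homologyMap ψ n (C.homologyπ n z)
  rw [homologyMap_homologyπ, homologyMap_homologyπ, ← sub_eq_zero, ← map_sub,
    homologyπ_eq_zero_iff]
  obtain ⟨w, hw⟩ := h (C.iCycles n z) fun j => d_iCycles n j z
  exact ⟨w, by rw [hw, map_sub, iCycles_cyclesMap, iCycles_cyclesMap]⟩

end Cycles

/-! ### Prism homotopies -/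

/-- The cancellation behind the prism operator. The terms `β k j` with `j = k` or `j = k - 1`
telescope; the other ones cancel against the terms `α k i`. -/
theorem sum_prism {A : Type u} [AddCommGroup A] (n : ℕ) (β : Fin (n + 3) → Fin (n + 2) → A)
    (α : Fin (n + 2) → Fin (n + 1) → A)
    (hle : ∀ (k : Fin (n + 2)) (i : Fin (n + 1)), k ≤ i.castSucc → β k.castSucc i.succ = α k i)
    (hlt : ∀ (k : Fin (n + 2)) (i : Fin (n + 1)), i.castSucc < k → β k.succ i.castSucc = α k i)
    (hdiag : ∀ i : Fin (n + 1), β i.succ.castSucc i.succ = β i.castSucc.succ i.castSucc) :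
    ∑ j : Fin (n + 2), ∑ k : Fin (n + 3), (-1 : ℤ) ^ ((k : ℕ) + j) • β k j =
      β 0 0 - β (Fin.last _) (Fin.last _) -
        ∑ k : Fin (n + 2), ∑ i : Fin (n + 1), (-1 : ℤ) ^ ((k : ℕ) + i) • α k i := by
  have h1 : ∀ j : Fin (n + 2), ∑ k : Fin (n + 3), (-1 : ℤ) ^ ((k : ℕ) + j) • β k j =
      β j.castSucc j + ∑ k : Fin (n + 2), (-1 : ℤ) ^ ((j.castSucc.succAbove k : ℕ) + j) •
        β (j.castSucc.succAbove k) j := by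
    intro j
    rw [Fin.sum_univ_succAbove _ j.castSucc]
    simp [← two_mul]
  have h2 : ∀ k : Fin (n + 2), ∑ j : Fin (n + 2), (-1 : ℤ) ^ ((j.castSucc.succAbove k : ℕ) + j) •
      β (j.castSucc.succAbove k) j =
        -β k.succ k - ∑ i : Fin (n + 1), (-1 : ℤ) ^ ((k : ℕ) + i) • α k i := by
    intro k
    rw [Fin.sum_univ_succAbove _ k, sub_eq_add_neg, ← Finset.sum_neg_distrib]
    congr 1
    · rw [Fin.succAbove_castSucc_self, Fin.val_succ, add_right_comm, ← two_mul, pow_succ, pow_mul]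
      simp
    · refine Finset.sum_congr rfl fun i _ => ?_
      rcases lt_or_ge i.castSucc k with h | h
      · rw [Fin.succAbove_of_castSucc_lt _ _ h,
          Fin.succAbove_of_le_castSucc _ k (by simpa using h.le), hlt k i h, Fin.val_succ,
          Fin.val_castSucc, add_right_comm, pow_succ, mul_neg_one, neg_smul]
      · rw [Fin.succAbove_of_le_castSucc _ _ h, Fin.succAbove_of_castSucc_lt _ k (by
            rw [Fin.lt_def]; rw [Fin.le_def] at h; simp at h ⊢; omega),
          hle k i h, Fin.val_succ, Fin.val_castSucc, ← add_assoc, pow_succ, mul_neg_one, neg_smul]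
  have h3 : ∑ j : Fin (n + 2), β j.castSucc j - ∑ k : Fin (n + 2), β k.succ k =
      β 0 0 - β (Fin.last _) (Fin.last _) := by
    rw [Fin.sum_univ_succ, Fin.sum_univ_castSucc (fun k : Fin (n + 2) => β k.succ k),
      Finset.sum_congr rfl fun i _ => hdiag i]
    simp only [Fin.castSucc_zero, Fin.succ_last]
    abel
  rw [Finset.sum_congr rfl fun j _ => h1 j, Finset.sum_add_distrib, Finset.sum_comm,
    Finset.sum_congr rfl fun k _ => h2 k, Finset.sum_sub_distrib, Finset.sum_neg_distrib, ← h3]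
  abel

namespace GSpace

variable {G : AmpleGroupoid.{u}}

/-- The composition of equivariant étale maps. -/
def Hom.comp {X Y Z : GSpace G} (ψ : Hom Y Z) (φ : Hom X Y) : Hom X Z where
  toFun := ψ.toFun ∘ φ.toFun
  etale := ψ.etale.comp φ.etale
  anchor_map x := (ψ.anchor_map _).trans (φ.anchor_map x)
  map_smul g x h := (congrArg ψ.toFun (φ.map_smul g x h)).trans (ψ.map_smul _ _ _)

/-- The identity map of a `G`-space. -/
def Hom.id (X : GSpace G) : Hom X X :=
  Hom.ofContinuous (fun x => x) continuous_id (fun _ => rfl) fun _ _ _ => rfl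

theorem coinvMap_id_apply (X : GSpace G) (x : X.Coinv) : (Hom.id X).coinvMap x = x := by
  obtain ⟨a, rfl⟩ := QuotientAddGroup.mk_surjective x
  exact congrArg _ (pushforward_id _ (fun _ => rfl) a)

theorem coinvMap_eq_comp {X Y Z : GSpace G} (ψ : Hom Y Z) (φ : Hom X Y) (χ : Hom X Z)
    (h : ∀ x, χ.toFun x = ψ.toFun (φ.toFun x)) (x : X.Coinv) :
    χ.coinvMap x = ψ.coinvMap (φ.coinvMap x) := by
  rw [← coinvMap_id_apply X x]
  exact (DFunLike.congr_fun (coinvMap_comp_eq (φ := Hom.id X) (ψ := χ) (φ' := φ) (ψ' := ψ) h)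
    x).trans (by rw [coinvMap_id_apply]; rfl)

end GSpace

namespace SemisimplicialGSpace

variable {G : AmpleGroupoid.{u}} {X Y Z : SemisimplicialGSpace G}

theorem complex_d_apply (X : SemisimplicialGSpace G) (n : ℕ) (x : (X.obj (n + 1)).Coinv) :
    X.complex.d (n + 1) n x =
      (∑ i : Fin (n + 2), (-1 : ℤ) ^ (i : ℕ) • (X.face n i).coinvMap x : (X.obj n).Coinv) := by
  have h : X.complex.d (n + 1) n = altSum (C := fun n => (X.obj n).Coinv)
    (fun n i => (X.face n i).coinvMap) n := altComplex_d _ _ n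
  rw [h]
  exact altSum_apply (C := fun n => (X.obj n).Coinv) _ _ _

theorem chainMap_f_apply (φ : Hom X Y) (n : ℕ) (x : (X.obj n).Coinv) :
    φ.chainMap.f n x = (φ.app n).coinvMap x := by
  rfl

/-- The composition of morphisms of semi-simplicial `G`-spaces. -/
def Hom.comp (ψ : Hom Y Z) (φ : Hom X Y) : Hom X Z where
  app n := (ψ.app n).comp (φ.app n)
  face_app n i x := (ψ.face_app n i _).trans (congrArg _ (φ.face_app n i x))

theorem homologyMap_comp (ψ : Hom Y Z) (φ : Hom X Y) (n : ℕ) :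
    (ψ.comp φ).homologyMap n = φ.homologyMap n ≫ ψ.homologyMap n := by
  refine Eq.trans (congrArg (HomologicalComplex.homologyMap · n) ?_)
    (HomologicalComplex.homologyMap_comp φ.chainMap ψ.chainMap n)
  refine HomologicalComplex.hom_ext _ _ fun k => AddCommGrpCat.hom_ext (AddMonoidHom.ext
    fun (x : (X.obj k).Coinv) => ?_)
  change (ψ.comp φ).chainMap.f k x = ψ.chainMap.f k (φ.chainMap.f k x)
  rw [chainMap_f_apply, chainMap_f_apply, chainMap_f_apply]
  exact GSpace.coinvMap_eq_comp _ _ _ (fun _ => rfl) x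

theorem homologyMap_comp_apply (ψ : Hom Y Z) (φ : Hom X Y) (n : ℕ) (c : X.homology n) :
    (ψ.comp φ).homologyMap n c = ψ.homologyMap n (φ.homologyMap n c) := by
  rw [homologyMap_comp, ConcreteCategory.comp_apply]

/-- A prism homotopy between morphisms of semi-simplicial `G`-spaces: maps `h_i : X_n → Y_{n+1}`
with the face relations of a simplicial homotopy. No degeneracies are needed. -/
structure PrismHomotopy (φ ψ : Hom X Y) where
  /-- The maps `h_i`. -/
  h : ∀ n, Fin (n + 1) → GSpace.Hom (X.obj n) (Y.obj (n + 1))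
  face_zero : ∀ n x, (Y.face n 0).toFun ((h n 0).toFun x) = (ψ.app n).toFun x
  face_last : ∀ n x, (Y.face n (Fin.last _)).toFun ((h n (Fin.last _)).toFun x) =
    (φ.app n).toFun x
  face_diag : ∀ n (i : Fin (n + 1)) x,
    (Y.face (n + 1) i.succ.castSucc).toFun ((h (n + 1) i.succ).toFun x) =
      (Y.face (n + 1) i.castSucc.succ).toFun ((h (n + 1) i.castSucc).toFun x)
  face_le : ∀ n (k : Fin (n + 2)) (i : Fin (n + 1)), k ≤ i.castSucc → ∀ x,
    (Y.face (n + 1) k.castSucc).toFun ((h (n + 1) i.succ).toFun x) =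
      (h n i).toFun ((X.face n k).toFun x)
  face_lt : ∀ n (k : Fin (n + 2)) (i : Fin (n + 1)), i.castSucc < k → ∀ x,
    (Y.face (n + 1) k.succ).toFun ((h (n + 1) i.castSucc).toFun x) =
      (h n i).toFun ((X.face n k).toFun x)

theorem PrismHomotopy.homologyMap_eq {φ ψ : Hom X Y} (H : PrismHomotopy φ ψ) (n : ℕ) :
    φ.homologyMap n = ψ.homologyMap n := by
  symm
  refine homologyMap_eq_of_forall_cycle _ _ n fun (z : (X.obj n).Coinv) hz => ?_
  let w : (Y.obj (n + 1)).Coinv := ∑ i : Fin (n + 1), (-1 : ℤ) ^ (i : ℕ) • (H.h n i).coinvMap z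
  refine ⟨w, ?_⟩
  have hw : (∑ k : Fin (n + 2), (-1 : ℤ) ^ (k : ℕ) • (Y.face n k).coinvMap w : (Y.obj n).Coinv) =
      ∑ j : Fin (n + 1), ∑ k : Fin (n + 2), (-1 : ℤ) ^ ((k : ℕ) + j) •
        (Y.face n k).coinvMap ((H.h n j).coinvMap z) := by
    simp only [w, map_sum, map_zsmul, Finset.smul_sum, smul_smul, ← pow_add]
    exact Finset.sum_comm
  have h0 : (Y.face n 0).coinvMap ((H.h n 0).coinvMap z) = (ψ.app n).coinvMap z :=
    (GSpace.coinvMap_eq_comp _ _ _ (fun x => (H.face_zero n x).symm) z).symm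
  have h1 : (Y.face n (Fin.last _)).coinvMap ((H.h n (Fin.last _)).coinvMap z) =
      (φ.app n).coinvMap z :=
    (GSpace.coinvMap_eq_comp _ _ _ (fun x => (H.face_last n x).symm) z).symm
  rw [chainMap_f_apply, chainMap_f_apply, complex_d_apply]
  refine hw.trans ?_
  cases n with
  | zero =>
    rw [← h0, ← h1]
    simp only [Fin.sum_univ_succ, Fin.sum_univ_zero]
    simp
    exact (sub_eq_add_neg _ _).symm
  | succ n =>
    rw [sum_prism n (fun k j => (Y.face (n + 1) k).coinvMap ((H.h (n + 1) j).coinvMap z))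
      (fun k i => (H.h n i).coinvMap ((X.face n k).coinvMap z))
      (fun k i hki => DFunLike.congr_fun (GSpace.coinvMap_comp_eq (H.face_le n k i hki)) z)
      (fun k i hki => DFunLike.congr_fun (GSpace.coinvMap_comp_eq (H.face_lt n k i hki)) z)
      (fun i => DFunLike.congr_fun (GSpace.coinvMap_comp_eq (H.face_diag n i)) z)]
    have hz' : (∑ k : Fin (n + 2), (-1 : ℤ) ^ (k : ℕ) • (X.face n k).coinvMap z :
        (X.obj n).Coinv) = 0 := (complex_d_apply X n z).symm.trans (hz n)
    have : ∑ k : Fin (n + 2), ∑ i : Fin (n + 1), (-1 : ℤ) ^ ((k : ℕ) + i) •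
        (H.h n i).coinvMap ((X.face n k).coinvMap z) = 0 := by
      rw [Finset.sum_comm]
      refine Finset.sum_eq_zero fun i _ => ?_
      have := congrArg (fun y => (-1 : ℤ) ^ (i : ℕ) • (H.h n i).coinvMap y) hz'
      simp only [map_sum, map_zsmul, Finset.smul_sum, smul_smul, ← pow_add, map_zero,
        smul_zero] at this
      simpa only [add_comm] using this
    rw [this, sub_zero, h0, h1]
    rfl

end SemisimplicialGSpace

/-! ### Open subspaces of semi-simplicial `G`-spaces -/

namespace SemisimplicialGSpace

variable {G : AmpleGroupoid.{u}}

theorem complex_d_coinvMap {X Y : SemisimplicialGSpace G} (φ : Hom X Y) (n : ℕ)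
    (x : (X.obj (n + 1)).Coinv) : Y.complex.d (n + 1) n ((φ.app (n + 1)).coinvMap x) =
      (φ.app n).coinvMap (X.complex.d (n + 1) n x) :=
  (ConcreteCategory.comp_apply _ _ _).symm.trans (congrArg (fun f => f x)
    (congrArg ConcreteCategory.hom (φ.chainMap.comm (n + 1) n)))

/-- An open `G`-invariant semi-simplicial subspace. -/
structure OpenSub (X : SemisimplicialGSpace G) where
  /-- The set of `n`-simplices. -/
  carrier : ∀ n, Set (X.obj n).carrier
  isOpen : ∀ n, IsOpen (carrier n)
  smul_mem : ∀ n (g : G.Arr) (x : (X.obj n).carrier) (h : G.s g = (X.obj n).anchor x),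
    x ∈ carrier n → (X.obj n).smul g x h ∈ carrier n
  face_mem : ∀ n (i : Fin (n + 2)) (x : (X.obj (n + 1)).carrier), x ∈ carrier (n + 1) →
    (X.face n i).toFun x ∈ carrier n

namespace OpenSub

variable {X : SemisimplicialGSpace G}

/-- The `G`-space of `n`-simplices of an open subspace. -/
def obj (S : OpenSub X) (n : ℕ) : GSpace G where
  carrier := {x // x ∈ S.carrier n}
  lc := (S.isOpen n).locallyCompactSpace
  anchor x := (X.obj n).anchor x.1
  smul g x h := ⟨(X.obj n).smul g x.1 h, S.smul_mem n g x.1 h x.2⟩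
  anchor_smul g x h := (X.obj n).anchor_smul g x.1 h
  unit_smul x := Subtype.ext ((X.obj n).unit_smul x.1)
  mul_smul g h x hg hx := Subtype.ext ((X.obj n).mul_smul g h x.1 hg hx)
  etale_anchor := (X.obj n).etale_anchor.comp
    (S.isOpen n).isOpenEmbedding_subtypeVal.isLocalHomeomorph
  continuous_smul := by
    refine Continuous.subtype_mk ((X.obj n).continuous_smul.comp (Continuous.subtype_mk
      (f := fun q : {q : G.Arr × {x // x ∈ S.carrier n} // G.s q.1 = (X.obj n).anchor q.2.1} =>
        (q.1.1, q.1.2.1)) ?_ fun q => q.2)) _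
    fun_prop

/-- An open subspace as a semi-simplicial `G`-space. -/
def space (S : OpenSub X) : SemisimplicialGSpace G where
  obj := S.obj
  face n i := GSpace.Hom.ofContinuous (X := S.obj (n + 1)) (Y := S.obj n)
    (fun x => ⟨(X.face n i).toFun x.1, S.face_mem n i x.1 x.2⟩)
    (Continuous.subtype_mk ((X.face n i).etale.continuous.comp continuous_subtype_val) _)
    (fun x => (X.face n i).anchor_map x.1)
    fun g x h => Subtype.ext ((X.face n i).map_smul g x.1 h)
  face_face n i j h x := Subtype.ext (X.face_face n i j h x.1)

/-- The inclusion of an open subspace. -/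
def incl (S : OpenSub X) : Hom S.space X where
  app n := GSpace.Hom.ofContinuous (X := S.obj n) (fun x => x.1) continuous_subtype_val
    (fun _ => rfl) fun _ _ _ => rfl
  face_app _ _ _ := rfl

/-- A morphism with values in an open subspace. -/
def lift {Y : SemisimplicialGSpace G} (S : OpenSub X) (φ : Hom Y X)
    (h : ∀ n y, (φ.app n).toFun y ∈ S.carrier n) : Hom Y S.space where
  app n := GSpace.Hom.ofContinuous (Y := S.obj n) (fun y => ⟨(φ.app n).toFun y, h n y⟩)
    ((φ.app n).etale.continuous.subtype_mk _) (fun y => (φ.app n).anchor_map y)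
    fun g y hy => Subtype.ext ((φ.app n).map_smul g y hy)
  face_app n i y := Subtype.ext (φ.face_app n i y)

/-- The inclusion between two open subspaces. -/
def inclusion {S T : OpenSub X} (h : ∀ n, S.carrier n ⊆ T.carrier n) : Hom S.space T.space :=
  T.lift S.incl fun n x => h n x.2

theorem incl_injective (S : OpenSub X) (n : ℕ) : Function.Injective (S.incl.app n).toFun :=
  Subtype.val_injective

theorem incl_inclusion {S T : OpenSub X} (h : ∀ n, S.carrier n ⊆ T.carrier n) (n : ℕ)
    (x : (S.space.obj n).Coinv) :
    (T.incl.app n).coinvMap (((inclusion h).app n).coinvMap x) = (S.incl.app n).coinvMap x :=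
  (GSpace.coinvMap_eq_comp _ _ _ (fun _ => rfl) x).symm

/-- An element of `ℤ[X_n]_G` comes from every sufficiently large open subspace. -/
theorem exists_coinvMap_incl_eq {n : ℕ} (x : (X.obj n).Coinv) :
    ∃ K : Set (X.obj n).carrier, IsCompact K ∧ ∀ S : OpenSub X, K ⊆ S.carrier n →
      ∃ x', (S.incl.app n).coinvMap x' = x := by
  obtain ⟨a, rfl⟩ := QuotientAddGroup.mk_surjective x
  refine ⟨tsupport a, a.hasCompactSupport, fun S hS => ?_⟩
  obtain ⟨a', rfl⟩ := exists_pushforward_eq (S.incl.app n).etale (S.incl_injective n) a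
    fun x hx => ⟨⟨x, hS hx⟩, rfl⟩
  exact ⟨(a' : (S.space.obj n).Coinv), rfl⟩

/-- An element of the kernel of `ℤ[X_n] → ℤ[X_n]_G` comes from the corresponding kernel of every
sufficiently large open subspace. -/
theorem exists_mem_coinvKer {n : ℕ} {y : C_c((X.obj n).carrier, ℤ)} (hy : y ∈ (X.obj n).coinvKer) :
    ∃ K : Set (X.obj n).carrier, IsCompact K ∧ ∀ S : OpenSub X, K ⊆ S.carrier n →
      ∃ y' ∈ (S.space.obj n).coinvKer,
        pushforward (S.incl.app n).toFun (S.incl.app n).etale y' = y := by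
  induction hy using AddSubgroup.closure_induction with
  | mem y hy =>
    obtain ⟨f, a, rfl⟩ := hy
    refine ⟨tsupport a, a.hasCompactSupport, fun S hS => ?_⟩
    obtain ⟨a', rfl⟩ := exists_pushforward_eq (S.incl.app n).etale (S.incl_injective n) a
      fun x hx => ⟨⟨x, hS hx⟩, rfl⟩
    refine ⟨_, AddSubgroup.subset_closure ⟨f, a', rfl⟩, ?_⟩
    rw [map_sub, GSpace.pushforward_convolve, GSpace.pushforward_convolve]
  | zero => exact ⟨∅, isCompact_empty, fun S _ => ⟨0, AddSubgroup.zero_mem _, map_zero _⟩⟩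
  | add y z _ _ hy hz =>
    obtain ⟨K, hK, h⟩ := hy
    obtain ⟨L, hL, h'⟩ := hz
    refine ⟨K ∪ L, hK.union hL, fun S hS => ?_⟩
    obtain ⟨y', hy', rfl⟩ := h S (Set.subset_union_left.trans hS)
    obtain ⟨z', hz', rfl⟩ := h' S (Set.subset_union_right.trans hS)
    exact ⟨y' + z', AddSubgroup.add_mem _ hy' hz', map_add _ _ _⟩
  | neg y _ hy =>
    obtain ⟨K, hK, h⟩ := hy
    refine ⟨K, hK, fun S hS => ?_⟩
    obtain ⟨y', hy', rfl⟩ := h S hS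
    exact ⟨-y', AddSubgroup.neg_mem _ hy', map_neg _ _⟩

/-- An element of the coinvariants of an open subspace that vanishes in `ℤ[X_n]_G` vanishes in
every sufficiently large open subspace. -/
theorem exists_coinvMap_inclusion_eq_zero {n : ℕ} (S : OpenSub X) (x : (S.space.obj n).Coinv)
    (hx : (S.incl.app n).coinvMap x = 0) :
    ∃ K : Set (X.obj n).carrier, IsCompact K ∧ ∀ (T : OpenSub X)
      (h : ∀ n, S.carrier n ⊆ T.carrier n), K ⊆ T.carrier n →
        ((inclusion h).app n).coinvMap x = 0 := by
  obtain ⟨a, rfl⟩ := QuotientAddGroup.mk_surjective x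
  obtain ⟨K, hK, h⟩ := exists_mem_coinvKer ((QuotientAddGroup.eq_zero_iff _).1 hx)
  refine ⟨K, hK, fun T hT hKT => ?_⟩
  obtain ⟨y', hy', he⟩ := h T hKT
  refine (QuotientAddGroup.eq_zero_iff _).2 ?_
  convert hy'
  refine pushforward_injective (T.incl.app n).etale (T.incl_injective n) ?_
  rw [he, pushforward_comp]
  rfl

variable {ι : Type v} (S : ι → OpenSub X)
  (hS : ∀ n (K : Set (X.obj n).carrier), IsCompact K → ∀ i, ∃ j,
    (∀ n, (S i).carrier n ⊆ (S j).carrier n) ∧ K ⊆ (S j).carrier n)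

include hS

/-- If the open subspaces `S i` exhaust `X`, then every homology class of `X` comes from one of
them. -/
theorem exists_homologyMap_incl_eq [Nonempty ι] {n : ℕ} (c : X.homology n) :
    ∃ i c', (S i).incl.homologyMap n c' = c := by
  obtain ⟨z, rfl⟩ := exists_homologyπ_eq n c
  obtain ⟨K, hK, h⟩ := exists_coinvMap_incl_eq (X := X) (n := n) (X.complex.iCycles n z)
  obtain ⟨i, -, hi⟩ := hS n K hK (Classical.arbitrary ι)
  obtain ⟨x, hx⟩ := h (S i) hi
  -- it suffices to find a cycle in some `S j`
  suffices hx' : ∃ j, ∃ x' : ((S j).space.obj n).Coinv,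
      (∀ k, (S j).space.complex.d n k x' = 0) ∧
        ((S j).incl.app n).coinvMap x' = X.complex.iCycles n z by
    obtain ⟨j, x', hd, hx'⟩ := hx'
    obtain ⟨z', rfl⟩ := exists_iCycles_eq (C := (S j).space.complex) (n := n) x' hd
    refine ⟨j, (S j).space.complex.homologyπ n z', ?_⟩
    refine (homologyMap_homologyπ _ n z').trans (congrArg _ ?_)
    refine iCycles_injective _ n ?_
    rw [iCycles_cyclesMap]
    exact hx'
  have hdz := d_iCycles (C := X.complex) n
  cases n with
  | zero =>
    refine ⟨i, x, fun k => ?_, hx⟩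
    rw [(S i).space.complex.shape 0 k (by simp)]
    rfl
  | succ n =>
    have h0 : ((S i).incl.app n).coinvMap ((S i).space.complex.d (n + 1) n x) = 0 := by
      refine Eq.trans ?_ (hdz n z)
      refine Eq.trans ?_ (congrArg (X.complex.d (n + 1) n) hx)
      exact (complex_d_coinvMap (S i).incl n x).symm
    obtain ⟨L, hL, hL'⟩ := exists_coinvMap_inclusion_eq_zero (S i) _ h0
    obtain ⟨j, hij, hj⟩ := hS n L hL i
    refine ⟨j, ((inclusion hij).app (n + 1)).coinvMap x, fun k => ?_, ?_⟩
    · by_cases hk : k = n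
      · subst hk
        refine Eq.trans ?_ (hL' (S j) hij hj)
        exact complex_d_coinvMap (inclusion hij) k x
      · rw [(S j).space.complex.shape (n + 1) k (by simp; omega)]
        rfl
    · rw [incl_inclusion, hx]

/-- If the open subspaces `S i` exhaust `X`, then a homology class of `S i` that vanishes in `X`
vanishes in some `S j`. -/
theorem exists_homologyMap_inclusion_eq_zero {n : ℕ} {i : ι} (c : (S i).space.homology n)
    (hc : (S i).incl.homologyMap n c = 0) :
    ∃ j, ∃ h : ∀ n, (S i).carrier n ⊆ (S j).carrier n, (inclusion h).homologyMap n c = 0 := by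
  obtain ⟨z, rfl⟩ := exists_homologyπ_eq n c
  have hc' := (homologyπ_eq_zero_iff _).1 ((homologyMap_homologyπ _ n z).symm.trans hc)
  obtain ⟨w, hw⟩ := hc'
  rw [iCycles_cyclesMap] at hw
  obtain ⟨K, hK, h⟩ := exists_coinvMap_incl_eq (X := X) (n := n + 1) w
  obtain ⟨j, hij, hj⟩ := hS (n + 1) K hK i
  obtain ⟨w', hw'⟩ := h (S j) hj
  let x : ((S i).space.obj n).Coinv := (S i).space.complex.iCycles n z
  let dw' : ((S j).space.obj n).Coinv := (S j).space.complex.d (n + 1) n w'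
  have h0 : ((S j).incl.app n).coinvMap (((inclusion hij).app n).coinvMap x - dw') = 0 := by
    rw [map_sub, incl_inclusion, sub_eq_zero]
    refine Eq.trans hw.symm ?_
    refine Eq.trans (congrArg (X.complex.d (n + 1) n) hw'.symm) ?_
    exact complex_d_coinvMap (S j).incl n w'
  obtain ⟨L, hL, hL'⟩ := exists_coinvMap_inclusion_eq_zero (S j) _ h0
  obtain ⟨k, hjk, hk⟩ := hS n L hL j
  have h1 := hL' (S k) hjk hk
  rw [map_sub, sub_eq_zero] at h1
  have hik : ∀ n, (S i).carrier n ⊆ (S k).carrier n := fun n => (hij n).trans (hjk n)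
  refine ⟨k, hik, ?_⟩
  refine (homologyMap_homologyπ _ n z).trans ((homologyπ_eq_zero_iff _).2
    ⟨((inclusion hjk).app (n + 1)).coinvMap w', ?_⟩)
  rw [iCycles_cyclesMap]
  refine Eq.trans ?_ ((GSpace.coinvMap_eq_comp ((inclusion hjk).app n) ((inclusion hij).app n)
    ((inclusion hik).app n) (fun _ => rfl) x).trans h1).symm
  exact complex_d_coinvMap (inclusion hjk) n w'

end OpenSub

end SemisimplicialGSpace

/-! ### The Rips filtration of `EG` -/

namespace AmpleGroupoid

variable {G : AmpleGroupoid.{u}}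

theorem mul_inv_mul_mul {g h k : G.Arr} (h1 : G.s g = G.r h) (h2 : G.s g = G.r k) :
    G.mul (G.inv (G.mul g h)) (G.mul g k) = G.mul (G.inv h) k := by
  rw [inv_mul_eq h1 (G.r_mul _ _ h2).symm, mul_inv_cancel h2]

theorem continuous_difference {n : ℕ} (i j : Fin (n + 1)) :
    Continuous fun γ : G.EGSpace n => G.mul (G.inv (γ.1 i)) (γ.1 j) :=
  continuous_mul (G.continuous_inv.comp (continuous_coord i)) (continuous_coord j) fun γ => by
    rw [G.s_inv, γ.2 i, γ.2 j]

/-- The simplices of `EG_*` all of whose differences `γ_i⁻¹ γ_j` lie in `K`. -/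
def rips (K : TopologicalSpace.CompactOpens G.Arr) : SemisimplicialGSpace.OpenSub G.EG where
  carrier n := {γ : G.EGSpace n | ∀ i j, G.mul (G.inv (γ.1 i)) (γ.1 j) ∈ K}
  isOpen n := by
    have h : IsOpen (⋂ i, ⋂ j, (fun γ : G.EGSpace n => G.mul (G.inv (γ.1 i)) (γ.1 j)) ⁻¹' K) :=
      isOpen_iInter_of_finite fun i => isOpen_iInter_of_finite fun j =>
        K.isOpen.preimage (continuous_difference i j)
    have e : {γ : G.EGSpace n | ∀ i j, G.mul (G.inv (γ.1 i)) (γ.1 j) ∈ K} =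
        ⋂ i, ⋂ j, (fun γ : G.EGSpace n => G.mul (G.inv (γ.1 i)) (γ.1 j)) ⁻¹' K := by
      ext γ
      simp
    rw [← e] at h
    exact h
  smul_mem n g γ h hγ i j := by
    change G.mul (G.inv (G.mul g (γ.1 i))) (G.mul g (γ.1 j)) ∈ K
    rw [mul_inv_mul_mul (h.trans (γ.2 i).symm) (h.trans (γ.2 j).symm)]
    exact hγ i j
  face_mem n i γ hγ _ _ := hγ _ _

theorem rips_exhausting (n : ℕ) (C : Set (G.EG.obj n).carrier) (hC : IsCompact C)
    (K : TopologicalSpace.CompactOpens G.Arr) : ∃ L : TopologicalSpace.CompactOpens G.Arr,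
      (∀ n, (rips K).carrier n ⊆ (rips L).carrier n) ∧ C ⊆ (rips L).carrier n := by
  have hD : IsCompact (⋃ i, ⋃ j, (fun γ : G.EGSpace n => G.mul (G.inv (γ.1 i)) (γ.1 j)) '' C) :=
    isCompact_iUnion fun i => isCompact_iUnion fun j => hC.image (continuous_difference i j)
  obtain ⟨L, hLc, hLo, hL⟩ := exists_isCompact_isOpen_superset hD
  refine ⟨K ⊔ ⟨⟨L, hLc⟩, hLo⟩, fun n γ hγ i j => Or.inl (hγ i j), fun γ hγ i j => Or.inr ?_⟩
  exact hL (Set.mem_iUnion₂.2 ⟨i, j, γ, hγ, rfl⟩)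

end AmpleGroupoid

/-! ### Fundamental domains of compact open principal subgroupoids -/

section FundamentalDomain

variable {G : AmpleGroupoid.{u}} {H : Set G.Arr}

namespace IsCompactOpenSubgroupoid

/-- Every point has a compact open neighbourhood to which `H` restricts trivially. -/
theorem exists_isCompact_isOpen_trivial (hG : G.IsPrincipal) (hH : IsCompactOpenSubgroupoid G H)
    (x : G.Obj) : ∃ V : Set G.Obj, IsCompact V ∧ IsOpen V ∧ x ∈ V ∧
      ∀ h ∈ H, G.r h ∈ V → G.s h ∈ V → h = G.unit (G.r h) := by
  -- the non-unit arrows of `H` form a compact set, which avoids the pair `(x, x)`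
  have hB : IsCompact (H \ Set.range G.unit) :=
    hH.isCompact.diff G.etale_unit.isOpenMap.isOpen_range
  have hcl := (hB.image (G.continuous_r.prodMk G.continuous_s)).isClosed
  have hx : (x, x) ∉ (fun h => (G.r h, G.s h)) '' (H \ Set.range G.unit) := by
    rintro ⟨h, ⟨-, hu⟩, he⟩
    exact hu ⟨_, (hG h ((congrArg Prod.fst he).trans (congrArg Prod.snd he).symm)).symm⟩
  obtain ⟨S, hS, T, hT, hST⟩ := mem_nhds_prod_iff.1 (hcl.isOpen_compl.mem_nhds hx)
  obtain ⟨V, hVc, hVo, hxV, hV⟩ := exists_isCompact_isOpen (inter_mem hS hT)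
  refine ⟨V, hVc, hVo, hxV, fun h hh hr hs => ?_⟩
  by_contra hne
  refine hST (Set.mk_mem_prod (hV hr).1 (hV hs).2) ⟨h, ⟨hh, ?_⟩, rfl⟩
  rintro ⟨y, rfl⟩
  exact hne (by rw [G.r_unit])

/-- A compact open principal subgroupoid `H` has an open fundamental domain: a set that meets each
orbit of `H` in exactly one point. It is built by adding, one after another, the members of a
finite cover by sets on which `H` is trivial, each time without the orbits met before. -/
theorem exists_fundamentalDomain (hG : G.IsPrincipal) (hH : IsCompactOpenSubgroupoid G H) :
    ∃ D : Set G.Obj, IsOpen D ∧ ∀ x, G.unit x ∈ H → ∃! h, h ∈ H ∧ G.r h = x ∧ G.s h ∈ D := by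
  classical
  choose V hVc hVo hxV hV using hH.exists_isCompact_isOpen_trivial hG
  have key : ∀ t : Finset G.Obj, ∃ D : Set G.Obj, IsOpen D ∧ D ⊆ ⋃ x ∈ t, V x ∧
      (∀ h ∈ H, G.r h ∈ D → G.s h ∈ D → h = G.unit (G.r h)) ∧
      ∀ h ∈ H, G.s h ∈ ⋃ x ∈ t, V x → ∃ h' ∈ H, G.r h' = G.r h ∧ G.s h' ∈ D := by
    intro t
    induction t using Finset.induction with
    | empty => exact ⟨∅, isOpen_empty, Set.empty_subset _, by simp, by simp⟩
    | insert x t _ ih =>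
      obtain ⟨D, hDo, hDW, huniq, hex⟩ := ih
      set W := ⋃ x ∈ t, V x with hW
      have hWc : IsCompact W := t.isCompact_biUnion fun x _ => hVc x
      have hsat : IsClosed (G.r '' (H ∩ G.s ⁻¹' W)) :=
        ((hH.isCompact.inter_right (hWc.isClosed.preimage G.continuous_s)).image
          G.continuous_r).isClosed
      refine ⟨D ∪ (V x \ G.r '' (H ∩ G.s ⁻¹' W)), hDo.union ((hVo x).sdiff hsat), ?_, ?_, ?_⟩
      · rw [Finset.set_biUnion_insert, ← hW]
        exact Set.union_subset (hDW.trans Set.subset_union_right)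
          (Set.sdiff_subset.trans Set.subset_union_left)
      · rintro h hh (hr | ⟨hr, hr'⟩) (hs | ⟨hs, hs'⟩)
        · exact huniq h hh hr hs
        · exact (hs' ⟨G.inv h, ⟨hH.inv_mem h hh,
            show G.s (G.inv h) ∈ W from (G.s_inv h).symm ▸ hDW hr⟩, G.r_inv h⟩).elim
        · exact (hr' ⟨h, ⟨hh, hDW hs⟩, rfl⟩).elim
        · exact hV x h hh hr hs
      · intro h hh hs
        rw [Finset.set_biUnion_insert, ← hW] at hs
        have hW' : ∀ k ∈ H, G.s k ∈ W → ∃ h' ∈ H, G.r h' = G.r k ∧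
            G.s h' ∈ D ∪ (V x \ G.r '' (H ∩ G.s ⁻¹' W)) := fun k hk hsk => by
          obtain ⟨h', h1, h2, h3⟩ := hex k hk hsk
          exact ⟨h', h1, h2, Or.inl h3⟩
        by_cases hs' : G.s h ∈ G.r '' (H ∩ G.s ⁻¹' W)
        · obtain ⟨k, ⟨hk, hkW⟩, hkr⟩ := hs'
          obtain ⟨h', h1, h2, h3⟩ := hW' (G.mul h k) (hH.mul_mem h hh k hk hkr.symm)
            ((G.s_mul _ _ hkr.symm).symm ▸ hkW)
          exact ⟨h', h1, h2.trans (G.r_mul _ _ hkr.symm), h3⟩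
        · rcases hs with hs | hs
          · exact ⟨h, hh, rfl, Or.inr ⟨hs, hs'⟩⟩
          · exact hW' h hh hs
  obtain ⟨t, -, ht⟩ := (hH.isCompact.image G.continuous_s).elim_nhds_subcover V
    fun x _ => (hVo x).mem_nhds (hxV x)
  obtain ⟨D, hDo, -, huniq, hex⟩ := key t
  refine ⟨D, hDo, fun x hx => ?_⟩
  obtain ⟨h, hh, hr, hs⟩ := hex _ hx (ht ⟨_, hx, rfl⟩)
  rw [G.r_unit] at hr
  refine ⟨h, ⟨hh, hr, hs⟩, ?_⟩
  rintro k ⟨hk, hkr, hks⟩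
  have hc : G.s (G.inv h) = G.r k := by rw [G.s_inv, hr, hkr]
  have := huniq (G.mul (G.inv h) k) (hH.mul_mem _ (hH.inv_mem _ hh) _ hk hc)
    (by rwa [G.r_mul _ _ hc, G.r_inv]) (by rwa [G.s_mul _ _ hc])
  rw [← AmpleGroupoid.inv_mul_cancel (hr.trans hkr.symm), this, G.r_mul _ _ hc, G.r_inv, G.mul_unit]

end IsCompactOpenSubgroupoid

end FundamentalDomain

/-! ### From the nerve of a colouring to `EG` -/

namespace Colouring

variable {G : AmpleGroupoid.{u}} {C : Colouring G}

variable (C) in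
/-- A continuous equivariant choice of a point in each element of the cover. -/
structure Representative where
  /-- The chosen point. -/
  toFun : C.Cover → G.Arr
  continuous : Continuous toFun
  mem : ∀ U, toFun U ∈ U.set
  map_smul : ∀ (g : G.Arr) (U : C.Cover) (h : G.s g = U.anchor),
    toFun (Cover.smul g U h) = G.mul g (toFun U)

/-- In the principal case, each `U = g G_i^{s(g)}` contains exactly one arrow whose source lies in
a fundamental domain of `G_i`. -/
theorem exists_representative (hG : G.IsPrincipal) : Nonempty C.Representative := by
  choose D hDo hD using fun i => (C.isSub i).exists_fundamentalDomain hG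
  have hex : ∀ U : C.Cover, ∃! k, k ∈ U.set ∧ G.s k ∈ D U.colour := by
    intro U
    obtain ⟨g, hg, hU⟩ := U.exists_set_eq
    obtain ⟨h, ⟨h1, h2, h3⟩, h4⟩ := hD _ _ hg
    refine ⟨G.mul g h, ⟨hU ▸ ⟨h, h1, h2, rfl⟩, (G.s_mul _ _ h2.symm).symm ▸ h3⟩, ?_⟩
    rintro k ⟨hk, hks⟩
    rw [hU] at hk
    obtain ⟨l, hl, hr, rfl⟩ := hk
    rw [G.s_mul _ _ hr.symm] at hks
    rw [h4 l ⟨hl, hr, hks⟩]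
  choose σ hσ huniq using hex
  refine ⟨⟨σ, ?_, fun U => (hσ U).1, ?_⟩⟩
  · refine continuous_def.2 fun O hO => ?_
    have : σ ⁻¹' O = ⋃ i, C.basicOpen i (O ∩ G.s ⁻¹' D i ∩ {g | G.unit (G.s g) ∈ C.sub i}) := by
      ext U
      rw [Set.mem_iUnion]
      constructor
      · intro hU
        exact ⟨U.colour, rfl, σ U, ⟨⟨hU, (hσ U).2⟩, (eq_cls_of_mem (hσ U).1).1⟩,
          Cover.set_eq_of_mem (hσ U).1⟩
      · rintro ⟨i, rfl, g, ⟨⟨hg, hgD⟩, hgu⟩, hU⟩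
        have : g = σ U := huniq U g ⟨hU ▸ self_mem_coset hgu, hgD⟩
        exact show σ U ∈ O from this ▸ hg
    rw [this]
    exact isOpen_iUnion fun i => isOpen_basicOpen ((hO.inter ((hDo i).preimage
      G.continuous_s)).inter (isOpen_units i)) fun g hg => hg.2
  · intro g U h
    refine (huniq (Cover.smul g U h) _ ⟨Cover.mem_smul h (hσ U).1, ?_⟩).symm
    rw [G.s_mul _ _ (h.trans (Cover.r_eq (hσ U).1).symm)]
    exact (hσ U).2

/-- The morphism from the nerve to `EG_*` given by representatives of the vertices. -/
noncomputable def Representative.toEG (σ : C.Representative) :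
    SemisimplicialGSpace.Hom C.nerve G.EG where
  app n := GSpace.Hom.ofContinuous (X := C.nerveObj n) (Y := G.EGObj n)
    (fun U => ⟨fun j => σ.toFun (U.1 j), fun j => by
      rw [Cover.r_eq (σ.mem _), Cover.r_eq (σ.mem _), U.anchor_eq]⟩)
    (Continuous.subtype_mk (continuous_pi fun j => σ.continuous.comp (continuous_coord j)) _)
    (fun U => Cover.r_eq (σ.mem _))
    fun g U h => Subtype.ext (funext fun j =>
      σ.map_smul g (U.1 j) (Eq.trans h (NerveSpace.anchor_eq U j).symm))
  face_app _ _ _ := rfl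

variable (C) in
/-- The products of two arrows in the subgroupoids of a colouring lie in a compact open set. -/
theorem exists_compactOpens : ∃ K : TopologicalSpace.CompactOpens G.Arr,
    ∀ i j, ∀ g ∈ C.sub i, ∀ h ∈ C.sub j, G.s g = G.r h → G.mul g h ∈ K := by
  have hcl : IsClosed {q : G.Arr × G.Arr | G.s q.1 = G.r q.2} :=
    isClosed_eq (G.continuous_s.comp continuous_fst) (G.continuous_r.comp continuous_snd)
  have hc : IsCompact (⋃ i, ⋃ j, (fun q : G.Arr × G.Arr => G.mul q.1 q.2) ''
      (C.sub i ×ˢ C.sub j ∩ {q | G.s q.1 = G.r q.2})) :=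
    isCompact_iUnion fun i => isCompact_iUnion fun j =>
      (((C.isSub i).isCompact.prod (C.isSub j).isCompact).inter_right hcl).image_of_continuousOn
        (G.continuousOn_mul.mono Set.inter_subset_right)
  obtain ⟨K, hKc, hKo, hK⟩ := exists_isCompact_isOpen_superset hc
  exact ⟨⟨⟨K, hKc⟩, hKo⟩, fun i j g hg h hh hgh => hK (Set.mem_iUnion₂.2
    ⟨i, j, (g, h), ⟨⟨hg, hh⟩, hgh⟩, rfl⟩)⟩

theorem Representative.toEG_mem_rips (σ : C.Representative)
    {K : TopologicalSpace.CompactOpens G.Arr}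
    (hK : ∀ i j, ∀ g ∈ C.sub i, ∀ h ∈ C.sub j, G.s g = G.r h → G.mul g h ∈ K) (n : ℕ)
    (U : C.NerveSpace n) : (σ.toEG.app n).toFun U ∈ (AmpleGroupoid.rips K).carrier n := by
  intro i j
  obtain ⟨g, hg⟩ := U.2
  rw [Set.mem_iInter] at hg
  change G.mul (G.inv (σ.toFun (U.1 i))) (σ.toFun (U.1 j)) ∈ K
  have h1 := σ.mem (U.1 i)
  have h2 := hg i
  have h3 := σ.mem (U.1 j)
  rw [Cover.set_eq_of_mem h1, mem_coset_iff] at h2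
  rw [Cover.set_eq_of_mem (hg j), mem_coset_iff] at h3
  have h4 : G.s (G.inv g) = G.r (σ.toFun (U.1 j)) := by rw [G.s_inv, h3.1]
  -- `σ(U_i)⁻¹ σ(U_j) = (σ(U_i)⁻¹ g) (g⁻¹ σ(U_j))` for a common point `g` of `U_i` and `U_j`
  have h5 := hK _ _ _ h2.2 _ h3.2 (by
    rw [G.s_mul _ _ ((G.s_inv _).trans h2.1.symm), G.r_mul _ _ h4, G.r_inv])
  rwa [G.mul_assoc _ _ _ ((G.s_inv _).trans h2.1.symm) (by rw [G.r_mul _ _ h4, G.r_inv]),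
    AmpleGroupoid.inv_mul_cancel h3.1.symm] at h5

end Colouring

/-! ### Prisms of tuples -/

section Prism

variable {V : Type u}

/-- The tuple `(a_0, …, a_i, b_i, …, b_n)`. -/
def prism {n : ℕ} (a b : Fin (n + 1) → V) (i : Fin (n + 1)) (k : Fin (n + 2)) : V :=
  if i.castSucc < k then b (i.predAbove k) else a (i.predAbove k)

theorem prism_cases {n : ℕ} {a b : Fin (n + 1) → V} {P : V → Prop} (ha : ∀ j, P (a j))
    (hb : ∀ j, P (b j)) (i : Fin (n + 1)) (k : Fin (n + 2)) : P (prism a b i k) := by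
  unfold prism
  split_ifs
  exacts [hb _, ha _]

theorem prism_map {W : Type v} {n : ℕ} {a b : Fin (n + 1) → V} {a' b' : Fin (n + 1) → W}
    {R : V → W → Prop} (ha : ∀ j, R (a j) (a' j)) (hb : ∀ j, R (b j) (b' j)) (i : Fin (n + 1))
    (k : Fin (n + 2)) : R (prism a b i k) (prism a' b' i k) := by
  unfold prism
  split_ifs
  exacts [hb _, ha _]

theorem continuous_prism {T : Type v} [TopologicalSpace T] [TopologicalSpace V] {n : ℕ}
    {a b : T → Fin (n + 1) → V} (ha : ∀ j, Continuous fun t => a t j)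
    (hb : ∀ j, Continuous fun t => b t j) (i : Fin (n + 1)) (k : Fin (n + 2)) :
    Continuous fun t => prism (a t) (b t) i k := by
  unfold prism
  split_ifs
  exacts [hb _, ha _]

theorem val_predAbove {n : ℕ} (i : Fin n) (k : Fin (n + 1)) :
    (i.predAbove k : ℕ) = if (i : ℕ) < k then (k : ℕ) - 1 else k := by
  simp only [Fin.predAbove, Fin.lt_def, Fin.val_castSucc]
  split_ifs <;> simp

theorem val_succAbove {n : ℕ} (p : Fin (n + 1)) (k : Fin n) :
    (p.succAbove k : ℕ) = if (k : ℕ) < p then (k : ℕ) else k + 1 := by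
  simp only [Fin.succAbove, Fin.lt_def, Fin.val_castSucc]
  split_ifs <;> simp

theorem prism_zero_face {n : ℕ} (a b : Fin (n + 1) → V) (l : Fin (n + 1)) :
    prism a b 0 (Fin.succAbove 0 l) = b l := by
  simp [prism]

theorem prism_last_face {n : ℕ} (a b : Fin (n + 1) → V) (l : Fin (n + 1)) :
    prism a b (Fin.last n) ((Fin.last _).succAbove l) = a l := by
  have : ¬ Fin.last n < l := not_lt.2 l.le_last
  simp [prism, this]

theorem prism_diag_face {n : ℕ} (a b : Fin (n + 2) → V) (i : Fin (n + 1)) (l : Fin (n + 2)) :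
    prism a b i.succ (i.succ.castSucc.succAbove l) =
      prism a b i.castSucc (i.castSucc.succ.succAbove l) := by
  have h1 : (i.succ.castSucc < i.succ.castSucc.succAbove l) ↔
      (i.castSucc.castSucc < i.castSucc.succ.succAbove l) := by
    simp only [Fin.lt_def, val_succAbove, Fin.val_succ, Fin.val_castSucc]
    split_ifs <;> omega
  have h2 : i.succ.predAbove (i.succ.castSucc.succAbove l) =
      i.castSucc.predAbove (i.castSucc.succ.succAbove l) := by
    ext
    simp only [val_succAbove, val_predAbove, Fin.val_succ, Fin.val_castSucc]
    split_ifs <;> omega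
  rw [prism, prism, h2]
  simp only [h1]

theorem prism_face_of_le {n : ℕ} (a b : Fin (n + 2) → V) {k : Fin (n + 2)} {i : Fin (n + 1)}
    (h : k ≤ i.castSucc) (l : Fin (n + 2)) :
    prism a b i.succ (k.castSucc.succAbove l) =
      prism (fun j => a (k.succAbove j)) (fun j => b (k.succAbove j)) i l := by
  rw [Fin.le_def, Fin.val_castSucc] at h
  have h1 : (i.succ.castSucc < k.castSucc.succAbove l) ↔ i.castSucc < l := by
    simp only [Fin.lt_def, val_succAbove, Fin.val_succ, Fin.val_castSucc]
    split_ifs <;> omega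
  have h2 : i.succ.predAbove (k.castSucc.succAbove l) = k.succAbove (i.predAbove l) := by
    ext
    simp only [val_succAbove, val_predAbove, Fin.val_succ, Fin.val_castSucc]
    split_ifs <;> omega
  rw [prism, prism, h2]
  simp only [h1]

theorem prism_face_of_lt {n : ℕ} (a b : Fin (n + 2) → V) {k : Fin (n + 2)} {i : Fin (n + 1)}
    (h : i.castSucc < k) (l : Fin (n + 2)) :
    prism a b i.castSucc (k.succ.succAbove l) =
      prism (fun j => a (k.succAbove j)) (fun j => b (k.succAbove j)) i l := by
  rw [Fin.lt_def, Fin.val_castSucc] at h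
  have h1 : (i.castSucc.castSucc < k.succ.succAbove l) ↔ i.castSucc < l := by
    simp only [Fin.lt_def, val_succAbove, Fin.val_succ, Fin.val_castSucc]
    split_ifs <;> omega
  have h2 : i.castSucc.predAbove (k.succ.succAbove l) = k.succAbove (i.predAbove l) := by
    ext
    simp only [val_succAbove, val_predAbove, Fin.val_succ, Fin.val_castSucc]
    split_ifs <;> omega
  rw [prism, prism, h2]
  simp only [h1]

end Prism

variable {G : AmpleGroupoid.{u}}

open SemisimplicialGSpace

/-- A prism homotopy between morphisms to a semi-simplicial `G`-space whose simplices are tuples,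
with faces omitting an entry: it suffices to provide equivariant étale maps that are given by
prisms in coordinates. -/
def SemisimplicialGSpace.PrismHomotopy.ofCoord {X Y : SemisimplicialGSpace G} {V : Type v}
    (coord : ∀ n, (Y.obj n).carrier → Fin (n + 1) → V)
    (hinj : ∀ n, Function.Injective (coord n))
    (hface : ∀ n k y, coord n ((Y.face n k).toFun y) = fun j => coord (n + 1) y (k.succAbove j))
    (φ ψ : Hom X Y) (h : ∀ n, Fin (n + 1) → GSpace.Hom (X.obj n) (Y.obj (n + 1)))
    (hh : ∀ n i x, coord (n + 1) ((h n i).toFun x) =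
      prism (coord n ((φ.app n).toFun x)) (coord n ((ψ.app n).toFun x)) i) :
    PrismHomotopy φ ψ where
  h := h
  face_zero n x := hinj _ (by
    rw [hface, hh]
    exact funext fun l => prism_zero_face _ _ l)
  face_last n x := hinj _ (by
    rw [hface, hh]
    exact funext fun l => prism_last_face _ _ l)
  face_diag n i x := hinj _ (by
    rw [hface, hface, hh, hh]
    exact funext fun l => prism_diag_face _ _ i l)
  face_le n k i hk x := hinj _ (by
    rw [hface, hh, hh, ← φ.face_app, ← ψ.face_app, hface, hface]
    exact funext fun l => prism_face_of_le _ _ hk l)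
  face_lt n k i hk x := hinj _ (by
    rw [hface, hh, hh, ← φ.face_app, ← ψ.face_app, hface, hface]
    exact funext fun l => prism_face_of_lt _ _ hk l)

/-- Any two morphisms to `EG_*` are homotopic, since every tuple of arrows with a common range is
a simplex. -/
theorem AmpleGroupoid.homologyMap_eq {X : SemisimplicialGSpace G} (φ ψ : Hom X G.EG) (n : ℕ) :
    φ.homologyMap n = ψ.homologyMap n := by
  have hr : ∀ (χ : Hom X G.EG) n (x : (X.obj n).carrier) j,
      G.r (((χ.app n).toFun x).1 j) = (X.obj n).anchor x := fun χ n x j =>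
    (((χ.app n).toFun x).2 j).trans ((χ.app n).anchor_map x)
  have hp : ∀ n (x : (X.obj n).carrier) i k,
      G.r (prism ((φ.app n).toFun x).1 ((ψ.app n).toFun x).1 i k) = (X.obj n).anchor x :=
    fun n x i k => prism_cases (P := fun g => G.r g = (X.obj n).anchor x) (hr φ n x) (hr ψ n x) i k
  exact (PrismHomotopy.ofCoord (Y := G.EG) (fun n γ => Subtype.val γ)
    (fun n => Subtype.val_injective) (fun _ _ _ => rfl) φ ψ
    (fun n i => GSpace.Hom.ofContinuous (X := X.obj n) (Y := G.EGObj (n + 1))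
      (fun x => ⟨prism ((φ.app n).toFun x).1 ((ψ.app n).toFun x).1 i, fun k =>
        (hp n x i k).trans (hp n x i 0).symm⟩)
      (Continuous.subtype_mk (continuous_pi fun k => continuous_prism
        (fun j => (continuous_coord j).comp (φ.app n).etale.continuous)
        (fun j => (continuous_coord j).comp (ψ.app n).etale.continuous) i k) _)
      (fun x => hp n x i 0)
      fun g x h => Subtype.ext (funext fun k => prism_map (R := fun a b => a = G.mul g b)
        (fun j => congrFun (congrArg Subtype.val ((φ.app n).map_smul g x h)) j)
        (fun j => congrFun (congrArg Subtype.val ((ψ.app n).map_smul g x h)) j) i k))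
    fun _ _ _ => rfl).homologyMap_eq n

namespace Colouring

variable {C C' : Colouring G}

/-- Contiguous morphisms to the nerve of a colouring are homotopic. -/
theorem homologyMap_eq {X : SemisimplicialGSpace G} (φ ψ : Hom X C.nerve)
    (hc : ∀ n (x : (X.obj n).carrier), ∃ g, ∀ j, g ∈ (((φ.app n).toFun x).1 j).set ∧
      g ∈ (((ψ.app n).toFun x).1 j).set) (n : ℕ) :
    φ.homologyMap n = ψ.homologyMap n := by
  have hr : ∀ (χ : Hom X C.nerve) n (x : (X.obj n).carrier) j,
      (((χ.app n).toFun x).1 j).anchor = (X.obj n).anchor x := fun χ n x j =>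
    (NerveSpace.anchor_eq _ j).trans ((χ.app n).anchor_map x)
  have hs : ∀ (χ : Hom X C.nerve) n g (x : (X.obj n).carrier) (h : G.s g = (X.obj n).anchor x) j,
      ∃ h', ((χ.app n).toFun ((X.obj n).smul g x h)).1 j =
        Cover.smul g (((χ.app n).toFun x).1 j) h' := fun χ n g x h j =>
    ⟨h.trans (hr χ n x j).symm, congrFun (congrArg Subtype.val ((χ.app n).map_smul g x h)) j⟩
  have hne : ∀ n (x : (X.obj n).carrier) i,
      (⋂ k, (prism ((φ.app n).toFun x).1 ((ψ.app n).toFun x).1 i k).set).Nonempty :=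
    fun n x i => (hc n x).imp fun g hg => Set.mem_iInter.2 fun k =>
      prism_cases (P := fun U : C.Cover => g ∈ U.set) (fun j => (hg j).1) (fun j => (hg j).2) i k
  exact (PrismHomotopy.ofCoord (Y := C.nerve) (fun n U => Subtype.val U)
    (fun n => Subtype.val_injective) (fun _ _ _ => rfl) φ ψ
    (fun n i => GSpace.Hom.ofContinuous (X := X.obj n) (Y := C.nerveObj (n + 1))
      (fun x => ⟨prism ((φ.app n).toFun x).1 ((ψ.app n).toFun x).1 i, hne n x i⟩)
      (Continuous.subtype_mk (continuous_pi fun k => continuous_prism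
        (fun j => (continuous_coord j).comp (φ.app n).etale.continuous)
        (fun j => (continuous_coord j).comp (ψ.app n).etale.continuous) i k) _)
      (fun x => prism_cases (P := fun U : C.Cover => U.anchor = (X.obj n).anchor x)
        (hr φ n x) (hr ψ n x) i 0)
      fun g x h => Subtype.ext (funext fun k =>
        (prism_map (R := fun a b : C.Cover => ∃ h', a = Cover.smul g b h')
          (hs φ n g x h) (hs ψ n g x h) i k).choose_spec))
    fun _ _ _ => rfl).homologyMap_eq n

/-! ### From the Rips filtration to the nerves -/

/-- The vertex of the nerve given by an element of the cover. -/
def vertex (U : C.Cover) : C.NerveSpace 0 :=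
  ⟨fun _ => U, U.nonempty.imp fun _ hg => Set.mem_iInter.2 fun _ => hg⟩

/-- A morphism between nerves is determined by its effect on vertices. -/
theorem app_coord (φ : Hom C.nerve C'.nerve) (n : ℕ) (U : C.NerveSpace n) (j : Fin (n + 1)) :
    ((φ.app n).toFun U).1 j = ((φ.app 0).toFun (vertex (U.1 j))).1 0 := by
  induction n with
  | zero =>
    have : Subsingleton (Fin (0 + 1)) := inferInstanceAs (Subsingleton (Fin 1))
    have hj : j = 0 := Subsingleton.elim _ _
    subst hj
    have : U = vertex (U.1 0) :=
      Subtype.ext (funext fun k => congrArg U.1 (Subsingleton.elim _ _))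
    conv_lhs => rw [this]
  | succ n ih =>
    obtain ⟨i, hi⟩ := exists_ne j
    obtain ⟨k, rfl⟩ := Fin.exists_succAbove_eq hi.symm
    have h := congrFun (congrArg Subtype.val (φ.face_app n i U)) k
    exact h.trans (ih ((C.nerve.face n i).toFun U) k)

variable (C) in
/-- A continuous equivariant map from `G` to the cover with `g ∈ κ(g)`: the colour of `κ(g)` is
the first one available at `s(g)`. -/
theorem exists_arrow_to_cover : ∃ κ : G.Arr → C.Cover, Continuous κ ∧ (∀ g, g ∈ (κ g).set) ∧
    ∀ (g k : G.Arr) (_h : G.s g = G.r k) (h' : G.s g = (κ k).anchor),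
      κ (G.mul g k) = Cover.smul g (κ k) h' := by
  have hmin : ∀ x, ∃ i, G.unit x ∈ C.sub i ∧ ∀ j < i, G.unit x ∉ C.sub j := by
    intro x
    obtain ⟨i, hi, hmin⟩ := WellFounded.has_min (α := Fin (C.d + 1)) wellFounded_lt
      {i | G.unit x ∈ C.sub i} (C.cover x)
    exact ⟨i, hi, fun j hj hj' => hmin j hj' hj⟩
  choose c hc hcmin using hmin
  have hco : ∀ i, IsOpen {g | c (G.s g) = i} := by
    intro i
    have : {g | c (G.s g) = i} = {g | G.unit (G.s g) ∈ C.sub i} ∩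
        ⋂ j, ⋂ _ : j < i, {g | G.unit (G.s g) ∈ C.sub j}ᶜ := by
      ext g
      simp only [Set.mem_ofPred_eq, Set.mem_inter_iff, Set.mem_iInter, Set.mem_compl_iff]
      constructor
      · rintro rfl
        exact ⟨hc _, hcmin _⟩
      · rintro ⟨h1, h2⟩
        rcases lt_trichotomy (c (G.s g)) i with h | h | h
        · exact (h2 _ h (hc _)).elim
        · exact h
        · exact (hcmin _ _ h h1).elim
    rw [this]
    exact (isOpen_units i).inter (isOpen_iInter_of_finite fun j =>
      isOpen_iInter_of_finite fun _ => ((C.isSub j).isCompact.isClosed.preimage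
        (G.continuous_unit.comp G.continuous_s)).isOpen_compl)
  refine ⟨fun g => C.cls (c (G.s g)) g (hc _), ?_, fun g => mem_cls _, ?_⟩
  · refine continuous_iff_continuousAt.2 fun g => ?_
    set i := c (G.s g) with hi
    refine ContinuousOn.continuousAt (s := {g | c (G.s g) = i}) ?_ ((hco i).mem_nhds hi.symm)
    rw [continuousOn_iff_continuous_domRestrict]
    have hcont := (continuous_cls (C := C) i).comp (Continuous.subtype_mk
      (f := fun g' : {g | c (G.s g) = i} => g'.1) continuous_subtype_val
      fun g' => (Set.ext_iff.1 (congrArg C.sub g'.2) (G.unit (G.s g'.1))).1 (hc (G.s g'.1)))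
    refine hcont.congr fun g' => Cover.ext ?_ ?_
    · change C.coset i g'.1 = C.coset (c (G.s g'.1)) g'.1
      rw [show c (G.s g'.1) = i from g'.2]
    · exact g'.2.symm
  · intro g k h h'
    have hs := G.s_mul g k h
    refine Cover.ext ?_ ?_
    · change C.coset (c (G.s (G.mul g k))) (G.mul g k) = G.mul g '' C.coset (c (G.s k)) k
      rw [hs, smul_image h]
    · change c (G.s (G.mul g k)) = c (G.s k)
      rw [hs]

/-- A morphism between nerves which enlarges every `U` to a set containing `U K` gives a morphism
from the Rips space of `K` to the nerve: the simplices `γ` go to tuples of sets containing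
`γ_j K`, which all contain `γ_0`. -/
theorem exists_ripsToNerve (φ : Hom C.nerve C'.nerve) (K : TopologicalSpace.CompactOpens G.Arr)
    (hK : ∀ U : (C.nerve.obj 0).carrier, setMul G (vertexSet U) K ⊆
      vertexSet ((φ.app 0).toFun U)) :
    ∃ τ : Hom (AmpleGroupoid.rips (G := G) K).space C'.nerve,
      ∀ n (γ : ((AmpleGroupoid.rips (G := G) K).space.obj n).carrier) j k, k ∈ K →
        G.s (γ.1.1 j) = G.r k → G.mul (γ.1.1 j) k ∈ (((τ.app n).toFun γ).1 j).set := by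
  obtain ⟨κ, hκ, hκm, hκs⟩ := C.exists_arrow_to_cover
  let θ : G.Arr → C'.Cover := fun g => ((φ.app 0).toFun (vertex (κ g))).1 0
  have hvert : Continuous (vertex (C := C)) :=
    Continuous.subtype_mk (continuous_pi fun _ => continuous_id) _
  have hθ : Continuous θ :=
    (continuous_coord 0).comp ((φ.app 0).etale.continuous.comp (hvert.comp hκ))
  have hθK : ∀ g, ∀ k ∈ K, G.s g = G.r k → G.mul g k ∈ (θ g).set := fun g k hk h =>
    hK (vertex (κ g)) ⟨g, hκm g, k, hk, h, rfl⟩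
  have hθa : ∀ g, (θ g).anchor = G.r g := fun g =>
    ((φ.app 0).anchor_map (vertex (κ g))).trans (Cover.r_eq (hκm g)).symm
  have hθs : ∀ g k (h : G.s g = G.r k), θ (G.mul g k) =
      Cover.smul g (θ k) (h.trans (hθa k).symm) := fun g k h => by
    have h' : G.s g = (κ k).anchor := h.trans (Cover.r_eq (hκm k))
    have h1 : vertex (κ (G.mul g k)) = (C.nerve.obj 0).smul g (vertex (κ k)) h' :=
      Subtype.ext (funext fun _ => hκs g k h h')
    have h2 := (φ.app 0).map_smul g (vertex (κ k)) h'
    rw [← h1] at h2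
    exact congrFun (congrArg Subtype.val h2) 0
  let S := AmpleGroupoid.rips (G := G) K
  have hr : ∀ n (γ : (S.space.obj n).carrier) j, G.r (γ.1.1 j) = G.r (γ.1.1 0) :=
    fun n γ j => γ.1.2 j
  refine ⟨{ app := fun n => GSpace.Hom.ofContinuous (X := S.obj n) (Y := C'.nerveObj n)
              (fun γ => ⟨fun j => θ (γ.1.1 j), γ.1.1 0, Set.mem_iInter.2 fun j => ?_⟩)
              (Continuous.subtype_mk (continuous_pi fun j =>
                hθ.comp ((continuous_coord j).comp continuous_subtype_val)) _)
              (fun γ => hθa _) (fun g γ h => Subtype.ext (funext fun j =>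
                hθs g (γ.1.1 j) (Eq.trans h (hr n γ j).symm)))
            face_app := fun _ _ _ => rfl }, fun n γ j k hk h => hθK _ k hk h⟩
  -- `γ_0 = γ_j (γ_j⁻¹ γ_0)` and `γ_j⁻¹ γ_0 ∈ K`
  have h0 : G.r (γ.1.1 j) = G.r (γ.1.1 0) := hr n γ j
  have h := hθK (γ.1.1 j) _ (γ.2 j 0) (by
    rw [G.r_mul _ _ ((G.s_inv _).trans h0), G.r_inv])
  rwa [AmpleGroupoid.inv_mul_cancel h0] at h

end Colouring

/-! ### The homology of an anti-Čech sequence -/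

namespace AntiCechSequence

variable (A : AntiCechSequence G)

/-- The direct system of homology groups. -/
noncomputable abbrev system (n : ℕ) : ℕ ⥤ AddCommGrpCat.{u} :=
  Functor.ofSequence (X := fun m => (A.colouring m).homology n) fun m => (A.map m).homologyMap n

theorem subset_map_app (m n : ℕ) (U : (A.colouring m).NerveSpace n) (j : Fin (n + 1)) :
    (U.1 j).set ⊆ ((((A.map m).app n).toFun U).1 j).set := by
  rw [Colouring.app_coord]
  exact A.subset_map m (Colouring.vertex (U.1 j))

/-- The iterated morphisms of the sequence. -/
theorem exists_iterate (m k : ℕ) :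
    ∃ ψ : Hom (A.colouring m).nerve (A.colouring (m + k + 1)).nerve,
      (∀ n (U : (A.colouring m).NerveSpace n) j,
        (U.1 j).set ⊆ (((ψ.app n).toFun U).1 j).set) ∧
      ∀ n, ψ.homologyMap n = (A.system n).map (homOfLE (by omega : m ≤ m + k + 1)) := by
  induction k with
  | zero =>
    refine ⟨A.map m, A.subset_map_app m, fun n => ?_⟩
    exact (Functor.ofSequence_map_homOfLE_succ
      (fun m => (A.map m).homologyMap n) m).symm
  | succ k ih =>
    obtain ⟨ψ, h1, h2⟩ := ih
    refine ⟨(A.map (m + k + 1)).comp ψ, fun n U j => (h1 n U j).trans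
      (A.subset_map_app (m + k + 1) n ((ψ.app n).toFun U) j), fun n => ?_⟩
    rw [homologyMap_comp, h2, ← homOfLE_comp (by omega : m ≤ m + k + 1)
      (by omega : m + k + 1 ≤ m + k + 1 + 1), Functor.map_comp]
    congr 1
    exact (Functor.ofSequence_map_homOfLE_succ
      (fun m => (A.map m).homologyMap n) (m + k + 1)).symm

/-- The comparison maps `H_n(C_m) → H_n(EG)` given by representatives of the vertices. -/
noncomputable def toEG (σ : ∀ m, (A.colouring m).Representative) (n : ℕ) :
    A.homology n ⟶ G.EG.homology n :=
  Limits.colimit.desc (A.system n) ⟨G.EG.homology n,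
    NatTrans.ofSequence (fun m => (σ m).toEG.homologyMap n) fun m => by
      refine Eq.trans (congrArg (· ≫ (σ (m + 1)).toEG.homologyMap n)
        (Functor.ofSequence_map_homOfLE_succ (fun m => (A.map m).homologyMap n) m)) ?_
      refine Eq.trans ?_ (Category.comp_id _).symm
      refine (homologyMap_comp _ _ _).symm.trans ?_
      exact AmpleGroupoid.homologyMap_eq _ _ n⟩

theorem toEG_ι (σ : ∀ m, (A.colouring m).Representative) (n m : ℕ)
    (c : (A.colouring m).homology n) :
    A.toEG σ n (Limits.colimit.ι (A.system n) m c) = (σ m).toEG.homologyMap n c := by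
  refine (ConcreteCategory.comp_apply _ _ _).symm.trans (congrArg (fun f => f c)
    (congrArg ConcreteCategory.hom (?_ : Limits.colimit.ι (A.system n) m ≫ A.toEG σ n = _)))
  exact Limits.colimit.ι_desc _ _

/-- From some stage on, the Rips space of `K` maps to the nerves of the sequence. -/
theorem exists_ripsToNerve (K : TopologicalSpace.CompactOpens G.Arr) (m : ℕ) :
    ∃ k, ∃ τ : Hom (AmpleGroupoid.rips (G := G) K).space (A.colouring (m + k + 1)).nerve,
      ∀ n (γ : ((AmpleGroupoid.rips (G := G) K).space.obj n).carrier) j k, k ∈ K →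
        G.s (γ.1.1 j) = G.r k → G.mul (γ.1.1 j) k ∈ (((τ.app n).toFun γ).1 j).set := by
  obtain ⟨m₀, h⟩ := A.absorbing K K.isCompact K.isOpen
  exact ⟨m₀, Colouring.exists_ripsToNerve (A.map (m + m₀)) K (h (m + m₀) (by omega))⟩

/-- A class of `EG` comes from a Rips space, which maps to some nerve; the composition back to
`EG` is homotopic to the inclusion. -/
theorem toEG_surjective (σ : ∀ m, (A.colouring m).Representative) (n : ℕ) :
    Function.Surjective (A.toEG σ n) := by
  intro c
  have : Nonempty (TopologicalSpace.CompactOpens G.Arr) := ⟨⊥⟩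
  obtain ⟨K, c', rfl⟩ := OpenSub.exists_homologyMap_incl_eq
    (AmpleGroupoid.rips (G := G)) AmpleGroupoid.rips_exhausting c
  obtain ⟨k, τ, -⟩ := A.exists_ripsToNerve K 0
  refine ⟨Limits.colimit.ι (A.system n) (0 + k + 1) (τ.homologyMap n c'), ?_⟩
  refine (A.toEG_ι σ n _ _).trans ((homologyMap_comp_apply _ _ n c').symm.trans ?_)
  exact congrArg (fun f => f c') (congrArg ConcreteCategory.hom
    (AmpleGroupoid.homologyMap_eq ((σ (0 + k + 1)).toEG.comp τ) (AmpleGroupoid.rips K).incl n))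

/-- A class of the nerve `N` of a colouring that dies in `EG` already dies in a Rips space of a
large `K`, hence in a later nerve `N'`. The composition `N → EG → N'` through this Rips space is
contiguous to the structure map of the sequence: both enlarge every `U`, the former because
`U = σ(U) G_i` is contained in `σ(U) K`. -/
theorem exists_map_eq_zero (σ : ∀ m, (A.colouring m).Representative) {n m : ℕ}
    (c : (A.colouring m).nerve.homology n) (hc : (σ m).toEG.homologyMap n c = 0) :
    ∃ m', ∃ h : m ≤ m', (A.system n).map (homOfLE h) c = 0 := by
  obtain ⟨K, hK⟩ := (A.colouring m).exists_compactOpens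
  let φ := (AmpleGroupoid.rips K).lift (σ m).toEG ((σ m).toEG_mem_rips hK)
  have hφ : (AmpleGroupoid.rips K).incl.homologyMap n (φ.homologyMap n c) = 0 := by
    refine (homologyMap_comp_apply _ _ n c).symm.trans ?_
    exact (congrArg (fun f => f c) (congrArg ConcreteCategory.hom
      (AmpleGroupoid.homologyMap_eq _ (σ m).toEG n))).trans hc
  obtain ⟨L, hKL, h0⟩ := OpenSub.exists_homologyMap_inclusion_eq_zero
    (AmpleGroupoid.rips (G := G)) AmpleGroupoid.rips_exhausting _ hφ
  -- the final Rips parameter contains the subgroupoids of the colouring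
  obtain ⟨k, τ, hτ⟩ := A.exists_ripsToNerve (L ⊔ K) m
  obtain ⟨ψ, hψ, hψm⟩ := A.exists_iterate m k
  have hL : ∀ n, (AmpleGroupoid.rips L).carrier n ⊆ (AmpleGroupoid.rips (L ⊔ K)).carrier n :=
    fun n γ hγ i j => Or.inl (hγ i j)
  let χ := τ.comp ((OpenSub.inclusion hL).comp ((OpenSub.inclusion hKL).comp φ))
  have hχ : ψ.homologyMap n = χ.homologyMap n := by
    refine Colouring.homologyMap_eq _ _ (fun n (U : (A.colouring m).NerveSpace n) => ?_) n
    obtain ⟨g, hg⟩ := U.2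
    rw [Set.mem_iInter] at hg
    refine ⟨g, fun j => ⟨hψ n U j (hg j), ?_⟩⟩
    have h1 := (σ m).mem (U.1 j)
    have h2 := hg j
    rw [Colouring.Cover.set_eq_of_mem h1] at h2
    obtain ⟨l, hl, hr, rfl⟩ := h2
    refine hτ n _ j l (Or.inr ?_) hr.symm
    rw [← G.mul_unit l]
    refine hK (U.1 j).colour (U.1 j).colour l hl _ ?_ (G.r_unit _).symm
    rw [← G.inv_mul]
    exact ((A.colouring m).isSub _).mul_mem _ (((A.colouring m).isSub _).inv_mem _ hl) _ hl
      (G.s_inv _)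
  refine ⟨m + k + 1, by omega, ?_⟩
  have h1 : χ.homologyMap n c = 0 := by
    rw [homologyMap_comp_apply, homologyMap_comp_apply, homologyMap_comp_apply, h0,
      map_zero, map_zero]
  exact (congrArg (fun f => f c)
    (congrArg ConcreteCategory.hom ((hψm n).symm.trans hχ))).trans h1

theorem toEG_injective (σ : ∀ m, (A.colouring m).Representative) (n : ℕ) :
    Function.Injective (A.toEG σ n) := by
  refine (injective_iff_map_eq_zero (A.toEG σ n).hom).2 fun x hx => ?_
  -- Mathlib states the preservation for index categories in the universe of `G` only
  have : Limits.PreservesFilteredColimitsOfSize.{0, 0} (forget AddCommGrpCat.{u}) :=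
    Limits.preservesFilteredColimitsOfSize_shrink.{0, u, 0, u} _
  obtain ⟨m, c, rfl⟩ := Limits.Concrete.colimit_exists_rep (A.system n) x
  obtain ⟨m', h, h0⟩ := A.exists_map_eq_zero σ c ((A.toEG_ι σ n m c).symm.trans hx)
  rw [← Limits.colimit.w (A.system n) (homOfLE h), ConcreteCategory.comp_apply, h0]
  exact map_zero _

end AntiCechSequence

end AntiCech

theorem mainTheorem9 (G : AntiCech.AmpleGroupoid) [CompactSpace G.Obj]
    [SigmaCompactSpace G.Arr] (hG : G.IsPrincipal) (A : AntiCech.AntiCechSequence G) (n : ℕ) :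
    Nonempty (A.homology n ≅ G.homology n) := by
  let σ := fun m => ((A.colouring m).exists_representative hG).some
  have : CategoryTheory.IsIso (A.toEG σ n) :=
    (CategoryTheory.ConcreteCategory.isIso_iff_bijective _).2
      ⟨A.toEG_injective σ n, A.toEG_surjective σ n⟩
  exact ⟨(CategoryTheory.asIso (A.toEG σ n)).trans
    ((HomologicalComplex.homologyFunctor _ _ n).mapIso (AntiCech.AmpleGroupoid.complexIso G))⟩
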